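/- **Conventions.** Let $L_i,L_j$ be the $4\times4$ matrices of left multiplication by the quaternions $i,j$ on $\mathbb R^4\simeq\mathbb H$, and $\omega(v,w)=\langle L_iv,w\rangle$. Let $\mathcal G=\{(G,T): G\in SO(4),\ GL_i=L_iG,\ T\in\mathbb R^4\}$ with $(G,T)(G',T')=(GG',GT'+T)$; $\mathcal G^{\mathbb C}$ is its complexification (complex $T$; complex $G$ with $G^{T}G=1$, $GL_i=L_iG$); $\mathcal G_0\simeq SU(2)$ is the group of right multiplications by unit quaternions. Let $\tau(G,T)=(-L_jGL_j,-L_jT)$, acting by the same formula on the complexified Lie algebra $\mathfrak g^{\mathbb C}$, and let $[\cdot]_k$ be the projection on the $i^k$-eigenspace of $\tau$. Put $\epsilon=\frac12(1,0,-i,0)^T$, $\bar\epsilon=\frac12(1,0,i,0)^T$, and let $\epsilon_1,\dots,\epsilon_4$ be the standard basis of $\mathbb R^4$. Fix $s>1/2$. $\Lambda\mathcal G^{\mathbb C}_\tau$ is the group of $H^s$ loops $g:S^1\to\mathcal G^{\mathbb C}$ with $g_{i\lambda}=\tau(g_\lambda)$, where $H^s$ means continuous with $\sum_k(1+k^2)^s|\hat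 g_k|^2<\infty$. $\Lambda^+\mathcal G^{\mathbb C}_\tau$ consists of the $g\in\Lambda\mathcal G^{\mathbb C}_\tau$ extending holomorphically to the unit disk (continuously up to the circle, with values in $\mathcal G^{\mathbb C}$), and $\Lambda^-_\star\mathcal G^{\mathbb C}_\tau$ of those extending in the same sense to the complement of the disk in $\mathbb C\cup\{\infty\}$, with value $1$ at $\infty$. $\Lambda\mathbb C^4_\tau$ is the space of $H^s$ loops $V:S^1\to\mathbb C^4$ with $V_{i\lambda}=-L_jV_\lambda$. For $V_\lambda=\sum_k\hat V_k\lambda^k$ put $Q^-(V)=\sum_{k<0}\hat V_k\lambda^k$ and $Q^+(V)=\sum_{k\ge0}\hat V_k\lambda^k$. Let $\Omega\subset\mathbb C$ be open and simply connected, $z_0\in\Omega$. A *lifted conformal Lagrangian immersion* (LCLI) is a smooth map $U=(F,X):\Omega\to\mathcal G$ with $U(z_0)=(1,0)$ and $F^{-1}dX=e^fK(\epsilon_1dx+\epsilon_3dy)$ for some smooth $f:\Omega\to\mathbb R$, $K:\Omega\to\mathcal G_0$. Its Lagrangian angle is the smooth $\beta:\Omega\to\mathbb R$ with $\beta(z_0)=0$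 and $e^{i\beta}=(dx^1+i\,dx^2)\wedge(dx^3+i\,dx^4)\big(\tfrac{\partial_xX}{|\partial_xX|},\tfrac{\partial_yX}{|\partial_yX|}\big)$. It is *Hamiltonian stationary* if $\frac{d}{dt}\big|_{t=0}\mathrm{Area}(X+tV)=0$ (area taken over the compact support of $V$) for every $V\in C^\infty_c(\Omega,\mathbb R^4)$ with $\omega(V,dX)=dh$ for some $h\in C_c^\infty(\Omega,\mathbb R)$. Let $\alpha=U^{-1}dU$, $\alpha_k=[\alpha]_k$, with $(1,0)$- and $(0,1)$-parts $\alpha_k'$, $\alpha_k''$, and $\alpha_\lambda=\lambda^{-2}\alpha_2'+\lambda^{-1}\alpha_{-1}'+\alpha_0+\lambda\alpha_1''+\lambda^2\alpha_2''$. The *extended lift* of $U$ is the family of smooth maps $U_\lambda=(F_\lambda,X_\lambda):\Omega\to\mathcal G$, $\lambda\in S^1$, with $dU_\lambda=U_\lambda\alpha_\lambda$ and $U_\lambda(z_0)=(1,0)$. **Theorem.** Let $U_\lambda=(F_\lambda,X_\lambda)$ be the extended lift of a Hamiltonian stationary LCLI $U$ on $\Omega$ with Lagrangian angle $\beta$.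 There is a smooth function $\gamma:\Omega\to\mathbb R$ with $\gamma(z_0)=0$ and $d\big(\tfrac12(\beta+i\gamma)\big)=\frac{\partial\beta}{\partial z}dz$; and for any such $\gamma$ the following hold. 1. For every $z\in\Omega$ the loop $\lambda\mapsto e^{-\frac{\lambda^{-2}}4(\beta+i\gamma)L_i}X_\lambda$ lies in $\Lambda\mathbb C^4_\tau$, and there are unique $U^-_\lambda(z)\in\Lambda^-_\star\mathcal G^{\mathbb C}_\tau$ and $U^+_\lambda(z)\in\Lambda^+\mathcal G^{\mathbb C}_\tau$ with $U_\lambda(z)=U^-_\lambda(z)U^+_\lambda(z)$ for all $\lambda\in S^1$. They are $$U^-_\lambda=\Big(e^{\frac{\lambda^{-2}}4(\beta+i\gamma)L_i},\ e^{\frac{\lambda^{-2}}4(\beta+i\gamma)L_i}\,Q^-\big(e^{-\frac{\lambda^{-2}}4(\beta+i\gamma)L_i}X_\lambda\big)\Big),$$ $$U^+_\lambda=\Big(e^{-\frac{\lambda^{-2}}4(\beta+i\gamma)L_i}F_\lambda,\ Q^+\big(e^{-\frac{\lambda^{-2}}4(\beta+i\gamma)L_i}X_\lambda\big)\Big).$$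 2. There are holomorphic functions $a,b:\Omega\to\mathbb C$, independent of $\lambda$, such that for every $\lambda\in S^1$ the map $z\mapsto U^-_\lambda(z)$ is smooth and $$(U^-_\lambda)^{-1}dU^-_\lambda=\Big(\tfrac{\lambda^{-2}}2L_i\tfrac{\partial\beta}{\partial z}dz,\ \lambda^{-1}(a\epsilon+bL_i\bar\epsilon)dz\Big).$$ -/

import Mathlib

open scoped ContDiff Matrix

noncomputable section

namespace HSL

/-! ### The group of affine symplectic isometries of Euclidean four-space -/

/-- Left multiplication by the quaternion `i` on `R⁴` (the complex structure `J`). -/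
def Li (R : Type*) [CommRing R] : Matrix (Fin 4) (Fin 4) R :=
  !![0, -1, 0, 0; 1, 0, 0, 0; 0, 0, 0, -1; 0, 0, 1, 0]

/-- Left multiplication by the quaternion `j`. -/
def Lj (R : Type*) [CommRing R] : Matrix (Fin 4) (Fin 4) R :=
  !![0, 0, -1, 0; 0, 0, 0, 1; 1, 0, 0, 0; 0, -1, 0, 0]

/-- Right multiplication by the quaternion `i`. -/
def Ri (R : Type*) [CommRing R] : Matrix (Fin 4) (Fin 4) R :=
  !![0, -1, 0, 0; 1, 0, 0, 0; 0, 0, 0, 1; 0, 0, -1, 0]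

/-- Right multiplication by the quaternion `j`. -/
def Rj (R : Type*) [CommRing R] : Matrix (Fin 4) (Fin 4) R :=
  !![0, 0, -1, 0; 0, 0, 0, -1; 1, 0, 0, 0; 0, 1, 0, 0]

/-- Right multiplication by the quaternion `k`. -/
def Rk (R : Type*) [CommRing R] : Matrix (Fin 4) (Fin 4) R :=
  !![0, 0, 0, -1; 0, 0, 1, 0; 0, -1, 0, 0; 1, 0, 0, 0]

/-- Pairs `(G, T)` of a rotation component and a translation component. -/
abbrev Aff (R : Type*) := Matrix (Fin 4) (Fin 4) R × (Fin 4 → R)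

/-- The product of the semidirect product, `(G, T).(G', T') = (G G', G T' + T)`. -/
def affMul {R : Type*} [CommRing R] (U V : Aff R) : Aff R :=
  (U.1 * V.1, U.1 *ᵥ V.2 + U.2)

/-- The neutral element `(1, 0)`. -/
def affOne (R : Type*) [CommRing R] : Aff R := (1, 0)

/-- For `R = ℝ`: the affine maps preserving the scalar product and the symplectic form, i.e.
`(G, T)` with `G` orthogonal and commuting with `J`. For `R = ℂ`: its complexification. -/
def affGroup (R : Type*) [CommRing R] : Set (Aff R) :=
  {U | U.1ᵀ * U.1 = 1 ∧ U.1 * Li R = Li R * U.1}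

/-- The subgroup `𝒢₀ ≃ SU(2)` of right multiplications by conjugates of unit quaternions. -/
def groupZero : Set (Matrix (Fin 4) (Fin 4) ℝ) :=
  {K | ∃ q : Fin 4 → ℝ, ∑ m, q m ^ 2 = 1 ∧
    K = q 0 • (1 : Matrix (Fin 4) (Fin 4) ℝ) - q 1 • Ri ℝ - q 2 • Rj ℝ - q 3 • Rk ℝ}

/-- The inclusion of the real pairs into the complex pairs. -/
def complexify (U : Aff ℝ) : Aff ℂ :=
  (U.1.map fun x : ℝ => (x : ℂ), fun p => (U.2 p : ℂ))

/-- The order-four automorphism `τ`: conjugation by `(-L_j, 0)`. The same formula gives the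
action of `τ` on the group and on the (complexified) Lie algebra. -/
def tau (U : Aff ℂ) : Aff ℂ :=
  (-(Lj ℂ * U.1 * Lj ℂ), -(Lj ℂ *ᵥ U.2))

/-- The projection `[ξ]_k` of `ξ` to the eigenspace of `τ` for the eigenvalue `i ^ k`, along the
other eigenspaces (recall `τ⁴ = 1`). -/
def tauProj (k : ℤ) (ξ : Aff ℂ) : Aff ℂ :=
  (1 / 4 : ℂ) • ∑ m ∈ Finset.range 4, (Complex.I ^ (-(k * (m : ℤ)))) • (tau^[m] ξ)

/-- The vector `ε = (1, 0, -i, 0) / 2`. -/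
def eps : Fin 4 → ℂ := ![1 / 2, 0, -Complex.I / 2, 0]

/-- The vector `ε̄ = (1, 0, i, 0) / 2`. -/
def epsBar : Fin 4 → ℂ := ![1 / 2, 0, Complex.I / 2, 0]

/-! ### Calculus on the parameter domain -/

/-- `∂f/∂z = (∂f/∂x - i ∂f/∂y) / 2`. -/
def dZ (f : ℂ → ℂ) (z : ℂ) : ℂ := (fderiv ℝ f z 1 - Complex.I * fderiv ℝ f z Complex.I) / 2

/-- `∂f/∂z̄ = (∂f/∂x + i ∂f/∂y) / 2`. -/
def dZbar (f : ℂ → ℂ) (z : ℂ) : ℂ := (fderiv ℝ f z 1 + Complex.I * fderiv ℝ f z Complex.I) / 2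

/-- Smoothness on `Ω` of a map into pairs, entry by entry. -/
def SmoothOn {R : Type*} [NormedAddCommGroup R] [NormedSpace ℝ R] (Ω : Set ℂ) (U : ℂ → Aff R) :
    Prop :=
  (∀ p q, ContDiffOn ℝ ∞ (fun z => (U z).1 p q) Ω) ∧ ∀ p, ContDiffOn ℝ ∞ (fun z => (U z).2 p) Ω

/-- The coefficient of `dz` in the Maurer-Cartan form `U⁻¹ dU = (F⁻¹ dF, F⁻¹ dX)` of
`U = (F, X)`. -/
def mcZ (U : ℂ → Aff ℂ) (z : ℂ) : Aff ℂ :=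
  ((U z).1⁻¹ * Matrix.of fun p q => dZ (fun w => (U w).1 p q) z,
   (U z).1⁻¹ *ᵥ fun p => dZ (fun w => (U w).2 p) z)

/-- The coefficient of `dz̄` in the Maurer-Cartan form of `U`. -/
def mcZbar (U : ℂ → Aff ℂ) (z : ℂ) : Aff ℂ :=
  ((U z).1⁻¹ * Matrix.of fun p q => dZbar (fun w => (U w).1 p q) z,
   (U z).1⁻¹ *ᵥ fun p => dZbar (fun w => (U w).2 p) z)

/-! ### Hamiltonian stationary lifted conformal Lagrangian immersions -/

/-- `∂X/∂x`. -/
def dX (X : ℂ → Fin 4 → ℝ) (z : ℂ) : Fin 4 → ℝ := fderiv ℝ X z 1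

/-- `∂X/∂y`. -/
def dY (X : ℂ → Fin 4 → ℝ) (z : ℂ) : Fin 4 → ℝ := fderiv ℝ X z Complex.I

/-- The symplectic form `ω(v, w) = ⟨J v, w⟩`. -/
def symp (v w : Fin 4 → ℝ) : ℝ := (Li ℝ *ᵥ v) ⬝ᵥ w

/-- The area element of `X`: the square root of the Gram determinant of `∂X/∂x, ∂X/∂y`. -/
def areaDensity (X : ℂ → Fin 4 → ℝ) (z : ℂ) : ℝ :=
  √((dX X z ⬝ᵥ dX X z) * (dY X z ⬝ᵥ dY X z) - (dX X z ⬝ᵥ dY X z) ^ 2)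

/-- The immersion `X` of `Ω` is a critical point of the area under compactly supported
Hamiltonian variations: the derivative of the area vanishes along each variation field `V` for
which the one-form `ω(V, dX)` is the differential of a function `h`, with `V` and `h` smooth and
compactly supported in `Ω`. -/
def IsHamiltonianStationary (Ω : Set ℂ) (X : ℂ → Fin 4 → ℝ) : Prop :=
  ∀ (V : ℂ → Fin 4 → ℝ) (h : ℂ → ℝ),
    ContDiff ℝ ∞ V → HasCompactSupport V → tsupport V ⊆ Ω →
    ContDiff ℝ ∞ h → HasCompactSupport h → tsupport h ⊆ Ω →
    (∀ z ∈ Ω, ∀ v : ℂ, symp (V z) (fderiv ℝ X z v) = fderiv ℝ h z v) →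
    HasDerivAt (fun t : ℝ => ∫ z in tsupport V, areaDensity (fun w => X w + t • V w) z) 0 0

/-- Lifted conformal Lagrangian immersions `U = (F, X)`: smooth maps from `Ω` to the group with
`U(z₀) = (1, 0)` and `F⁻¹ dX = e^f K (ε₁ dx + ε₃ dy)` with `f` real and `K` with values in
`𝒢₀`. -/
structure IsLCLI (Ω : Set ℂ) (z₀ : ℂ) (U : ℂ → Aff ℝ) : Prop where
  smooth : SmoothOn Ω U
  mem : ∀ z ∈ Ω, U z ∈ affGroup ℝ
  base : U z₀ = affOne ℝ
  translation : ∃ (f : ℂ → ℝ) (K : ℂ → Matrix (Fin 4) (Fin 4) ℝ),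
    ContDiffOn ℝ ∞ f Ω ∧ (∀ p q, ContDiffOn ℝ ∞ (fun z => K z p q) Ω) ∧
    ∀ z ∈ Ω, K z ∈ groupZero ∧
      (U z).1⁻¹ *ᵥ dX (fun w => (U w).2) z = Real.exp (f z) • (K z *ᵥ Pi.single 0 1) ∧
      (U z).1⁻¹ *ᵥ dY (fun w => (U w).2) z = Real.exp (f z) • (K z *ᵥ Pi.single 2 1)

/-- The complex two-form `(dx¹ + i dx²) ∧ (dx³ + i dx⁴)`. -/
def hermDet (v w : Fin 4 → ℝ) : ℂ :=
  ((v 0 : ℂ) + Complex.I * v 1) * ((w 2 : ℂ) + Complex.I * w 3) -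
    ((w 0 : ℂ) + Complex.I * w 1) * ((v 2 : ℂ) + Complex.I * v 3)

/-- The real-valued Lagrangian angle map `β` of a conformal Lagrangian immersion `X`, normalised
by `β(z₀) = 0`: `e^{iβ}` is the value of `(dx¹ + i dx²) ∧ (dx³ + i dx⁴)` on the orthonormal
basis `(e₁, e₃)` obtained by normalising `∂X/∂x, ∂X/∂y`. -/
structure IsLagrangianAngle (Ω : Set ℂ) (z₀ : ℂ) (X : ℂ → Fin 4 → ℝ) (β : ℂ → ℝ) : Prop where
  smooth : ContDiffOn ℝ ∞ β Ω
  base : β z₀ = 0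
  angle : ∀ z ∈ Ω, Complex.exp (Complex.I * β z) =
    hermDet ((√(dX X z ⬝ᵥ dX X z))⁻¹ • dX X z) ((√(dY X z ⬝ᵥ dY X z))⁻¹ • dY X z)

/-- The coefficient of `dz` in the extended Maurer-Cartan form
`α_λ = λ⁻² α₂' + λ⁻¹ α₋₁' + α₀ + λ α₁'' + λ² α₂''`, where `α = U⁻¹ dU`. -/
def extZ (U : ℂ → Aff ℝ) (l : Circle) (z : ℂ) : Aff ℂ :=
  ((l : ℂ) ^ (-2 : ℤ)) • tauProj 2 (mcZ (fun w => complexify (U w)) z)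
    + ((l : ℂ) ^ (-1 : ℤ)) • tauProj (-1) (mcZ (fun w => complexify (U w)) z)
    + tauProj 0 (mcZ (fun w => complexify (U w)) z)

/-- The coefficient of `dz̄` in the extended Maurer-Cartan form. -/
def extZbar (U : ℂ → Aff ℝ) (l : Circle) (z : ℂ) : Aff ℂ :=
  tauProj 0 (mcZbar (fun w => complexify (U w)) z)
    + (l : ℂ) • tauProj 1 (mcZbar (fun w => complexify (U w)) z)
    + ((l : ℂ) ^ 2) • tauProj 2 (mcZbar (fun w => complexify (U w)) z)

/-- The extended lift of `U`: the family `U_λ`, `λ ∈ S¹`, of smooth maps from `Ω` to the group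
with `U_λ⁻¹ dU_λ = α_λ` and `U_λ(z₀) = 1`. -/
structure IsExtendedLift (Ω : Set ℂ) (z₀ : ℂ) (U : ℂ → Aff ℝ) (E : Circle → ℂ → Aff ℝ) :
    Prop where
  smooth : ∀ l, SmoothOn Ω (E l)
  mem : ∀ l, ∀ z ∈ Ω, E l z ∈ affGroup ℝ
  base : ∀ l, E l z₀ = affOne ℝ
  eqZ : ∀ l, ∀ z ∈ Ω, mcZ (fun w => complexify (E l w)) z = extZ U l z
  eqZbar : ∀ l, ∀ z ∈ Ω, mcZbar (fun w => complexify (E l w)) z = extZbar U l z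

/-- `γ` is the harmonic conjugate of `β` vanishing at `z₀`:
`d((β + iγ)/2) = (∂β/∂z) dz`. -/
structure IsHarmonicConjugate (Ω : Set ℂ) (z₀ : ℂ) (β γ : ℂ → ℝ) : Prop where
  smooth : ContDiffOn ℝ ∞ γ Ω
  base : γ z₀ = 0
  eqZ : ∀ z ∈ Ω, dZ (fun w => ((β w : ℂ) + Complex.I * γ w) / 2) z = dZ (fun w => (β w : ℂ)) z
  eqZbar : ∀ z ∈ Ω, dZbar (fun w => ((β w : ℂ) + Complex.I * γ w) / 2) z = 0

/-! ### Twisted loop groups -/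

/-- The point `i` of the unit circle. -/
def circleI : Circle := ⟨Complex.I, mem_sphere_zero_iff_norm.2 Complex.norm_I⟩

/-- The Fourier coefficient `ĝ_k` in `g_λ = ∑ ĝ_k λ^k`, for a function on the unit circle. -/
def loopCoeff (g : Circle → ℂ) (k : ℤ) : ℂ :=
  fourierCoeff (T := 1) (fun x => g (AddCircle.toCircle x)) k

/-- Functions on the circle of Sobolev class `H^s` (for `s > 1/2`, where each class has a
continuous representative). -/
def IsHs (s : ℝ) (g : Circle → ℂ) : Prop :=
  Continuous g ∧ Summable fun k : ℤ => (1 + (k : ℝ) ^ 2) ^ s * ‖loopCoeff g k‖ ^ 2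

/-- The twisted loop group `Λ𝒢^ℂ_τ`, with the `H^s` regularity. -/
def loopGroup (s : ℝ) : Set (Circle → Aff ℂ) :=
  {g | (∀ p q, IsHs s fun l => (g l).1 p q) ∧ (∀ p, IsHs s fun l => (g l).2 p) ∧
    (∀ l, g l ∈ affGroup ℂ) ∧ ∀ l, g (circleI * l) = tau (g l)}

/-- A map on the closed unit disk with values in the complexified group which is continuous on
the closed disk and holomorphic in its interior. -/
def IsHolomorphicOnDisk (H : ℂ → Aff ℂ) : Prop :=
  (∀ p q, DiffContOnCl ℂ (fun w => (H w).1 p q) (Metric.ball 0 1)) ∧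
  (∀ p, DiffContOnCl ℂ (fun w => (H w).2 p) (Metric.ball 0 1)) ∧
  ∀ w ∈ Metric.closedBall (0 : ℂ) 1, H w ∈ affGroup ℂ

/-- `Λ⁺𝒢^ℂ_τ`: the twisted loops that extend holomorphically to the unit disk. -/
def loopPlus (s : ℝ) : Set (Circle → Aff ℂ) :=
  {g | g ∈ loopGroup s ∧ ∃ H : ℂ → Aff ℂ, IsHolomorphicOnDisk H ∧ ∀ l : Circle, H l = g l}

/-- `Λ⁻_⋆𝒢^ℂ_τ`: the twisted loops that extend holomorphically to the complement of the unit disk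
in the Riemann sphere, with value `1` at infinity (the extension is written in the coordinate
`w = λ⁻¹`). -/
def loopMinus (s : ℝ) : Set (Circle → Aff ℂ) :=
  {g | g ∈ loopGroup s ∧ ∃ H : ℂ → Aff ℂ, IsHolomorphicOnDisk H ∧ H 0 = affOne ℂ ∧
    ∀ l : Circle, H ((l : ℂ)⁻¹) = g l}

/-- `Λℂ⁴_τ`: the twisted loops of vectors. -/
def loopVec (s : ℝ) : Set (Circle → Fin 4 → ℂ) :=
  {v | (∀ p, IsHs s fun l => v l p) ∧ ∀ l, v (circleI * l) = -(Lj ℂ *ᵥ v l)}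

/-- `Q⁻`: the part with negative powers of `λ` of a Fourier series. -/
def Qminus (v : Circle → Fin 4 → ℂ) (l : Circle) : Fin 4 → ℂ := fun p =>
  ∑' n : ℕ, loopCoeff (fun m => v m p) (-((n : ℤ) + 1)) * (l : ℂ) ^ (-((n : ℤ) + 1))

/-- `Q⁺`: the part with nonnegative powers of `λ` of a Fourier series. -/
def Qplus (v : Circle → Fin 4 → ℂ) (l : Circle) : Fin 4 → ℂ := fun p =>
  ∑' n : ℕ, loopCoeff (fun m => v m p) (n : ℤ) * (l : ℂ) ^ (n : ℤ)

/-! ### The explicit factors -/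

/-- `e^{c λ⁻² (β + iγ) L_i / 4}` at the point `z`, used with `c = 1` and `c = -1`. -/
def rotExp (c : ℂ) (β γ : ℂ → ℝ) (l : Circle) (z : ℂ) : Matrix (Fin 4) (Fin 4) ℂ :=
  NormedSpace.exp ((c * ((l : ℂ) ^ (-2 : ℤ) / 4 * ((β z : ℂ) + Complex.I * γ z))) • Li ℂ)

/-- The loop `λ ↦ e^{-λ⁻² (β + iγ) L_i / 4} X_λ` at the point `z`. -/
def innerLoop (β γ : ℂ → ℝ) (E : Circle → ℂ → Aff ℝ) (z : ℂ) (l : Circle) : Fin 4 → ℂ :=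
  rotExp (-1) β γ l z *ᵥ (complexify (E l z)).2

/-- `U⁻_λ = (e^{λ⁻²(β+iγ)L_i/4}, e^{λ⁻²(β+iγ)L_i/4} Q⁻(e^{-λ⁻²(β+iγ)L_i/4} X_λ))`. -/
def Uminus (β γ : ℂ → ℝ) (E : Circle → ℂ → Aff ℝ) (z : ℂ) (l : Circle) : Aff ℂ :=
  (rotExp 1 β γ l z, rotExp 1 β γ l z *ᵥ Qminus (innerLoop β γ E z) l)

/-- `U⁺_λ = (e^{-λ⁻²(β+iγ)L_i/4} F_λ, Q⁺(e^{-λ⁻²(β+iγ)L_i/4} X_λ))`. -/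
def Uplus (β γ : ℂ → ℝ) (E : Circle → ℂ → Aff ℝ) (z : ℂ) (l : Circle) : Aff ℂ :=
  (rotExp (-1) β γ l z * (complexify (E l z)).1, Qplus (innerLoop β γ E z) l)

end HSL

end

open scoped ContDiff Matrix
open Complex MeasureTheory Metric Set Filter Topology

namespace HSL

/-! ### Fourier coefficients of functions on the unit circle -/

/-! Write u = (β + iγ)/4, so that u' = ∂β/∂z / 2. Since the complex determinant of F is e^{iβ}, the
matrix R = e^{-βL_i/2} F (`frame`) is special unitary and commutes with L_j. In the Maurer-Cartan
form of F the eigenspace projections [·]₂ and [·]₀ therefore separate dβ/2 L_i from R⁻¹dR, and the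
spectral parameter touches only the abelian part.

The rotation F_λ Rᵀ (`relRot`) solves a linear equation with values in multiples of L_i. At λ² = i
its existence forces the form (∂β - ∂̄β)/2 to integrate; multiplying the solution by e^{β/2} gives a
nonvanishing holomorphic function with logarithmic derivative ∂β/∂z, and a logarithm of it on the
simply connected Ω supplies γ. For any such γ, solving the abelian equation gives F_λ = e^{(λ⁻²u +
λ²ū)L_i} R (`extendedLift_rotation`). Splitting the exponent yields the rotation parts of both
factors: e^{λ⁻²uL_i} on the outside, e^{λ²ūL_i} R on the inside.

For the translations put Y_λ = e^{-λ⁻²uL_i} X_λ. The maps `proj I` and `proj (-I)` diagonalize L_i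
and reduce everything to scalar families (`IsSpectralFamily`). Integration along segments shows that
X_λ, hence Y_λ, extends holomorphically to λ ∈ ℂ∖{0} (`loopHol`). Its Fourier coefficients then
decay faster than every geometric sequence: the loops are H^s for all s, and Q⁻Y and Q⁺Y are entire
in λ⁻¹ and in λ. This gives existence of the factorization. Uniqueness is Liouville's theorem: a
function extending continuously to both closed sides of the circle, holomorphically inside each, is
constant (`eq_of_extends_both_sides`).

The gauge leaves only powers λ^k with k ≥ 1 in the dz̄ part of dY, so the coefficients Ŷ_k with k <
0 are holomorphic in z and satisfy Ŷ_k' = -u' L_i Ŷ_{k+2} + δ_{k,-1} A, where A = R α₋₁' is taken as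
a dz-coefficient. Summing over k < 0 leaves boundary terms in Ŷ₀ and Ŷ₁, and the twisting gives Ŷ₀ =
0. Hence (U⁻)⁻¹dU⁻ has translation part λ⁻¹(A - u' L_i Ŷ₁)dz (`potential`). Twisting places this
vector in the i-eigenspace of L_j, spanned by ε and L_i ε̄. -/

theorem continuous_comp_toCircle {g : Circle → ℂ} (hg : Continuous g) :
    Continuous fun x : AddCircle (1 : ℝ) => g (AddCircle.toCircle x) :=
  hg.comp AddCircle.continuous_toCircle

theorem fourier_eq_toCircle_zpow (k : ℤ) (x : AddCircle (1 : ℝ)) :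
    fourier k x = (AddCircle.toCircle x : ℂ) ^ k := by
  rw [fourier_apply, AddCircle.toCircle_zsmul]; simp

theorem loopCoeff_eq_integral (g : Circle → ℂ) (k : ℤ) :
    loopCoeff g k = ∫ x : AddCircle (1 : ℝ), (AddCircle.toCircle x : ℂ) ^ (-k) *
      g (AddCircle.toCircle x) ∂AddCircle.haarAddCircle := by
  simp only [loopCoeff, fourierCoeff, fourier_eq_toCircle_zpow, smul_eq_mul]

theorem continuous_toCircle_zpow (k : ℤ) :
    Continuous fun x : AddCircle (1 : ℝ) => (AddCircle.toCircle x : ℂ) ^ k := by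
  have := (fourier k : C(AddCircle (1 : ℝ), ℂ)).continuous
  refine this.congr fun x => fourier_eq_toCircle_zpow k x

theorem integrable_loop {g : Circle → ℂ} (hg : Continuous g) (k : ℤ) :
    Integrable (fun x : AddCircle (1 : ℝ) => (AddCircle.toCircle x : ℂ) ^ k *
      g (AddCircle.toCircle x)) AddCircle.haarAddCircle :=
  ((continuous_toCircle_zpow k).mul (continuous_comp_toCircle hg)).integrable_of_hasCompactSupport
    (HasCompactSupport.of_compactSpace _)

theorem loopCoeff_add {g h : Circle → ℂ} (hg : Continuous g) (hh : Continuous h) (k : ℤ) :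
    loopCoeff (fun l => g l + h l) k = loopCoeff g k + loopCoeff h k := by
  simp only [loopCoeff_eq_integral, mul_add]
  exact integral_add (integrable_loop hg _) (integrable_loop hh _)

theorem loopCoeff_const_mul (c : ℂ) (g : Circle → ℂ) (k : ℤ) :
    loopCoeff (fun l => c * g l) k = c * loopCoeff g k := by
  simp only [loopCoeff_eq_integral, ← integral_const_mul]
  congr 1; ext x; ring

theorem loopCoeff_zpow_mul (n : ℤ) (g : Circle → ℂ) (k : ℤ) :
    loopCoeff (fun l => (l : ℂ) ^ n * g l) k = loopCoeff g (k - n) := by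
  simp only [loopCoeff_eq_integral]
  congr 1; ext x
  rw [← mul_assoc, ← zpow_add₀ (Circle.coe_ne_zero _)]
  congr 2; ring

/-- A rotation of the circle is a translation of `AddCircle`, which preserves Haar measure. -/
theorem loopCoeff_mul_left (m : Circle) (g : Circle → ℂ) (k : ℤ) :
    loopCoeff (fun l => g (m * l)) k = (m : ℂ) ^ k * loopCoeff g k := by
  obtain ⟨y, rfl⟩ := AddCircle.homeomorphCircle (T := 1) one_ne_zero |>.surjective m
  simp only [loopCoeff_eq_integral, AddCircle.homeomorphCircle_apply]
  rw [← integral_add_left_eq_self (fun x : AddCircle (1 : ℝ) =>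
    (AddCircle.toCircle x : ℂ) ^ (-k) * g (AddCircle.toCircle x)) y, ← integral_const_mul]
  congr 1; ext x
  have hy : (AddCircle.toCircle y : ℂ) ^ k ≠ 0 := zpow_ne_zero _ (Circle.coe_ne_zero _)
  simp only [AddCircle.toCircle_add, Circle.coe_mul, mul_zpow, zpow_neg]
  field_simp

theorem loopCoeff_inv (g : Circle → ℂ) (k : ℤ) :
    loopCoeff (fun l => g l⁻¹) k = loopCoeff g (-k) := by
  simp only [loopCoeff_eq_integral]
  rw [← integral_neg_eq_self]
  congr 1; ext x
  rw [AddCircle.toCircle_neg]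
  simp

theorem hasSum_loopCoeff {g : Circle → ℂ} (hg : Continuous g) (hs : Summable (loopCoeff g))
    (l : Circle) : HasSum (fun k : ℤ => loopCoeff g k * (l : ℂ) ^ k) (g l) := by
  obtain ⟨x, rfl⟩ := AddCircle.homeomorphCircle (T := 1) one_ne_zero |>.surjective l
  have := has_pointwise_sum_fourier_series_of_summable
    (f := ⟨fun x : AddCircle (1 : ℝ) => g (AddCircle.toCircle x), continuous_comp_toCircle hg⟩) hs x
  simp only [fourier_eq_toCircle_zpow, smul_eq_mul] at this
  simp only [AddCircle.homeomorphCircle_apply]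
  exact this

theorem eq_of_loopCoeff_eq_zero {g : Circle → ℂ} (hg : Continuous g)
    (h0 : ∀ k ≠ 0, loopCoeff g k = 0) (l : Circle) : g l = loopCoeff g 0 := by
  have hs : Summable (loopCoeff g) :=
    summable_of_ne_finset_zero (s := {0}) fun k hk => h0 k (by simpa using hk)
  refine (hasSum_loopCoeff hg hs l).unique ?_
  convert hasSum_single (0 : ℤ) (fun k hk => ?_) using 1
  · simp
  · simp [h0 k hk]

/-- The substitution θ = 2πx turns the Haar integral into a contour integral, which makes Cauchy's
theorem available. -/
theorem loopCoeff_eq_circleIntegral {g : Circle → ℂ} {G : ℂ → ℂ} (hG : ∀ l : Circle, G l = g l)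
    (k : ℤ) : loopCoeff g k = (2 * Real.pi * I)⁻¹ * ∮ w in C(0, 1), w ^ (-k - 1) * G w := by
  rw [loopCoeff, fourierCoeff_eq_intervalIntegral _ _ 0, circleIntegral]
  have h := intervalIntegral.integral_comp_mul_left
    (a := 0) (b := 1) (fun θ : ℝ => deriv (circleMap 0 1) θ • (circleMap 0 1 θ ^ (-k - 1) *
      G (circleMap 0 1 θ))) (c := 2 * Real.pi) (by positivity)
  simp only [mul_zero, mul_one] at h
  have h2 : (∫ θ in (0 : ℝ)..2 * Real.pi, deriv (circleMap 0 1) θ • (circleMap 0 1 θ ^ (-k - 1) *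
      G (circleMap 0 1 θ))) = (2 * Real.pi : ℝ) • ∫ x in (0 : ℝ)..1, deriv (circleMap 0 1)
      (2 * Real.pi * x) • (circleMap 0 1 (2 * Real.pi * x) ^ (-k - 1) *
      G (circleMap 0 1 (2 * Real.pi * x))) := by
    rw [h, smul_smul, mul_inv_cancel₀ (by positivity), one_smul]
  rw [h2, real_smul (x := 2 * Real.pi), ← mul_assoc, ← intervalIntegral.integral_const_mul]
  simp only [zero_add, div_one, one_smul]
  refine intervalIntegral.integral_congr fun x _ => ?_
  have hc : (AddCircle.toCircle (x : AddCircle (1 : ℝ)) : ℂ) = circleMap 0 1 (2 * Real.pi * x) := by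
    rw [AddCircle.toCircle_apply_mk, Circle.coe_exp]; simp [circleMap]
  have hne : circleMap 0 1 (2 * Real.pi * x) ≠ 0 := by simp
  simp only [fourier_eq_toCircle_zpow, smul_eq_mul, ← hG, hc, deriv_circleMap]
  rw [zpow_sub_one₀ hne]
  have := Real.pi_ne_zero
  field_simp
  push_cast
  ring

/-- For k = 0 this is Cauchy's integral formula at the centre; for k < 0 the kernel w^(-k-1) is
itself entire, so Cauchy's theorem gives zero. -/
theorem loopCoeff_of_diffContOnCl {g : Circle → ℂ} {G : ℂ → ℂ} (hG : ∀ l : Circle, G l = g l)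
    (hd : DiffContOnCl ℂ G (ball 0 1)) : loopCoeff g 0 = G 0 ∧ ∀ k < 0, loopCoeff g k = 0 := by
  have hpi : (2 * Real.pi * I : ℂ) ≠ 0 := by simp [Real.pi_ne_zero]
  constructor
  · rw [loopCoeff_eq_circleIntegral hG]
    have := hd.circleIntegral_sub_inv_smul (w := 0) (by simp)
    simp only [sub_zero, smul_eq_mul] at this
    simp only [neg_zero, zero_sub, zpow_neg_one, this]
    field_simp
  · intro k hk
    rw [loopCoeff_eq_circleIntegral hG]
    obtain ⟨n, rfl⟩ : ∃ n : ℕ, k = -(n + 1 : ℤ) := ⟨(-k - 1).toNat, by omega⟩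
    have : DiffContOnCl ℂ (fun w => w ^ n * G w) (ball 0 1) :=
      (Differentiable.diffContOnCl (f := fun w : ℂ => w ^ n) (by fun_prop)).smul hd
    have h0 := this.circleIntegral_eq_zero zero_le_one
    have e : (-(-(n + 1 : ℤ)) - 1) = n := by ring
    simp only [e, zpow_natCast, h0, mul_zero]

/-- The closed annulus with radii `1/R` and `R`. -/
def annulus (R : ℝ) : Set ℂ := closedBall 0 R \ ball 0 R⁻¹

theorem isCompact_annulus (R : ℝ) : IsCompact (annulus R) :=
  (isCompact_closedBall _ _).diff isOpen_ball

theorem annulus_subset {R : ℝ} (hR : 1 ≤ R) : annulus R ⊆ {0}ᶜ := by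
  rintro w ⟨-, h⟩ rfl
  simp at h; linarith

theorem coe_mem_annulus {R : ℝ} (hR : 1 ≤ R) (l : Circle) : (l : ℂ) ∈ annulus R := by
  simp [annulus, Circle.norm_coe, hR, inv_le_one_of_one_le₀ hR]

/-- Cauchy estimates: the contour is moved to radius R when k ≥ 0 and to radius 1/R when k ≤ 0. -/
theorem norm_loopCoeff_le_of_annulus {g : Circle → ℂ} {G : ℂ → ℂ} (hG : ∀ l : Circle, G l = g l)
    (hd : DifferentiableOn ℂ G {0}ᶜ) {R M : ℝ} (hR : 1 ≤ R) (hM : ∀ w ∈ annulus R, ‖G w‖ ≤ M)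
    (k : ℤ) : ‖loopCoeff g k‖ ≤ M * (R⁻¹) ^ k.natAbs := by
  have hR0 : 0 < R := by linarith
  have hd' : DifferentiableOn ℂ (fun w => w ^ (-k - 1) * G w) {0}ᶜ := fun w hw =>
    ((differentiableAt_zpow.2 (Or.inl hw)).differentiableWithinAt).mul (hd w hw)
  -- The estimate for a single radius r, given that the contour may be moved there.
  have key : ∀ r, 0 < r → (∀ w : ℂ, ‖w‖ = r → ‖G w‖ ≤ M) →
      (∮ w in C(0, 1), w ^ (-k - 1) * G w) = ∮ w in C(0, r), w ^ (-k - 1) * G w →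
      ‖loopCoeff g k‖ ≤ M * r ^ (-k) := by
    intro r hr hMr he
    rw [loopCoeff_eq_circleIntegral hG, he]
    have := circleIntegral.norm_two_pi_i_inv_smul_integral_le_of_norm_le_const
      (f := fun w => w ^ (-k - 1) * G w) (c := 0) (R := r) (C := r ^ (-k - 1) * M) hr.le ?_
    · refine this.trans (le_of_eq ?_)
      rw [zpow_sub_one₀ hr.ne']; field_simp
    · intro w hw
      have hw' : ‖w‖ = r := by simpa using hw
      rw [norm_mul, norm_zpow, hw']
      exact mul_le_mul_of_nonneg_left (hMr w hw') (by positivity)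
  rcases le_total 0 k with hk | hk
  · have := key R hR0 (fun w hw => hM w ?_) ?_
    · refine this.trans (le_of_eq ?_)
      rw [zpow_neg, inv_pow]
      congr 2
      conv_lhs => rw [← Int.natAbs_of_nonneg hk]
      exact zpow_natCast _ _
    · simp [annulus, hw, inv_le_of_inv_le₀ hR0, (inv_le_one_of_one_le₀ hR).trans hR]
    · symm
      refine circleIntegral_eq_of_differentiable_on_annulus_off_countable one_pos hR
        countable_empty (hd'.continuousOn.mono ?_) fun z hz =>
          hd'.differentiableAt (isOpen_compl_singleton.mem_nhds ?_)
      · rintro w ⟨-, h⟩ rfl; simp at h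
      · rintro rfl; simp at hz
  · have := key R⁻¹ (by positivity) (fun w hw => hM w ?_) ?_
    · refine this.trans (le_of_eq ?_)
      congr 1
      rw [← Int.ofNat_natAbs_of_nonpos hk, zpow_natCast]
    · simp [annulus, hw, (inv_le_one_of_one_le₀ hR).trans hR]
    · refine circleIntegral_eq_of_differentiable_on_annulus_off_countable (by positivity)
        (inv_le_one_of_one_le₀ hR)
        countable_empty (hd'.continuousOn.mono ?_) fun z hz =>
          hd'.differentiableAt (isOpen_compl_singleton.mem_nhds ?_)
      · rintro w ⟨-, h⟩ rfl; simp at h; linarith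
      · rintro rfl
        have : ¬ (0 : ℝ) ≤ R⁻¹ := by simpa using hz
        exact this (by positivity)

/-! ### Loops extending holomorphically to the punctured plane -/

/-- The function on the circle is the restriction of a holomorphic function on `ℂ \ {0}`. -/
def LoopHol (g : Circle → ℂ) : Prop :=
  ∃ G : ℂ → ℂ, DifferentiableOn ℂ G {0}ᶜ ∧ ∀ l : Circle, G l = g l

namespace LoopHol

variable {g h : Circle → ℂ}

theorem continuous (hg : LoopHol g) : Continuous g := by
  obtain ⟨G, hd, hG⟩ := hg
  have : Continuous fun l : Circle => G l := by
    rw [← continuousOn_univ]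
    exact hd.continuousOn.comp continuous_subtype_val.continuousOn fun l _ => Circle.coe_ne_zero l
  exact this.congr hG

theorem add (hg : LoopHol g) (hh : LoopHol h) : LoopHol fun l => g l + h l := by
  obtain ⟨G, hd, hG⟩ := hg
  obtain ⟨H, hd', hH⟩ := hh
  exact ⟨fun w => G w + H w, hd.add hd', fun l => congrArg₂ (· + ·) (hG l) (hH l)⟩

theorem mul (hg : LoopHol g) (hh : LoopHol h) : LoopHol fun l => g l * h l := by
  obtain ⟨G, hd, hG⟩ := hg
  obtain ⟨H, hd', hH⟩ := hh
  exact ⟨fun w => G w * H w, hd.mul hd', fun l => congrArg₂ (· * ·) (hG l) (hH l)⟩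

theorem const (c : ℂ) : LoopHol fun _ => c := ⟨fun _ => c, differentiableOn_const c, fun _ => rfl⟩

theorem of_entire {N : ℂ → ℂ} (hN : Differentiable ℂ N) : LoopHol fun l => N l :=
  ⟨N, hN.differentiableOn, fun _ => rfl⟩

theorem of_entire_inv {N : ℂ → ℂ} (hN : Differentiable ℂ N) : LoopHol fun l => N (l : ℂ)⁻¹ :=
  ⟨fun w => N w⁻¹, fun w hw => (hN.differentiableAt.comp w
    (differentiableAt_inv hw)).differentiableWithinAt, fun _ => rfl⟩

theorem exists_decay (hg : LoopHol g) {R : ℝ} (hR : 1 ≤ R) :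
    ∃ M, 0 ≤ M ∧ ∀ k, ‖loopCoeff g k‖ ≤ M * R⁻¹ ^ k.natAbs := by
  obtain ⟨G, hd, hG⟩ := hg
  obtain ⟨M, hM⟩ := (isCompact_annulus R).exists_bound_of_continuousOn
    (hd.continuousOn.mono (annulus_subset hR))
  refine ⟨M, (norm_nonneg _).trans (hM 1 (coe_mem_annulus hR 1)), fun k =>
    norm_loopCoeff_le_of_annulus hG hd hR hM k⟩

theorem _root_.HSL.summable_int_of_natAbs {f : ℕ → ℝ} (hf : Summable f) :
    Summable fun k : ℤ => f k.natAbs := by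
  refine Summable.of_nat_of_neg ?_ ?_ <;> simpa using hf

theorem summable (hg : LoopHol g) : Summable (loopCoeff g) := by
  obtain ⟨M, -, hM⟩ := hg.exists_decay one_le_two
  refine Summable.of_norm_bounded (summable_int_of_natAbs (f := fun n => M * 2⁻¹ ^ n) ?_) hM
  exact (summable_geometric_of_lt_one (by norm_num) (by norm_num)).mul_left M

/-- The geometric decay of the coefficients beats the polynomial weight, whatever s is. -/
theorem isHs (hg : LoopHol g) (s : ℝ) : IsHs s g := by
  refine ⟨hg.continuous, ?_⟩
  obtain ⟨M, hM0, hM⟩ := hg.exists_decay one_le_two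
  obtain ⟨m, hm⟩ := exists_nat_ge s
  -- The majorant uses |k| + 1 in place of |k| so that it dominates the weight; the factor 4 below
  -- compensates the shifted exponent of 4⁻¹.
  have h1 : Summable fun n : ℕ => ((n + 1 : ℕ) : ℝ) ^ (2 * m) * (4⁻¹ : ℝ) ^ (n + 1) :=
    (summable_nat_add_iff (f := fun n : ℕ => (n : ℝ) ^ (2 * m) * (4⁻¹ : ℝ) ^ n) 1).2
      (summable_pow_mul_geometric_of_norm_lt_one _ (by norm_num))
  refine Summable.of_nonneg_of_le (fun k => by positivity) (fun k => ?_)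
    (summable_int_of_natAbs (h1.mul_left (4 * M ^ 2)))
  have e1 : (1 + (k : ℝ) ^ 2) ^ s ≤ ((k.natAbs + 1 : ℕ) : ℝ) ^ (2 * m) := by
    have hk : (k : ℝ) ^ 2 = (k.natAbs : ℝ) ^ 2 := by
      rw [Nat.cast_natAbs, Int.cast_abs, sq_abs]
    rw [hk]
    calc (1 + (k.natAbs : ℝ) ^ 2) ^ s ≤ (1 + (k.natAbs : ℝ) ^ 2) ^ (m : ℝ) :=
          Real.rpow_le_rpow_of_exponent_le (by nlinarith [sq_nonneg (k.natAbs : ℝ)]) hm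
      _ = (1 + (k.natAbs : ℝ) ^ 2) ^ m := Real.rpow_natCast _ _
      _ ≤ (((k.natAbs + 1 : ℕ) : ℝ) ^ 2) ^ m := by
          gcongr
          push_cast
          nlinarith [(Nat.cast_nonneg k.natAbs : (0 : ℝ) ≤ k.natAbs)]
      _ = _ := by rw [pow_mul]
  have e2 : ‖loopCoeff g k‖ ^ 2 ≤ M ^ 2 * 4⁻¹ ^ k.natAbs := by
    calc ‖loopCoeff g k‖ ^ 2 ≤ (M * 2⁻¹ ^ k.natAbs) ^ 2 := by gcongr; exact hM k
      _ = M ^ 2 * 4⁻¹ ^ k.natAbs := by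
        rw [mul_pow, ← pow_mul, mul_comm _ 2, pow_mul]; norm_num
  calc _ ≤ ((k.natAbs + 1 : ℕ) : ℝ) ^ (2 * m) * (M ^ 2 * 4⁻¹ ^ k.natAbs) := by gcongr
    _ = _ := by rw [pow_succ]; ring

/-- Taylor series with coefficients decaying faster than any geometric sequence are entire. -/
theorem _root_.HSL.differentiable_tsum_pow {c : ℕ → ℂ}
    (hc : ∀ R : ℝ, 1 ≤ R → ∃ M, ∀ n, ‖c n‖ ≤ M * R⁻¹ ^ n) :
    Differentiable ℂ fun w : ℂ => ∑' n, c n * w ^ n := by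
  intro z
  set r : ℝ := ‖z‖ + 1 with hr
  have hr1 : 1 ≤ r := by have := norm_nonneg z; linarith
  -- Decay at rate 1/(2r) makes the terms at most M/2^n on the ball of radius r.
  obtain ⟨M, hM⟩ := hc (2 * r) (by linarith)
  refine (differentiableOn_tsum_of_summable_norm (u := fun n => M * 2⁻¹ ^ n)
    ((summable_geometric_of_lt_one (by norm_num) (by norm_num)).mul_left M)
    (fun n => by fun_prop) (isOpen_ball (x := 0) (ε := r)) fun n w hw => ?_).differentiableAt
      (isOpen_ball.mem_nhds (by simp [hr]))
  have hw' : ‖w‖ ≤ r := by simpa using (mem_ball_zero_iff.1 hw).le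
  calc ‖c n * w ^ n‖ ≤ (M * (2 * r)⁻¹ ^ n) * r ^ n := by
        rw [norm_mul, norm_pow]
        exact mul_le_mul (hM n) (by gcongr) (by positivity) ((norm_nonneg _).trans (hM n))
    _ = M * 2⁻¹ ^ n := by
        rw [mul_assoc, ← mul_pow]; congr 2; field_simp

/-- The annulus in `exists_decay` may be taken arbitrarily large, so the power series has infinite
radius of convergence. -/
theorem exists_posPart (hg : LoopHol g) : ∃ N : ℂ → ℂ, Differentiable ℂ N ∧
    ∀ l : Circle, N l = ∑' n : ℕ, loopCoeff g (n : ℤ) * (l : ℂ) ^ (n : ℤ) := by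
  refine ⟨_, differentiable_tsum_pow (c := fun n => loopCoeff g (n : ℤ)) fun R hR => ?_, fun l => ?_⟩
  · obtain ⟨M, -, hM⟩ := hg.exists_decay hR
    exact ⟨M, fun n => by simpa using hM n⟩
  · simp

/-- In w = λ⁻¹ the series starts at w¹. The factor w taken out of it gives the vanishing at w = 0,
which later normalizes the minus factor at infinity. -/
theorem exists_negPart (hg : LoopHol g) : ∃ N : ℂ → ℂ, Differentiable ℂ N ∧ N 0 = 0 ∧
    ∀ l : Circle, N (l : ℂ)⁻¹ =
      ∑' n : ℕ, loopCoeff g (-((n : ℤ) + 1)) * (l : ℂ) ^ (-((n : ℤ) + 1)) := by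
  have hd : Differentiable ℂ fun w : ℂ => w * ∑' n : ℕ, loopCoeff g (-((n : ℤ) + 1)) * w ^ n := by
    refine differentiable_id.mul (differentiable_tsum_pow fun R hR => ?_)
    obtain ⟨M, hM0, hM⟩ := hg.exists_decay hR
    refine ⟨M, fun n => (hM _).trans ?_⟩
    have e : (-((n : ℤ) + 1)).natAbs = n + 1 := by omega
    rw [e]
    exact mul_le_mul_of_nonneg_left (pow_le_pow_of_le_one (by positivity)
      (inv_le_one_of_one_le₀ hR) (Nat.le_succ n)) hM0
  refine ⟨_, hd, by simp, fun l => ?_⟩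
  rw [← tsum_mul_left]
  congr 1; ext n
  have e : (-((n : ℤ) + 1)) = -((n + 1 : ℕ) : ℤ) := by push_cast; ring
  rw [e, zpow_neg, zpow_natCast, pow_succ, inv_pow, mul_inv]
  ring

theorem tsum_neg_add_tsum_nonneg (hg : LoopHol g) (l : Circle) :
    (∑' n : ℕ, loopCoeff g (-((n : ℤ) + 1)) * (l : ℂ) ^ (-((n : ℤ) + 1))) +
      ∑' n : ℕ, loopCoeff g (n : ℤ) * (l : ℂ) ^ (n : ℤ) = g l := by
  have h := hasSum_loopCoeff hg.continuous hg.summable l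
  have hs := h.summable
  rw [← h.tsum_eq, tsum_of_nat_of_neg_add_one, add_comm]
  · exact hs.comp_injective Nat.cast_injective
  · exact hs.comp_injective (i := fun n : ℕ => -((n : ℤ) + 1)) fun a b hab => by
      simpa using hab

end LoopHol

/-! ### Uniqueness of the Birkhoff factorization -/

/-- Liouville's theorem read on Fourier coefficients: the inner extension kills the negative ones,
the outer extension the positive ones. -/
theorem eq_of_extends_both_sides {g : Circle → ℂ} {W V : ℂ → ℂ}
    (hW : DiffContOnCl ℂ W (ball 0 1)) (hV : DiffContOnCl ℂ V (ball 0 1))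
    (hWg : ∀ l : Circle, W (l : ℂ)⁻¹ = g l) (hVg : ∀ l : Circle, V l = g l) (l : Circle) :
    g l = W 0 := by
  have hcont : Continuous g := by
    have : Continuous fun l : Circle => V l := by
      rw [← continuousOn_univ]
      refine hV.continuousOn_ball.comp continuous_subtype_val.continuousOn fun l _ => ?_
      simp [Circle.norm_coe]
    exact this.congr hVg
  have hWg' : ∀ l : Circle, W l = g l⁻¹ := fun l => by
    rw [← hWg l⁻¹, Circle.coe_inv, inv_inv]
  obtain ⟨h0, hneg⟩ := loopCoeff_of_diffContOnCl hWg' hW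
  obtain ⟨-, hneg'⟩ := loopCoeff_of_diffContOnCl hVg hV
  rw [loopCoeff_inv, neg_zero] at h0
  rw [← h0]
  refine eq_of_loopCoeff_eq_zero hcont (fun k hk => ?_) l
  rcases lt_or_gt_of_ne hk with hk | hk
  · exact hneg' k hk
  · have := hneg (-k) (by omega)
    rwa [loopCoeff_inv, neg_neg] at this

theorem diffContOnCl_sum_mul {s : Set ℂ} {f g : Fin 4 → ℂ → ℂ} (hf : ∀ j, DiffContOnCl ℂ (f j) s)
    (hg : ∀ j, DiffContOnCl ℂ (g j) s) : DiffContOnCl ℂ (fun w => ∑ j, f j w * g j w) s :=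
  ⟨DifferentiableOn.fun_sum fun j _ => (hf j).differentiableOn.mul (hg j).differentiableOn,
    continuousOn_finsetSum _ fun j _ => (hf j).continuousOn.mul (hg j).continuousOn⟩

theorem affGroup.mul_transpose {R : Type*} [CommRing R] {U : Aff R} (hU : U ∈ affGroup R) :
    U.1 * U.1ᵀ = 1 := mul_eq_one_comm.1 hU.1

theorem affGroup.inv_eq {R : Type*} [CommRing R] {U : Aff R} (hU : U ∈ affGroup R) :
    U.1⁻¹ = U.1ᵀ := Matrix.inv_eq_left_inv hU.1

/-- The rotation parts give A'⁻¹A = B'B⁻¹, whose left side extends outside the disk with value 1 at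
infinity and whose right side extends inside; both are 1. With equal rotations, the same argument
applies to the translations. In `affGroup` the inverse is the transpose, so every entry of these
loops is polynomial in entries with the required extension. -/
theorem factorization_unique {s : ℝ} {A A' B B' : Circle → Aff ℂ} (hA : A ∈ loopMinus s)
    (hA' : A' ∈ loopMinus s) (hB : B ∈ loopPlus s) (hB' : B' ∈ loopPlus s)
    (h : ∀ l, affMul (A l) (B l) = affMul (A' l) (B' l)) : A = A' ∧ B = B' := by
  obtain ⟨⟨-, -, hAm, -⟩, H, ⟨hH1, hH2, -⟩, hH0, hHA⟩ := hA
  obtain ⟨⟨-, -, hAm', -⟩, H', ⟨hH1', hH2', -⟩, hH0', hHA'⟩ := hA'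
  obtain ⟨⟨-, -, hBm, -⟩, K, ⟨hK1, hK2, -⟩, hKB⟩ := hB
  obtain ⟨⟨-, -, hBm', -⟩, K', ⟨hK1', hK2', -⟩, hKB'⟩ := hB'
  have h1 : ∀ l, (A l).1 * (B l).1 = (A' l).1 * (B' l).1 := fun l => congrArg Prod.fst (h l)
  have h2 : ∀ l, (A l).1 *ᵥ (B l).2 + (A l).2 = (A' l).1 *ᵥ (B' l).2 + (A' l).2 :=
    fun l => congrArg Prod.snd (h l)
  have hrot : ∀ l, (A' l).1ᵀ * (A l).1 = (B' l).1 * (B l).1ᵀ := fun l => by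
    calc (A' l).1ᵀ * (A l).1 = (A' l).1ᵀ * ((A l).1 * (B l).1) * (B l).1ᵀ := by
          rw [Matrix.mul_assoc, Matrix.mul_assoc, affGroup.mul_transpose (hBm l), Matrix.mul_one]
      _ = (B' l).1 * (B l).1ᵀ := by
          rw [h1, ← Matrix.mul_assoc, (hAm' l).1, Matrix.one_mul]
  have hrot1 : ∀ l, (A' l).1ᵀ * (A l).1 = 1 := fun l => by
    ext p q
    have := eq_of_extends_both_sides (g := fun l => ((A' l).1ᵀ * (A l).1) p q)
      (W := fun w => ∑ j, (H' w).1 j p * (H w).1 j q)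
      (V := fun w => ∑ j, (K' w).1 p j * (K w).1 q j)
      (diffContOnCl_sum_mul (fun j => hH1' j p) fun j => hH1 j q)
      (diffContOnCl_sum_mul (fun j => hK1' p j) fun j => hK1 q j)
      (fun l => by simp only [hHA, hHA']; rfl) (fun l => by simp only [hKB, hKB', hrot]; rfl) l
    rw [this, hH0, hH0']
    simp [affOne, Matrix.one_apply, eq_comm]
  have hA1 : ∀ l, (A l).1 = (A' l).1 := fun l => by
    calc (A l).1 = (A' l).1 * ((A' l).1ᵀ * (A l).1) := by
          rw [← Matrix.mul_assoc, affGroup.mul_transpose (hAm' l), Matrix.one_mul]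
      _ = _ := by rw [hrot1, Matrix.mul_one]
  have hB1 : ∀ l, (B l).1 = (B' l).1 := fun l => by
    have := congrArg (fun M => (A' l).1ᵀ * M) (h1 l)
    simpa [← Matrix.mul_assoc, hrot1, (hAm' l).1] using this
  -- The left side extends outside the disk and vanishes at infinity, while the right side extends
  -- inside.
  have htr : ∀ l, (A l).1ᵀ *ᵥ ((A l).2 - (A' l).2) = (B' l).2 - (B l).2 := fun l => by
    have h3 : (A l).2 - (A' l).2 = (A l).1 *ᵥ ((B' l).2 - (B l).2) := by
      rw [Matrix.mulVec_sub, sub_eq_sub_iff_add_eq_add, add_comm, h2, hA1, add_comm]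
    rw [h3, Matrix.mulVec_mulVec, (hAm l).1, Matrix.one_mulVec]
  have hB2 : ∀ l, (B' l).2 - (B l).2 = 0 := fun l => by
    ext p
    have := eq_of_extends_both_sides (g := fun l => ((B' l).2 - (B l).2) p)
      (W := fun w => ∑ j, (H w).1 j p * ((H w).2 j - (H' w).2 j))
      (V := fun w => (K' w).2 p - (K w).2 p)
      (diffContOnCl_sum_mul (fun j => hH1 j p) fun j => (hH2 j).sub (hH2' j))
      ((hK2' p).sub (hK2 p))
      (fun l => by simp only [hHA, hHA', ← htr]; rfl) (fun l => by simp only [hKB, hKB']; rfl) l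
    rw [this, hH0, hH0']
    simp
  have hA2 : ∀ l, (A l).2 = (A' l).2 := fun l => by
    have := h2 l
    rw [sub_eq_zero.1 (hB2 l), hA1] at this
    exact add_left_cancel this
  exact ⟨funext fun l => Prod.ext (hA1 l) (hA2 l),
    funext fun l => Prod.ext (hB1 l) (sub_eq_zero.1 (hB2 l)).symm⟩

/-! ### Real-linear differentials on the complex plane -/

/-- The real-linear map `p dz + q dz̄`. -/
noncomputable def lin (p q : ℂ) : ℂ →L[ℝ] ℂ :=
  p • (1 : ℂ →L[ℝ] ℂ) + q • (conjCLE : ℂ →L[ℝ] ℂ)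

@[simp] theorem lin_apply (p q v : ℂ) : lin p q v = p * v + q * (starRingEnd ℂ) v := by
  simp [lin]

theorem smul_lin (c p q : ℂ) : c • lin p q = lin (c * p) (c * q) := by
  ext; simp [mul_add, mul_assoc]

theorem lin_add_lin (p q p' q' : ℂ) : lin p q + lin p' q' = lin (p + p') (q + q') := by
  ext; simp; ring

theorem norm_lin_le (p q : ℂ) : ‖lin p q‖ ≤ ‖p‖ + ‖q‖ := by
  refine ContinuousLinearMap.opNorm_le_bound _ (by positivity) fun v => ?_
  rw [lin_apply, add_mul]
  refine (norm_add_le _ _).trans (le_of_eq ?_)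
  simp

theorem continuous_lin : Continuous fun pq : ℂ × ℂ => lin pq.1 pq.2 := by
  unfold lin; fun_prop

theorem hasDerivAt_of_lin {f : ℂ → ℂ} {p z : ℂ} (h : HasFDerivAt f (lin p 0) z) :
    HasDerivAt f p z := by
  rw [hasDerivAt_iff_hasFDerivAt]
  refine hasFDerivAt_of_restrictScalars ℝ h ?_
  ext; simp [mul_comm]

theorem hasFDerivAt_lin_of_hasDerivAt {f : ℂ → ℂ} {p z : ℂ} (h : HasDerivAt f p z) :
    HasFDerivAt f (lin p 0) z := by
  refine (h.hasFDerivAt.restrictScalars ℝ).congr_fderiv ?_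
  ext; simp [mul_comm]

theorem hasFDerivAt_mul_lin {f g : ℂ → ℂ} {p q p' q' z : ℂ} (hf : HasFDerivAt f (lin p q) z)
    (hg : HasFDerivAt g (lin p' q') z) :
    HasFDerivAt (fun w => f w * g w) (lin (f z * p' + g z * p) (f z * q' + g z * q)) z := by
  refine (hf.mul hg).congr_fderiv ?_
  rw [smul_lin, smul_lin, lin_add_lin]

/-- Differentiation under the integral sign; the bound uniform in λ is the dominating function. -/
theorem hasFDerivAt_loopCoeff {y p q : Circle → ℂ → ℂ} {z₁ : ℂ} {ρ M : ℝ} (hρ : 0 < ρ)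
    (hy : ∀ l, ∀ z ∈ ball z₁ ρ, HasFDerivAt (y l) (lin (p l z) (q l z)) z)
    (hyc : ∀ z ∈ ball z₁ ρ, Continuous fun l => y l z)
    (hpc : Continuous fun l => p l z₁) (hqc : Continuous fun l => q l z₁)
    (hp : ∀ l, ∀ z ∈ ball z₁ ρ, ‖p l z‖ ≤ M) (hq : ∀ l, ∀ z ∈ ball z₁ ρ, ‖q l z‖ ≤ M) (k : ℤ) :
    HasFDerivAt (fun z => loopCoeff (fun l => y l z) k)
      (lin (loopCoeff (fun l => p l z₁) k) (loopCoeff (fun l => q l z₁) k)) z₁ := by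
  simp only [loopCoeff_eq_integral]
  have h := hasFDerivAt_integral_of_dominated_of_fderiv_le (𝕜 := ℝ)
    (μ := AddCircle.haarAddCircle (T := 1)) (x₀ := z₁) (s := ball z₁ ρ) (bound := fun _ => M + M)
    (F := fun z t => (AddCircle.toCircle t : ℂ) ^ (-k) * y (AddCircle.toCircle t) z)
    (F' := fun z t => lin ((AddCircle.toCircle t : ℂ) ^ (-k) * p (AddCircle.toCircle t) z)
      ((AddCircle.toCircle t : ℂ) ^ (-k) * q (AddCircle.toCircle t) z))
    (ball_mem_nhds z₁ hρ) ?_ (integrable_loop (hyc z₁ (mem_ball_self hρ)) _) ?_ ?_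
    (integrable_const _) ?_
  · refine h.congr_fderiv ?_
    unfold lin
    rw [integral_add, integral_smul_const, integral_smul_const]
    · exact (integrable_loop hpc _).smul_const _
    · exact (integrable_loop hqc _).smul_const _
  · filter_upwards [ball_mem_nhds z₁ hρ] with z hz
    exact (integrable_loop (hyc z hz) _).aestronglyMeasurable
  · exact (continuous_lin.comp
      (((continuous_toCircle_zpow (-k)).mul (continuous_comp_toCircle hpc)).prodMk
      ((continuous_toCircle_zpow (-k)).mul (continuous_comp_toCircle hqc)))).aestronglyMeasurable
  · refine ae_of_all _ fun t z hz => (norm_lin_le _ _).trans ?_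
    simp only [norm_mul, norm_zpow, Circle.norm_coe, one_zpow, one_mul]
    exact add_le_add (hp _ z hz) (hq _ z hz)
  · refine ae_of_all _ fun t z hz => ?_
    exact ((hy _ z hz).const_mul _).congr_fderiv (smul_lin _ _ _)

/-! ### Holomorphic dependence of integrals on the spectral parameter -/

/-- Around w₀ ≠ 0 the closed ball of radius |w₀|/2 avoids 0 and is compact, so the w-derivative is
bounded there and dominates. -/
theorem differentiableOn_integral_of_continuousOn {Φ Φ' : ℂ → ℝ → ℂ}
    (hΦ : ContinuousOn (Function.uncurry Φ) ({0}ᶜ ×ˢ Icc 0 1))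
    (hΦ' : ContinuousOn (Function.uncurry Φ') ({0}ᶜ ×ˢ Icc 0 1))
    (hd : ∀ w ≠ 0, ∀ t ∈ Icc (0 : ℝ) 1, HasDerivAt (fun w => Φ w t) (Φ' w t) w) :
    DifferentiableOn ℂ (fun w => ∫ t in (0 : ℝ)..1, Φ w t) {0}ᶜ := by
  intro w₀ hw₀
  have hw₀' : w₀ ≠ 0 := hw₀
  have hsub : closedBall w₀ (‖w₀‖ / 2) ⊆ {0}ᶜ := by
    rintro w hw rfl
    have : 0 < ‖w₀‖ := norm_pos_iff.2 hw₀'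
    simp at hw; linarith
  obtain ⟨M, hM⟩ := ((isCompact_closedBall w₀ (‖w₀‖ / 2)).prod
    (isCompact_Icc (a := (0 : ℝ)) (b := 1))).exists_bound_of_continuousOn
    (hΦ'.mono (prod_mono hsub subset_rfl))
  have hIoc : uIoc (0 : ℝ) 1 ⊆ Icc 0 1 := by
    rw [uIoc_of_le zero_le_one]; exact Ioc_subset_Icc_self
  have hc : ∀ {Ψ : ℂ → ℝ → ℂ}, ContinuousOn (Function.uncurry Ψ) ({0}ᶜ ×ˢ Icc 0 1) → ∀ w ≠ 0,
      ContinuousOn (Ψ w) (Icc 0 1) := fun hΨ w hw =>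
    hΨ.comp (f := fun t => (w, t)) (by fun_prop) fun t ht => ⟨hw, ht⟩
  have hm : ∀ {Ψ : ℂ → ℝ → ℂ}, ContinuousOn (Function.uncurry Ψ) ({0}ᶜ ×ˢ Icc 0 1) → ∀ w ≠ 0,
      AEStronglyMeasurable (Ψ w) (volume.restrict (uIoc (0 : ℝ) 1)) := fun hΨ w hw =>
    ((hc hΨ w hw).mono hIoc).aestronglyMeasurable measurableSet_uIoc
  have h := intervalIntegral.hasDerivAt_integral_of_dominated_loc_of_deriv_le (μ := volume)
    (a := 0) (b := 1) (F := Φ) (F' := Φ') (x₀ := w₀) (s := closedBall w₀ (‖w₀‖ / 2))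
    (bound := fun _ => M) (closedBall_mem_nhds _ (by positivity)) ?_ ?_ (hm hΦ' w₀ hw₀') ?_ ?_ ?_
  · exact h.2.differentiableAt.differentiableWithinAt
  · filter_upwards [isOpen_compl_singleton.mem_nhds hw₀] with w hw using hm hΦ w hw
  · exact ContinuousOn.intervalIntegrable_of_Icc zero_le_one (hc hΦ w₀ hw₀')
  · exact ae_of_all _ fun t ht w hw => hM (w, t) ⟨hw, hIoc ht⟩
  · exact intervalIntegrable_const
  · exact ae_of_all _ fun t ht w hw => hd w (hsub hw) t (hIoc ht)

/-- The exponential `exp (σ (λ⁻² v + λ² v̄))`. -/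
noncomputable def kexp (σ w v : ℂ) : ℂ := exp (σ * (w⁻¹ ^ 2 * v + w ^ 2 * (starRingEnd ℂ) v))

theorem continuousOn_kexp {T : Type*} [TopologicalSpace T] {s : Set T} (σ : ℂ) {f g : T → ℂ}
    (hf : ContinuousOn f s) (hg : ContinuousOn g s) (hf0 : ∀ t ∈ s, f t ≠ 0) :
    ContinuousOn (fun t => kexp σ (f t) (g t)) s := by
  have h1 : ContinuousOn (fun t => (f t)⁻¹) s := hf.inv₀ hf0
  have h2 : ContinuousOn (fun t => (starRingEnd ℂ) (g t)) s :=
    continuous_conj.comp_continuousOn hg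
  unfold kexp
  fun_prop

/-- Only v is conjugated, never w, so `kexp` is holomorphic in the spectral parameter on the
punctured plane. -/
theorem hasDerivAt_kexp (σ v : ℂ) {w : ℂ} (hw : w ≠ 0) :
    HasDerivAt (fun w => kexp σ w v)
      (kexp σ w v * (σ * (-2 * w⁻¹ ^ 3 * v + 2 * w * (starRingEnd ℂ) v))) w := by
  unfold kexp
  have h1 : HasDerivAt (fun w : ℂ => w⁻¹) (-(w ^ 2)⁻¹) w := hasDerivAt_inv hw
  have h2 := ((((h1.fun_pow 2).mul_const v).add
    (((hasDerivAt_id w).fun_pow 2).mul_const ((starRingEnd ℂ) v))).const_mul σ).cexp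
  refine h2.congr_deriv ?_
  simp
  left; left
  field_simp

theorem differentiableOn_integral_kexp (σ : ℂ) {u a b : ℝ → ℂ} (hu : ContinuousOn u (Icc 0 1))
    (ha : ContinuousOn a (Icc 0 1)) (hb : ContinuousOn b (Icc 0 1)) :
    DifferentiableOn ℂ (fun w => ∫ t in (0 : ℝ)..1, kexp σ w (u t) * (w⁻¹ * a t + w * b t))
      {0}ᶜ := by
  have hf : ContinuousOn (fun p : ℂ × ℝ => p.1) ({0}ᶜ ×ˢ Icc 0 1) := continuousOn_fst
  have hfi : ContinuousOn (fun p : ℂ × ℝ => p.1⁻¹) ({0}ᶜ ×ˢ Icc (0 : ℝ) 1) :=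
    hf.inv₀ fun p hp => hp.1
  have lift : ∀ {f : ℝ → ℂ}, ContinuousOn f (Icc 0 1) →
      ContinuousOn (fun p : ℂ × ℝ => f p.2) ({0}ᶜ ×ˢ Icc 0 1) := fun h =>
    h.comp continuousOn_snd fun p hp => hp.2
  have hk := continuousOn_kexp σ hf (lift hu) fun p hp => hp.1
  have ha' := lift ha
  have hb' := lift hb
  have hu' := lift hu
  have hcu' := continuous_conj.comp_continuousOn hu'
  refine differentiableOn_integral_of_continuousOn
    (Φ := fun w t => kexp σ w (u t) * (w⁻¹ * a t + w * b t))
    (Φ' := fun w t => kexp σ w (u t) * (σ * (-2 * w⁻¹ ^ 3 * u t + 2 * w * (starRingEnd ℂ) (u t))) *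
      (w⁻¹ * a t + w * b t) + kexp σ w (u t) * (-(w ^ 2)⁻¹ * a t + b t)) ?_ ?_ ?_
  · exact hk.mul ((hfi.mul ha').add (hf.mul hb'))
  · simp only [← inv_pow]
    refine ((hk.mul (continuousOn_const.mul (((continuousOn_const.mul (hfi.pow 3)).mul hu').add
      ((continuousOn_const.mul hf).mul hcu')))).mul ((hfi.mul ha').add (hf.mul hb'))).add
      (hk.mul (((hfi.pow 2).neg.mul ha').add hb'))
  · intro w hw t _
    refine ((hasDerivAt_kexp σ (u t) hw).mul (((hasDerivAt_inv hw).mul_const (a t)).add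
      ((hasDerivAt_id w).mul_const (b t)))).congr_deriv ?_
    simp

/-- A family `x` of functions with `x(z₀) = 0` and
`dx = exp (σ (λ⁻² u + λ² ū)) (λ⁻¹ a dz + λ b dz̄)`. -/
structure IsSpectralFamily (Ω : Set ℂ) (z₀ σ : ℂ) (u a b : ℂ → ℂ) (x : Circle → ℂ → ℂ) :
    Prop where
  isOpen : IsOpen Ω
  isPreconnected : IsPreconnected Ω
  mem : z₀ ∈ Ω
  differentiableOn : DifferentiableOn ℂ u Ω
  continuousOn_left : ContinuousOn a Ω
  continuousOn_right : ContinuousOn b Ω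
  base : ∀ l, x l z₀ = 0
  hasFDerivAt : ∀ l : Circle, ∀ z ∈ Ω, HasFDerivAt (x l)
    (lin (kexp σ l (u z) * ((l : ℂ)⁻¹ * a z)) (kexp σ l (u z) * ((l : ℂ) * b z))) z

namespace IsSpectralFamily

variable {Ω : Set ℂ} {z₀ σ : ℂ} {u a b : ℂ → ℂ} {x : Circle → ℂ → ℂ}

/-- The increment of the family along the segment from `z` to `z + ζ`, as a function of the
spectral parameter in the punctured plane. -/
noncomputable def incr (σ : ℂ) (u a b : ℂ → ℂ) (z ζ w : ℂ) : ℂ :=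
  ∫ t in (0 : ℝ)..1, kexp σ w (u (z + t * ζ)) *
    (w⁻¹ * (a (z + t * ζ) * ζ) + w * (b (z + t * ζ) * (starRingEnd ℂ) ζ))

theorem segment_mem {z₁ z ζ : ℂ} {ρ : ℝ} (hz : z ∈ closedBall z₁ ρ) (hz' : z + ζ ∈ closedBall z₁ ρ)
    {t : ℝ} (ht : t ∈ Icc (0 : ℝ) 1) : z + t * ζ ∈ closedBall z₁ ρ := by
  have := (convex_closedBall z₁ ρ).add_smul_mem hz hz' ht
  simpa using this

theorem continuousOn_segment {f : ℂ → ℂ} (hf : ContinuousOn f Ω) {z₁ z ζ : ℂ} {ρ : ℝ}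
    (hΩ : closedBall z₁ ρ ⊆ Ω)
    (hz : z ∈ closedBall z₁ ρ) (hz' : z + ζ ∈ closedBall z₁ ρ) :
    ContinuousOn (fun t : ℝ => f (z + t * ζ)) (Icc 0 1) :=
  hf.comp (by fun_prop) fun _ ht => hΩ (segment_mem hz hz' ht)

theorem differentiableOn_incr (hx : IsSpectralFamily Ω z₀ σ u a b x) {z₁ z ζ : ℂ} {ρ : ℝ}
    (hΩ : closedBall z₁ ρ ⊆ Ω) (hz : z ∈ closedBall z₁ ρ) (hz' : z + ζ ∈ closedBall z₁ ρ) :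
    DifferentiableOn ℂ (incr σ u a b z ζ) {0}ᶜ :=
  differentiableOn_integral_kexp σ
    (continuousOn_segment hx.differentiableOn.continuousOn hΩ hz hz')
    ((continuousOn_segment hx.continuousOn_left hΩ hz hz').mul continuousOn_const)
    ((continuousOn_segment hx.continuousOn_right hΩ hz hz').mul continuousOn_const)

/-- The fundamental theorem of calculus along the segment from z to z + ζ. -/
theorem add_incr (hx : IsSpectralFamily Ω z₀ σ u a b x) {z₁ z ζ : ℂ} {ρ : ℝ}
    (hΩ : closedBall z₁ ρ ⊆ Ω) (hz : z ∈ closedBall z₁ ρ) (hz' : z + ζ ∈ closedBall z₁ ρ)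
    (l : Circle) : x l z + incr σ u a b z ζ l = x l (z + ζ) := by
  have hd : ∀ t ∈ uIcc (0 : ℝ) 1, HasDerivAt (fun t : ℝ => x l (z + t * ζ))
      (kexp σ l (u (z + t * ζ)) * ((l : ℂ)⁻¹ * (a (z + t * ζ) * ζ) +
        l * (b (z + t * ζ) * (starRingEnd ℂ) ζ))) t := by
    intro t ht
    rw [uIcc_of_le zero_le_one] at ht
    have h1 : HasDerivAt (fun t : ℝ => z + t * ζ) ζ t := by
      simpa using ((Complex.ofRealCLM.hasDerivAt (x := t)).mul_const ζ).const_add z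
    refine ((hx.hasFDerivAt l _ (hΩ (segment_mem hz hz' ht))).comp_hasDerivAt t h1).congr_deriv ?_
    rw [lin_apply]; ring
  have hc : ContinuousOn (fun t : ℝ => kexp σ l (u (z + t * ζ)) *
      ((l : ℂ)⁻¹ * (a (z + t * ζ) * ζ) + l * (b (z + t * ζ) * (starRingEnd ℂ) ζ))) (Icc 0 1) :=
    (continuousOn_kexp σ continuousOn_const
      (continuousOn_segment hx.differentiableOn.continuousOn hΩ hz hz')
      fun _ _ => Circle.coe_ne_zero l).mul
    ((continuousOn_const.mul
      ((continuousOn_segment hx.continuousOn_left hΩ hz hz').mul continuousOn_const)).add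
    (continuousOn_const.mul
      ((continuousOn_segment hx.continuousOn_right hΩ hz hz').mul continuousOn_const)))
  have := intervalIntegral.integral_eq_sub_of_hasDerivAt hd
    (hc.intervalIntegrable_of_Icc zero_le_one)
  rw [incr, this]
  simp

theorem loopHol_add_incr (hx : IsSpectralFamily Ω z₀ σ u a b x) {z₁ z z' : ℂ} {ρ : ℝ}
    (hΩ : closedBall z₁ ρ ⊆ Ω) (hz : z ∈ closedBall z₁ ρ) (hz' : z' ∈ closedBall z₁ ρ)
    (h : LoopHol fun l => x l z) : LoopHol fun l => x l z' := by
  have hz'' : z + (z' - z) ∈ closedBall z₁ ρ := by simpa using hz'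
  have h2 : LoopHol fun l => incr σ u a b z (z' - z) l :=
    ⟨_, hx.differentiableOn_incr hΩ hz hz'', fun _ => rfl⟩
  have h3 := h.add h2
  simp only [hx.add_incr hΩ hz hz''] at h3
  simpa using h3

/-- Increments along segments are holomorphic in the spectral parameter, so the property passes both
ways between the centre of a small disk and its points. It holds at z₀, where the family vanishes,
and spreads over Ω by connectedness. -/
theorem loopHol (hx : IsSpectralFamily Ω z₀ σ u a b x) {z : ℂ} (hz : z ∈ Ω) :
    LoopHol fun l => x l z := by
  refine hx.isPreconnected.induction₂'
    (fun z z' => (LoopHol fun l => x l z) → LoopHol fun l => x l z')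
    (fun z₁ hz₁ => ?_) (fun _ _ _ _ _ _ h h' => h' ∘ h) hx.mem hz ?_
  · obtain ⟨ρ, hρ, hΩ⟩ := nhds_basis_closedBall.mem_iff.1 (hx.isOpen.mem_nhds hz₁)
    filter_upwards [mem_nhdsWithin_of_mem_nhds (closedBall_mem_nhds z₁ hρ)] with z' hz'
    have h1 := mem_closedBall_self (x := z₁) hρ.le
    exact ⟨hx.loopHol_add_incr hΩ h1 hz', hx.loopHol_add_incr hΩ hz' h1⟩
  · simpa only [hx.base] using LoopHol.const 0

theorem exists_bound {K : Set ℂ} (hK : IsCompact K) {f : ℂ × ℂ → ℂ}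
    (hf : ContinuousOn f (annulus 2 ×ˢ K)) :
    ∃ M, 0 ≤ M ∧ ∀ w ∈ annulus 2, ∀ z ∈ K, ‖f (w, z)‖ ≤ M := by
  obtain ⟨M, hM⟩ := ((isCompact_annulus 2).prod hK).exists_bound_of_continuousOn hf
  exact ⟨max M 0, le_max_right _ _, fun w hw z hz => (hM (w, z) ⟨hw, hz⟩).trans (le_max_left _ _)⟩

theorem exists_bound_incr (hx : IsSpectralFamily Ω z₀ σ u a b x) {z₁ : ℂ} {ρ : ℝ}
    (hΩ : closedBall z₁ ρ ⊆ Ω) (hρ : 0 < ρ) :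
    ∃ M, ∀ w ∈ annulus 2, ∀ ζ ∈ closedBall (0 : ℂ) ρ, ‖incr σ u a b z₁ ζ w‖ ≤ M := by
  have hw0 : ∀ p : ℂ × ℂ, p ∈ annulus 2 ×ˢ closedBall z₁ ρ → p.1 ≠ 0 := fun p hp =>
    annulus_subset one_le_two hp.1
  have hk : ContinuousOn (fun p : ℂ × ℂ => kexp σ p.1 (u p.2)) (annulus 2 ×ˢ closedBall z₁ ρ) :=
    continuousOn_kexp σ continuousOn_fst
      ((hx.differentiableOn.continuousOn.mono hΩ).comp continuousOn_snd fun p hp => hp.2) hw0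
  obtain ⟨M₁, h0, hM₁⟩ := exists_bound (isCompact_closedBall z₁ ρ) (hk.mul
    ((continuousOn_fst.inv₀ hw0).mul
      ((hx.continuousOn_left.mono hΩ).comp continuousOn_snd fun p hp => hp.2)))
  obtain ⟨M₂, h0', hM₂⟩ := exists_bound (isCompact_closedBall z₁ ρ) (hk.mul
    (continuousOn_fst.mul
      ((hx.continuousOn_right.mono hΩ).comp continuousOn_snd fun p hp => hp.2)))
  refine ⟨M₁ * ρ + M₂ * ρ, fun w hw ζ hζ => ?_⟩
  have hz := mem_closedBall_self (x := z₁) hρ.le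
  have hζ' : z₁ + ζ ∈ closedBall z₁ ρ := by simpa using hζ
  have hζn : ‖ζ‖ ≤ ρ := by simpa using hζ
  have := intervalIntegral.norm_integral_le_of_norm_le_const (a := 0) (b := 1)
    (C := M₁ * ρ + M₂ * ρ) (f := fun t : ℝ => kexp σ w (u (z₁ + t * ζ)) *
      (w⁻¹ * (a (z₁ + t * ζ) * ζ) + w * (b (z₁ + t * ζ) * (starRingEnd ℂ) ζ))) fun t ht => ?_
  · simpa [incr] using this
  · rw [uIoc_of_le zero_le_one] at ht
    have hs := segment_mem hz hζ' (Ioc_subset_Icc_self ht)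
    have e : ∀ k a b c : ℂ, k * (w⁻¹ * (a * ζ) + w * (b * c)) =
        k * (w⁻¹ * a) * ζ + k * (w * b) * c := by intros; ring
    rw [e]
    refine (norm_add_le _ _).trans ?_
    rw [norm_mul, norm_mul _ ((starRingEnd ℂ) ζ), RCLike.norm_conj]
    exact add_le_add (mul_le_mul (hM₁ w hw _ hs) hζn (norm_nonneg _) h0)
      (mul_le_mul (hM₂ w hw _ hs) hζn (norm_nonneg _) h0')

/-- The family `y = exp (-σ λ⁻² u) x`. -/
noncomputable def gauge (σ : ℂ) (u : ℂ → ℂ) (x : Circle → ℂ → ℂ) (l : Circle) (z : ℂ) : ℂ :=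
  exp (-σ * ((l : ℂ)⁻¹ ^ 2 * u z)) * x l z

theorem loopHol_gauge (hx : IsSpectralFamily Ω z₀ σ u a b x) {z : ℂ} (hz : z ∈ Ω) :
    LoopHol fun l => gauge σ u x l z :=
  (LoopHol.of_entire_inv (N := fun w => exp (-σ * (w ^ 2 * u z))) (by fun_prop)).mul (hx.loopHol hz)

/-- A bound on the annulus that is uniform in z near z₁ makes the decay of the Fourier coefficients
uniform in z. This is what allows differentiating a coefficient and, later, the whole series term by
term. -/
theorem exists_local_extension (hx : IsSpectralFamily Ω z₀ σ u a b x) {z₁ : ℂ} (hz₁ : z₁ ∈ Ω) :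
    ∃ ρ > 0, ∃ M, closedBall z₁ ρ ⊆ Ω ∧ ∀ z ∈ ball z₁ ρ, ∃ G : ℂ → ℂ,
      DifferentiableOn ℂ G {0}ᶜ ∧ (∀ l : Circle, G l = gauge σ u x l z) ∧
      ∀ w ∈ annulus 2, ‖G w‖ ≤ M := by
  obtain ⟨ρ, hρ, hΩ⟩ := nhds_basis_closedBall.mem_iff.1 (hx.isOpen.mem_nhds hz₁)
  obtain ⟨G₁, hd, hG₁⟩ := hx.loopHol hz₁
  obtain ⟨M₁, hM₁⟩ := (isCompact_annulus 2).exists_bound_of_continuousOn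
    (hd.continuousOn.mono (annulus_subset one_le_two))
  obtain ⟨M₂, hM₂⟩ := hx.exists_bound_incr hΩ hρ
  have hw0 : ∀ p : ℂ × ℂ, p ∈ annulus 2 ×ˢ closedBall z₁ ρ → p.1 ≠ 0 := fun p hp =>
    annulus_subset one_le_two hp.1
  have hi : ContinuousOn (fun p : ℂ × ℂ => p.1⁻¹) (annulus 2 ×ˢ closedBall z₁ ρ) :=
    continuousOn_fst.inv₀ hw0
  have hu : ContinuousOn (fun p : ℂ × ℂ => u p.2) (annulus 2 ×ˢ closedBall z₁ ρ) :=
    (hx.differentiableOn.continuousOn.mono hΩ).comp continuousOn_snd fun p hp => hp.2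
  obtain ⟨M₃, h0, hM₃⟩ := exists_bound (isCompact_closedBall z₁ ρ)
    (f := fun p => exp (-σ * (p.1⁻¹ ^ 2 * u p.2)))
    (continuous_exp.comp_continuousOn (continuousOn_const.mul ((hi.pow 2).mul hu)))
  refine ⟨ρ, hρ, M₃ * (M₁ + M₂), hΩ, fun z hz => ?_⟩
  have hz1 := mem_closedBall_self (x := z₁) hρ.le
  have hz' : z₁ + (z - z₁) ∈ closedBall z₁ ρ := by simpa using (ball_subset_closedBall hz)
  have hζ : z - z₁ ∈ closedBall (0 : ℂ) ρ := by
    have := ball_subset_closedBall hz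
    rw [mem_closedBall, dist_eq_norm] at this
    simpa using this
  -- The extension at z is built from one fixed extension G₁ at z₁ and the increment from z₁ to z;
  -- both factors have bounds independent of z.
  refine ⟨fun w => exp (-σ * (w⁻¹ ^ 2 * u z)) * (G₁ w + incr σ u a b z₁ (z - z₁) w), ?_, ?_, ?_⟩
  · have hinv : DifferentiableOn ℂ (fun w : ℂ => w⁻¹) {0}ᶜ := differentiableOn_inv
    refine DifferentiableOn.mul ?_ (hd.add (hx.differentiableOn_incr hΩ hz1 hz'))
    exact (((hinv.pow 2).mul_const _).const_mul _).cexp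
  · intro l
    have h := hx.add_incr hΩ hz1 hz' l
    rw [add_sub_cancel] at h
    simp only [gauge, ← h, hG₁]
  · intro w hw
    rw [norm_mul]
    exact mul_le_mul (hM₃ w hw z (ball_subset_closedBall hz))
      ((norm_add_le _ _).trans (add_le_add (hM₁ w hw) (hM₂ w hw _ hζ))) (norm_nonneg _) h0

end IsSpectralFamily

/-! ### Differential equations for the Fourier coefficients of the gauged family -/

namespace IsSpectralFamily

variable {Ω : Set ℂ} {z₀ σ : ℂ} {u a b : ℂ → ℂ} {x : Circle → ℂ → ℂ}

/-- The gauge cancels the λ⁻² half of the exponent. What remains, exp(σλ²ū), is a power series in λ,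
so the dz̄ coefficient contains only positive powers of λ. -/
theorem hasFDerivAt_gauge (hx : IsSpectralFamily Ω z₀ σ u a b x) {z : ℂ} (hz : z ∈ Ω)
    (l : Circle) : HasFDerivAt (gauge σ u x l)
      (lin (-σ * deriv u z * ((l : ℂ)⁻¹ ^ 2 * gauge σ u x l z) +
          (l : ℂ)⁻¹ * (exp (σ * ((l : ℂ) ^ 2 * (starRingEnd ℂ) (u z))) * a z))
        ((l : ℂ) * (exp (σ * ((l : ℂ) ^ 2 * (starRingEnd ℂ) (u z))) * b z))) z := by
  have hu := (hx.differentiableOn.differentiableAt (hx.isOpen.mem_nhds hz)).hasDerivAt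
  have he := hasFDerivAt_lin_of_hasDerivAt ((hu.const_mul ((l : ℂ)⁻¹ ^ 2)).const_mul (-σ)).cexp
  have hk : exp (-σ * ((l : ℂ)⁻¹ ^ 2 * u z)) * kexp σ l (u z) =
      exp (σ * ((l : ℂ) ^ 2 * (starRingEnd ℂ) (u z))) := by
    rw [kexp, ← exp_add]; congr 1; ring
  refine (hasFDerivAt_mul_lin he (hx.hasFDerivAt l z hz)).congr_fderiv ?_
  rw [← hk, gauge]
  congr 1 <;> ring

theorem norm_exp_le (l : Circle) (v : ℂ) :
    ‖exp (σ * ((l : ℂ) ^ 2 * (starRingEnd ℂ) v))‖ ≤ Real.exp (‖σ‖ * ‖v‖) := by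
  refine (norm_exp_le_exp_norm _).trans (Real.exp_le_exp.2 (le_of_eq ?_))
  simp [Circle.norm_coe]

/-- For k < 0 the dz̄ coefficient of the gauged family has no λ^k term, so the Fourier coefficient
is holomorphic in z. In the dz coefficient, λ⁻² shifts the index by two and λ⁻¹exp(σλ²ū)a
contributes only its leading term, at k = -1. -/
theorem hasDerivAt_loopCoeff_gauge (hx : IsSpectralFamily Ω z₀ σ u a b x) {z₁ : ℂ} (hz₁ : z₁ ∈ Ω)
    {k : ℤ} (hk : k < 0) : HasDerivAt (fun z => loopCoeff (fun l => gauge σ u x l z) k)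
      (-σ * deriv u z₁ * loopCoeff (fun l => gauge σ u x l z₁) (k + 2) +
        if k = -1 then a z₁ else 0) z₁ := by
  obtain ⟨ρ, hρ, M, hΩ, hG⟩ := hx.exists_local_extension hz₁
  have hM : ∀ l, ∀ z ∈ ball z₁ ρ, ‖gauge σ u x l z‖ ≤ M := by
    intro l z hz
    obtain ⟨G, -, hGl, hGM⟩ := hG z hz
    rw [← hGl]
    exact hGM _ (coe_mem_annulus one_le_two l)
  have hu := hx.differentiableOn.continuousOn.mono hΩ
  have hu' := (hx.differentiableOn.deriv hx.isOpen).continuousOn.mono hΩ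
  have ha := hx.continuousOn_left.mono hΩ
  have hb := hx.continuousOn_right.mono hΩ
  have hexp : ContinuousOn (fun z => Real.exp (‖σ‖ * ‖u z‖)) (closedBall z₁ ρ) :=
    Real.continuous_exp.comp_continuousOn (continuousOn_const.mul hu.norm)
  obtain ⟨M₁, hM₁⟩ := (isCompact_closedBall z₁ ρ).exists_bound_of_continuousOn
    (f := fun z => ‖σ‖ * ‖deriv u z‖ * M + Real.exp (‖σ‖ * ‖u z‖) * ‖a z‖)
    (((continuousOn_const.mul hu'.norm).mul continuousOn_const).add (hexp.mul ha.norm))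
  obtain ⟨M₂, hM₂⟩ := (isCompact_closedBall z₁ ρ).exists_bound_of_continuousOn
    (f := fun z => Real.exp (‖σ‖ * ‖u z‖) * ‖b z‖) (hexp.mul hb.norm)
  have hyc : Continuous fun l => gauge σ u x l z₁ := (hx.loopHol_gauge hz₁).continuous
  have hent : ∀ c : ℂ, Differentiable ℂ fun w : ℂ =>
      exp (σ * (w ^ 2 * (starRingEnd ℂ) (u z₁))) * c := fun c => by fun_prop
  have hentc : ∀ c : ℂ, Continuous fun l : Circle =>
      exp (σ * ((l : ℂ) ^ 2 * (starRingEnd ℂ) (u z₁))) * c := fun c =>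
    (LoopHol.of_entire (hent c)).continuous
  have hcoe : Continuous fun l : Circle => (l : ℂ) := continuous_subtype_val
  have hinv : Continuous fun l : Circle => (l : ℂ)⁻¹ :=
    hcoe.inv₀ fun l => Circle.coe_ne_zero l
  -- At nonpositive indices, exp(σλ²ū)c has only its value at λ = 0.
  have hcoeff : ∀ c : ℂ, ∀ k : ℤ, k ≤ 0 → loopCoeff (fun l : Circle =>
      exp (σ * ((l : ℂ) ^ 2 * (starRingEnd ℂ) (u z₁))) * c) k = if k = 0 then c else 0 := by
    intro c k hk
    have h := loopCoeff_of_diffContOnCl (g := fun l : Circle =>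
      exp (σ * ((l : ℂ) ^ 2 * (starRingEnd ℂ) (u z₁))) * c) (fun _ => rfl) (hent c).diffContOnCl
    split_ifs with h0
    · rw [h0, h.1]; simp
    · exact h.2 k (lt_of_le_of_ne hk h0)
  have h := hasFDerivAt_loopCoeff (M := max M₁ M₂) hρ
    (fun l z hz => hx.hasFDerivAt_gauge (hΩ (ball_subset_closedBall hz)) l)
    (fun z hz => (hx.loopHol_gauge (hΩ (ball_subset_closedBall hz))).continuous)
    ((continuous_const.mul ((hinv.pow 2).mul hyc)).add (hinv.mul (hentc _)))
    (hcoe.mul (hentc _)) ?_ ?_ k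
  · apply hasDerivAt_of_lin
    refine h.congr_fderiv ?_
    congr 1
    · have e0 := loopCoeff_add
        (g := fun l : Circle => -σ * deriv u z₁ * ((l : ℂ)⁻¹ ^ 2 * gauge σ u x l z₁))
        (h := fun l : Circle => (l : ℂ)⁻¹ *
          (exp (σ * ((l : ℂ) ^ 2 * (starRingEnd ℂ) (u z₁))) * a z₁))
        (continuous_const.mul ((hinv.pow 2).mul hyc)) (hinv.mul (hentc _)) k
      rw [e0, loopCoeff_const_mul]
      have e1 := loopCoeff_zpow_mul (-2) (fun l => gauge σ u x l z₁) k
      have e2 := loopCoeff_zpow_mul (-1) (fun l : Circle =>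
        exp (σ * ((l : ℂ) ^ 2 * (starRingEnd ℂ) (u z₁))) * a z₁) k
      simp only [zpow_neg, zpow_ofNat, ← inv_pow, pow_one, sub_neg_eq_add] at e1 e2
      rw [e1, e2, hcoeff _ _ (by omega)]
      congr 2
      simp only [eq_iff_iff]; omega
    · have e2 := loopCoeff_zpow_mul 1 (fun l : Circle =>
        exp (σ * ((l : ℂ) ^ 2 * (starRingEnd ℂ) (u z₁))) * b z₁) k
      simp only [zpow_one] at e2
      rw [e2, hcoeff _ _ (by omega), if_neg (by omega)]
  · intro l z hz
    refine le_trans ?_ (((le_abs_self _).trans (hM₁ z (ball_subset_closedBall hz))).trans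
      (le_max_left _ _))
    refine (norm_add_le _ _).trans (add_le_add ?_ ?_)
    · simp only [norm_mul, norm_neg, norm_pow, norm_inv, Circle.norm_coe, inv_one, one_pow, one_mul]
      exact mul_le_mul_of_nonneg_left (hM l z hz) (by positivity)
    · rw [norm_mul, norm_mul, norm_inv, Circle.norm_coe, inv_one, one_mul]
      exact mul_le_mul_of_nonneg_right (norm_exp_le l _) (norm_nonneg _)
  · intro l z hz
    refine le_trans ?_ (((le_abs_self _).trans (hM₂ z (ball_subset_closedBall hz))).trans
      (le_max_right _ _))
    rw [norm_mul, norm_mul, Circle.norm_coe, one_mul]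
    exact mul_le_mul_of_nonneg_right (norm_exp_le l _) (norm_nonneg _)

/-- The negative part of the Fourier series of the gauged family. -/
noncomputable def negSum (σ : ℂ) (u : ℂ → ℂ) (x : Circle → ℂ → ℂ) (l : Circle) (z : ℂ) : ℂ :=
  ∑' n : ℕ, loopCoeff (fun m => gauge σ u x m z) (-((n : ℤ) + 1)) * (l : ℂ) ^ (-((n : ℤ) + 1))

/-- Summing the recursion over k < 0, the shifted series is λ⁻² times the negative part together
with the two terms of index 0 and 1 that the shift brings in. -/
theorem hasDerivAt_negSum (hx : IsSpectralFamily Ω z₀ σ u a b x) {z₁ : ℂ} (hz₁ : z₁ ∈ Ω)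
    (l : Circle) : HasDerivAt (negSum σ u x l)
      (-σ * deriv u z₁ * ((l : ℂ)⁻¹ ^ 2 * (negSum σ u x l z₁ +
        loopCoeff (fun m => gauge σ u x m z₁) 0) +
        (l : ℂ)⁻¹ * loopCoeff (fun m => gauge σ u x m z₁) 1) + (l : ℂ)⁻¹ * a z₁) z₁ := by
  obtain ⟨ρ, hρ, M, hΩ, hG⟩ := hx.exists_local_extension hz₁
  have hl0 : (l : ℂ) ≠ 0 := Circle.coe_ne_zero l
  set c : ℤ → ℂ → ℂ := fun k z => loopCoeff (fun m => gauge σ u x m z) k with hc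
  set F : ℕ → ℂ → ℂ := fun n z => c (-((n : ℤ) + 1)) z * (l : ℂ) ^ (-((n : ℤ) + 1)) with hF
  have hFd : ∀ n : ℕ, ∀ z ∈ Ω, HasDerivAt (F n)
      ((-σ * deriv u z * c (-((n : ℤ) + 1) + 2) z + if -((n : ℤ) + 1) = -1 then a z else 0) *
        (l : ℂ) ^ (-((n : ℤ) + 1))) z := fun n z hz =>
    (hx.hasDerivAt_loopCoeff_gauge hz (by omega)).mul_const _
  have hbd : ∀ n : ℕ, ∀ z ∈ ball z₁ ρ, ‖F n z‖ ≤ M * 2⁻¹ ^ (n + 1) := by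
    intro n z hz
    obtain ⟨G, hd, hGl, hGM⟩ := hG z hz
    have := norm_loopCoeff_le_of_annulus hGl hd one_le_two hGM (-((n : ℤ) + 1))
    have e : (-((n : ℤ) + 1)).natAbs = n + 1 := by omega
    rw [e] at this
    simpa [hF, norm_mul, norm_zpow, Circle.norm_coe] using this
  have hsum : Summable fun n : ℕ => M * (2⁻¹ : ℝ) ^ (n + 1) :=
    ((summable_nat_add_iff 1).2
      (summable_geometric_of_lt_one (r := (2⁻¹ : ℝ)) (by norm_num) (by norm_num))).mul_left M
  have hFo : ∀ n : ℕ, DifferentiableOn ℂ (F n) (ball z₁ ρ) := fun n z hz =>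
    (hFd n z (hΩ (ball_subset_closedBall hz))).differentiableAt.differentiableWithinAt
  have hmem := mem_ball_self (x := z₁) hρ
  have hdiff := (differentiableOn_tsum_of_summable_norm hsum hFo isOpen_ball
    hbd).differentiableAt (isOpen_ball.mem_nhds hmem)
  have hder := hasSum_deriv_of_summable_norm hsum hFo isOpen_ball hbd hmem
  refine hdiff.hasDerivAt.congr_deriv (hder.unique ?_)
  have hFs : HasSum (fun n => F n z₁) (negSum σ u x l z₁) :=
    (Summable.of_norm_bounded hsum fun n => hbd n z₁ hmem).hasSum
  -- From n = 2 on, the derivative of the n-th term is a multiple of the term n - 2. The first two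
  -- derivatives involve the coefficients 1 and 0 and are handled separately.
  rw [← hasSum_nat_add_iff' 2]
  have h2 := hFs.mul_left (-σ * deriv u z₁ * (l : ℂ)⁻¹ ^ 2)
  have hterm : (fun n => deriv (F (n + 2)) z₁) =
      fun n => -σ * deriv u z₁ * (l : ℂ)⁻¹ ^ 2 * F n z₁ := by
    ext n
    rw [(hFd (n + 2) z₁ hz₁).deriv, if_neg (by omega)]
    have e : (-(((n + 2 : ℕ) : ℤ) + 1) + 2) = -((n : ℤ) + 1) := by push_cast; ring
    have e' : (-(((n + 2 : ℕ) : ℤ) + 1)) = -((n : ℤ) + 1) + (-2) := by push_cast; ring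
    rw [e, e', zpow_add₀ hl0]
    simp only [hF, zpow_neg, zpow_ofNat, inv_pow]
    ring
  rw [hterm]
  refine Eq.subst (motive := fun s => HasSum _ s) ?_ h2
  symm
  rw [Finset.sum_range_succ, Finset.sum_range_one, (hFd 0 z₁ hz₁).deriv, (hFd 1 z₁ hz₁).deriv]
  have e1 : ((l : ℂ) ^ (-(((0 : ℕ) : ℤ) + 1))) = (l : ℂ)⁻¹ := by simp
  have e2 : ((l : ℂ) ^ (-(((1 : ℕ) : ℤ) + 1))) = (l : ℂ)⁻¹ ^ 2 := by
    rw [inv_pow, ← zpow_natCast, ← zpow_neg]; norm_num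
  rw [e1, e2, if_pos (by norm_num), if_neg (by norm_num), hc]
  norm_num
  ring

end IsSpectralFamily

/-! ### Matrix identities -/

theorem Li_mul_Li (R : Type*) [CommRing R] : Li R * Li R = -1 := by
  ext p q; fin_cases p <;> fin_cases q <;> simp [Li, Matrix.mul_apply, Fin.sum_univ_four]

theorem Lj_mul_Lj (R : Type*) [CommRing R] : Lj R * Lj R = -1 := by
  ext p q; fin_cases p <;> fin_cases q <;> simp [Lj, Matrix.mul_apply, Fin.sum_univ_four]

theorem Lj_mul_Li (R : Type*) [CommRing R] : Lj R * Li R = -(Li R * Lj R) := by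
  ext p q; fin_cases p <;> fin_cases q <;> simp [Li, Lj, Matrix.mul_apply, Fin.sum_univ_four]

theorem Li_transpose (R : Type*) [CommRing R] : (Li R)ᵀ = -Li R := by
  ext p q; fin_cases p <;> fin_cases q <;> simp [Li]

theorem Li_mulVec_Li {R : Type*} [CommRing R] (V : Fin 4 → R) : Li R *ᵥ (Li R *ᵥ V) = -V := by
  rw [Matrix.mulVec_mulVec, Li_mul_Li, Matrix.neg_mulVec, Matrix.one_mulVec]

theorem Lj_mulVec_Lj {R : Type*} [CommRing R] (V : Fin 4 → R) : Lj R *ᵥ (Lj R *ᵥ V) = -V := by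
  rw [Matrix.mulVec_mulVec, Lj_mul_Lj, Matrix.neg_mulVec, Matrix.one_mulVec]

theorem Lj_mulVec_Li {R : Type*} [CommRing R] (V : Fin 4 → R) :
    Lj R *ᵥ (Li R *ᵥ V) = -(Li R *ᵥ (Lj R *ᵥ V)) := by
  rw [Matrix.mulVec_mulVec, Lj_mul_Li, Matrix.neg_mulVec, Matrix.mulVec_mulVec]

/-- The rotation `exp (c L_i) = cos c + sin c L_i`. -/
noncomputable def rot (c : ℂ) : Matrix (Fin 4) (Fin 4) ℂ :=
  cos c • (1 : Matrix (Fin 4) (Fin 4) ℂ) + sin c • Li ℂ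

theorem rot_zero : rot 0 = 1 := by simp [rot]

theorem rot_mul_rot (c d : ℂ) : rot c * rot d = rot (c + d) := by
  simp only [rot, cos_add, sin_add, add_mul, mul_add, smul_mul_assoc, mul_smul_comm, Li_mul_Li,
    Matrix.one_mul, Matrix.mul_one]
  module

theorem rot_mul_rot_neg (c : ℂ) : rot c * rot (-c) = 1 := by
  rw [rot_mul_rot, add_neg_cancel, rot_zero]

theorem rot_neg_mul_rot (c : ℂ) : rot (-c) * rot c = 1 := by
  rw [rot_mul_rot, neg_add_cancel, rot_zero]

theorem rot_transpose (c : ℂ) : (rot c)ᵀ = rot (-c) := by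
  simp [rot, Matrix.transpose_add, Li_transpose]

theorem rot_mul_Li (c : ℂ) : rot c * Li ℂ = Li ℂ * rot c := by
  simp [rot, add_mul, mul_add]

theorem Lj_mul_rot (c : ℂ) : Lj ℂ * rot c = rot (-c) * Lj ℂ := by
  simp [rot, add_mul, mul_add, Lj_mul_Li]

theorem rot_mulVec_apply (c : ℂ) (V : Fin 4 → ℂ) (p : Fin 4) :
    (rot c *ᵥ V) p = cos c * V p + sin c * (Li ℂ *ᵥ V) p := by
  simp [rot, Matrix.add_mulVec, Matrix.smul_mulVec]

theorem Lj_mulVec_rot (c : ℂ) (V : Fin 4 → ℂ) :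
    Lj ℂ *ᵥ (rot c *ᵥ V) = rot (-c) *ᵥ (Lj ℂ *ᵥ V) := by
  rw [Matrix.mulVec_mulVec, Lj_mul_rot, Matrix.mulVec_mulVec]

theorem Li_mulVec_rot (c : ℂ) (V : Fin 4 → ℂ) :
    Li ℂ *ᵥ (rot c *ᵥ V) = rot c *ᵥ (Li ℂ *ᵥ V) := by
  rw [Matrix.mulVec_mulVec, ← rot_mul_Li, Matrix.mulVec_mulVec]

/-- The component of `V` in the eigenspace of `L_i` with eigenvalue `σ = ±i`, doubled. -/
noncomputable def proj (σ : ℂ) (V : Fin 4 → ℂ) : Fin 4 → ℂ := V - σ • (Li ℂ *ᵥ V)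

/-- On the image of `proj σ`, L_i acts as the scalar σ, because σ⁻¹ = -σ; so exp(cL_i) acts there as
e^{σc}. -/
theorem proj_rot {σ : ℂ} (hσ : σ ^ 2 = -1) (c : ℂ) (V : Fin 4 → ℂ) :
    proj σ (rot c *ᵥ V) = exp (σ * c) • proj σ V := by
  have he : exp (σ * c) = cos c + σ * sin c := by
    have : σ = I ∨ σ = -I := by
      rw [← sq_eq_sq_iff_eq_or_eq_neg, hσ, I_sq]
    rcases this with rfl | rfl
    · rw [mul_comm, exp_mul_I]; ring
    · rw [neg_mul, ← mul_neg, mul_comm, exp_mul_I, cos_neg, sin_neg]; ring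
  ext p
  have hL : (Li ℂ *ᵥ (Li ℂ *ᵥ V)) p = -V p := by rw [Li_mulVec_Li]; rfl
  simp only [proj, Pi.sub_apply, Pi.smul_apply, smul_eq_mul, Li_mulVec_rot, rot_mulVec_apply, hL,
    he]
  linear_combination (sin c * (Li ℂ *ᵥ V) p) * hσ

theorem rotation_exp (c : ℂ) : NormedSpace.exp (c • Li ℂ) = rot c := by
  -- The columns of P are eigenvectors (1, -i) and (1, i) of L_i in each coordinate plane, with
  -- eigenvalues i and -i.
  set P : Matrix (Fin 4) (Fin 4) ℂ := !![1, 1, 0, 0; -I, I, 0, 0; 0, 0, 1, 1; 0, 0, -I, I]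
  set P' : Matrix (Fin 4) (Fin 4) ℂ :=
    !![1/2, I/2, 0, 0; 1/2, -I/2, 0, 0; 0, 0, 1/2, I/2; 0, 0, 1/2, -I/2]
  have hPP : P * P' = 1 := by
    ext p q
    fin_cases p <;> fin_cases q <;> simp [P, P', Matrix.mul_apply, Fin.sum_univ_four] <;>
      ring_nf <;> simp
  have hinv : P⁻¹ = P' := Matrix.inv_eq_right_inv hPP
  have hU : IsUnit P := IsUnit.of_mul_eq_one _ hPP
  have hD : ∀ s t : ℂ, P * Matrix.diagonal ![s, t, s, t] * P⁻¹ =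
      ((s + t) / 2) • (1 : Matrix (Fin 4) (Fin 4) ℂ) + ((s - t) / (2 * I)) • Li ℂ := by
    intro s t
    rw [hinv]
    ext p q
    rw [Matrix.mul_apply]
    simp only [Matrix.mul_diagonal]
    fin_cases p <;> fin_cases q <;>
      simp [P, P', Li, Fin.sum_univ_four] <;> ring_nf <;> simp <;> ring
  have h1 : c • Li ℂ = P * Matrix.diagonal ![c * I, -(c * I), c * I, -(c * I)] * P⁻¹ := by
    rw [hD, add_neg_cancel, zero_div, zero_smul, zero_add]
    congr 1
    field_simp
    ring
  rw [h1, Matrix.exp_conj _ _ hU, Matrix.exp_diagonal]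
  have h2 : NormedSpace.exp ![c * I, -(c * I), c * I, -(c * I)] =
      ![exp (c * I), exp (-(c * I)), exp (c * I), exp (-(c * I))] := by
    ext p
    rw [Pi.coe_exp, ← exp_eq_exp_ℂ]
    fin_cases p <;> rfl
  rw [h2, hD, rot]
  congr 2
  · rw [cos, neg_mul]
  · rw [sin, neg_mul]
    field_simp
    simp

theorem rotExp_eq (c : ℂ) (β γ : ℂ → ℝ) (l : Circle) (z : ℂ) :
    rotExp c β γ l z = rot (c * ((l : ℂ)⁻¹ ^ 2 * (((β z : ℂ) + I * γ z) / 4))) := by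
  rw [rotExp, rotation_exp]
  congr 1
  rw [zpow_neg, zpow_ofNat, inv_pow]
  ring

theorem rot_mem_affGroup (c : ℂ) (T : Fin 4 → ℂ) : (rot c, T) ∈ affGroup ℂ := by
  refine ⟨?_, rot_mul_Li c⟩
  rw [rot_transpose, rot_neg_mul_rot]

/-! ### The automorphism `τ` and its eigenspaces -/

/-- τ² is +1 on matrices and -1 on vectors, so even eigenspaces of τ carry only rotations and odd
ones only translations. -/
theorem tau_tau_fst (ξ : Aff ℂ) : (tau (tau ξ)).1 = ξ.1 := by
  simp only [tau, mul_neg, neg_mul, neg_neg]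
  rw [← Matrix.mul_assoc, ← Matrix.mul_assoc, Lj_mul_Lj, Matrix.mul_assoc, Lj_mul_Lj]
  simp

theorem tau_tau_snd (ξ : Aff ℂ) : (tau (tau ξ)).2 = -ξ.2 := by
  simp only [tau, Matrix.mulVec_neg, neg_neg, Lj_mulVec_Lj]

theorem tauProj_eq (k : ℤ) (ξ : Aff ℂ) : tauProj k ξ =
    (1 / 4 : ℂ) • (ξ + I ^ (-k) • tau ξ + I ^ (-(k * 2)) • tau (tau ξ) +
      I ^ (-(k * 3)) • tau (tau (tau ξ))) := by
  simp [tauProj, Finset.sum_range_succ]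

theorem tauProj_zero (ξ : Aff ℂ) : tauProj 0 ξ = ((1 / 2 : ℂ) • (ξ.1 - Lj ℂ * ξ.1 * Lj ℂ), 0) := by
  rw [tauProj_eq]
  have h3 : (tau (tau (tau ξ))).1 = (tau ξ).1 := by rw [tau_tau_fst]
  have h3' : (tau (tau (tau ξ))).2 = -(tau ξ).2 := by rw [tau_tau_snd]
  refine Prod.ext ?_ ?_
  · simp [h3, tau_tau_fst]
    simp only [tau]
    module
  · simp [h3', tau_tau_snd]

theorem tauProj_two (ξ : Aff ℂ) : tauProj 2 ξ = ((1 / 2 : ℂ) • (ξ.1 + Lj ℂ * ξ.1 * Lj ℂ), 0) := by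
  rw [tauProj_eq]
  have h3 : (tau (tau (tau ξ))).1 = (tau ξ).1 := by rw [tau_tau_fst]
  have h3' : (tau (tau (tau ξ))).2 = -(tau ξ).2 := by rw [tau_tau_snd]
  have e1 : I ^ (-2 : ℤ) = -1 := by rw [zpow_neg, zpow_ofNat]; simp
  have e2 : I ^ (-(2 * 2) : ℤ) = 1 := by rw [zpow_neg]; norm_num
  have e3 : I ^ (-(2 * 3) : ℤ) = -1 := by
    rw [show (-(2 * 3) : ℤ) = -4 + -2 from rfl, zpow_add₀ I_ne_zero, e1, zpow_neg]
    norm_num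
  rw [e1, e2, e3]
  refine Prod.ext ?_ ?_
  · simp [h3, tau_tau_fst]
    simp only [tau]
    module
  · simp [h3', tau_tau_snd]

theorem tauProj_one (ξ : Aff ℂ) : tauProj 1 ξ = (0, (1 / 2 : ℂ) • (ξ.2 + I • (Lj ℂ *ᵥ ξ.2))) := by
  rw [tauProj_eq]
  have h3 : (tau (tau (tau ξ))).1 = (tau ξ).1 := by rw [tau_tau_fst]
  have h3' : (tau (tau (tau ξ))).2 = -(tau ξ).2 := by rw [tau_tau_snd]
  have e1 : I ^ (-1 : ℤ) = -I := by simp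
  have e2 : I ^ (-(1 * 2) : ℤ) = -1 := by rw [one_mul, zpow_neg, zpow_ofNat]; simp
  have e3 : I ^ (-(1 * 3) : ℤ) = I := by rw [one_mul, zpow_neg, zpow_ofNat, I_pow_three]; simp
  rw [e1, e2, e3]
  refine Prod.ext ?_ ?_
  · simp [h3, tau_tau_fst]
  · simp [h3', tau_tau_snd]
    simp only [tau]
    module

theorem tauProj_neg_one (ξ : Aff ℂ) :
    tauProj (-1) ξ = (0, (1 / 2 : ℂ) • (ξ.2 - I • (Lj ℂ *ᵥ ξ.2))) := by
  rw [tauProj_eq]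
  have h3 : (tau (tau (tau ξ))).1 = (tau ξ).1 := by rw [tau_tau_fst]
  have h3' : (tau (tau (tau ξ))).2 = -(tau ξ).2 := by rw [tau_tau_snd]
  have e1 : I ^ (-(-1) : ℤ) = I := by simp
  have e2 : I ^ (-(-1 * 2) : ℤ) = -1 := by norm_num
  have e3 : I ^ (-(-1 * 3) : ℤ) = -I := by norm_num
  rw [e1, e2, e3]
  refine Prod.ext ?_ ?_
  · simp [h3, tau_tau_fst]
  · simp [h3', tau_tau_snd]
    simp only [tau]
    module

/-! ### The special unitary part of the frame -/

/-- Commuting with L_i means being a complex 2×2 matrix written in real blocks, hence determined by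
columns 0 and 2. -/
theorem entries_of_mul_Li_comm {R : Type*} [CommRing R] {G : Matrix (Fin 4) (Fin 4) R}
    (h : G * Li R = Li R * G) :
    G 0 1 = -G 1 0 ∧ G 1 1 = G 0 0 ∧ G 2 1 = -G 3 0 ∧ G 3 1 = G 2 0 ∧
    G 0 3 = -G 1 2 ∧ G 1 3 = G 0 2 ∧ G 2 3 = -G 3 2 ∧ G 3 3 = G 2 2 := by
  have e := fun p q => congrFun (congrFun h p) q
  have e00 := e 0 0
  have e10 := e 1 0
  have e20 := e 2 0
  have e30 := e 3 0
  have e02 := e 0 2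
  have e12 := e 1 2
  have e22 := e 2 2
  have e32 := e 3 2
  simp [Matrix.mul_apply, Li, Fin.sum_univ_four] at e00 e10 e20 e30 e02 e12 e22 e32
  exact ⟨e00, e10, e20, e30, e02, e12, e22, e32⟩

/-- The complex determinant of a matrix commuting with `L_i`. -/
noncomputable def cdet (G : Matrix (Fin 4) (Fin 4) ℝ) : ℂ :=
  hermDet (fun p => G p 0) (fun p => G p 2)

/-- A special unitary matrix with first complex column (p, q) has second column (-q̄, p̄), which is
exactly commutation with L_j. -/
theorem commute_Lj_of_cdet_eq_one {G : Matrix (Fin 4) (Fin 4) ℝ} (h1 : Gᵀ * G = 1)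
    (h2 : G * Li ℝ = Li ℝ * G) (hd : cdet G = 1) : G * Lj ℝ = Lj ℝ * G := by
  obtain ⟨a1, a2, a3, a4, a5, a6, a7, a8⟩ := entries_of_mul_Li_comm h2
  have hre := congrArg Complex.re hd
  have him := congrArg Complex.im hd
  simp [cdet, hermDet] at hre him
  have e := fun p q => congrFun (congrFun h1 p) q
  have n1 := e 0 0
  have n2 := e 0 2
  have n3 := e 1 2
  simp [Matrix.mul_apply, Fin.sum_univ_four] at n1 n2 n3
  rw [a1, a2, a3, a4] at n3
  -- Unitary orthogonality to the first column and determinant 1 form a linear system for the second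
  -- column, with determinant the squared norm of the first; Cramer's rule gives the four
  -- coefficients.
  have k1 : G 2 2 = G 0 0 := by
    linear_combination (-G 2 2) * n1 + G 0 0 * hre + G 1 0 * him + G 2 0 * n2 - G 3 0 * n3
  have k2 : G 3 2 = -G 1 0 := by
    linear_combination (-G 3 2) * n1 + G 0 0 * him - G 1 0 * hre + G 3 0 * n2 + G 2 0 * n3
  have k3 : G 0 2 = -G 2 0 := by
    linear_combination (-G 0 2) * n1 - G 2 0 * hre - G 3 0 * him + G 0 0 * n2 - G 1 0 * n3
  have k4 : G 1 2 = G 3 0 := by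
    linear_combination (-G 1 2) * n1 - G 2 0 * him + G 3 0 * hre + G 1 0 * n2 + G 0 0 * n3
  ext p q
  fin_cases p <;> fin_cases q <;>
    simp [Matrix.mul_apply, Lj, Fin.sum_univ_four, a1, a2, a3, a4, a5, a6, a7, a8, k1, k2, k3, k4]

/-- The complex determinant is multiplicative, and that of K is |q|² = 1. -/
theorem hermDet_mul_groupZero {F K : Matrix (Fin 4) (Fin 4) ℝ} (hF : F * Li ℝ = Li ℝ * F)
    (hK : K ∈ groupZero) :
    hermDet (F *ᵥ (K *ᵥ Pi.single 0 1)) (F *ᵥ (K *ᵥ Pi.single 2 1)) = cdet F := by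
  obtain ⟨q, hq, rfl⟩ := hK
  obtain ⟨a1, a2, a3, a4, a5, a6, a7, a8⟩ := entries_of_mul_Li_comm hF
  rw [Fin.sum_univ_four] at hq
  simp only [hermDet, cdet, Matrix.mulVec, dotProduct, Fin.sum_univ_four, Ri, Rj, Rk, a1, a2, a3,
    a4, a5, a6, a7, a8]
  apply Complex.ext
  · simp
    linear_combination (F 0 0 * F 2 2 - F 1 0 * F 3 2 - F 0 2 * F 2 0 + F 1 2 * F 3 0) * hq
  · simp
    linear_combination (F 0 0 * F 3 2 + F 1 0 * F 2 2 - F 0 2 * F 3 0 - F 1 2 * F 2 0) * hq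

theorem dotProduct_groupZero {K : Matrix (Fin 4) (Fin 4) ℝ} (hK : K ∈ groupZero) :
    (K *ᵥ Pi.single 0 1) ⬝ᵥ (K *ᵥ Pi.single 0 1) = 1 ∧
    (K *ᵥ Pi.single 2 1) ⬝ᵥ (K *ᵥ Pi.single 2 1) = 1 := by
  obtain ⟨q, hq, rfl⟩ := hK
  rw [Fin.sum_univ_four] at hq
  constructor <;>
  · simp [Matrix.mulVec, dotProduct, Fin.sum_univ_four, Ri, Rj, Rk]
    linear_combination hq

theorem dotProduct_mulVec_of_orthogonal {F : Matrix (Fin 4) (Fin 4) ℝ} (hF : Fᵀ * F = 1)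
    (v : Fin 4 → ℝ) : (F *ᵥ v) ⬝ᵥ (F *ᵥ v) = v ⬝ᵥ v := by
  rw [Matrix.dotProduct_mulVec, Matrix.vecMul_mulVec, hF, Matrix.vecMul_one]

/-- After normalization e^f disappears and the tangent vectors are FKε₁ and FKε₃, so the Lagrangian
angle is the phase of the complex determinant of F. -/
theorem cdet_eq_exp {Ω : Set ℂ} {z₀ : ℂ} {U : ℂ → Aff ℝ} {β : ℂ → ℝ} (hU : IsLCLI Ω z₀ U)
    (hβ : IsLagrangianAngle Ω z₀ (fun z => (U z).2) β) {z : ℂ} (hz : z ∈ Ω) :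
    cdet (U z).1 = exp (I * β z) := by
  obtain ⟨f, K, -, -, h⟩ := hU.translation
  obtain ⟨hK, hx, hy⟩ := h z hz
  obtain ⟨hn0, hn2⟩ := dotProduct_groupZero hK
  have hUz := hU.mem z hz
  have hcancel : ∀ v w : Fin 4 → ℝ, (U z).1⁻¹ *ᵥ v = w → v = (U z).1 *ᵥ w := by
    rintro v w rfl
    rw [affGroup.inv_eq hUz, Matrix.mulVec_mulVec, affGroup.mul_transpose hUz, Matrix.one_mulVec]
  have hx' := hcancel _ _ hx
  have hy' := hcancel _ _ hy
  have hnorm : ∀ v : Fin 4 → ℝ, v ⬝ᵥ v = 1 →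
      (√(((U z).1 *ᵥ (Real.exp (f z) • v)) ⬝ᵥ ((U z).1 *ᵥ (Real.exp (f z) • v))))⁻¹ •
        ((U z).1 *ᵥ (Real.exp (f z) • v)) = (U z).1 *ᵥ v := by
    intro v hv
    rw [dotProduct_mulVec_of_orthogonal hUz.1, dotProduct_smul, smul_dotProduct, hv,
      Matrix.mulVec_smul, smul_eq_mul, smul_eq_mul, mul_one, Real.sqrt_mul_self (Real.exp_pos _).le,
      smul_smul, inv_mul_cancel₀ (Real.exp_pos _).ne', one_smul]
  rw [hβ.angle z hz, hx', hy', hnorm _ hn0, hnorm _ hn2, hermDet_mul_groupZero hUz.2 hK]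

/-- The factor `exp (-β L_i / 2) F` of the frame `F`. -/
noncomputable def frame (U : ℂ → Aff ℝ) (β : ℂ → ℝ) (z : ℂ) : Matrix (Fin 4) (Fin 4) ℂ :=
  rot (-(β z / 2)) * (complexify (U z)).1

theorem Li_map : (Li ℝ).map (fun x : ℝ => (x : ℂ)) = Li ℂ := by
  ext p q; fin_cases p <;> fin_cases q <;> simp [Li]

theorem Lj_map : (Lj ℝ).map (fun x : ℝ => (x : ℂ)) = Lj ℂ := by
  ext p q; fin_cases p <;> fin_cases q <;> simp [Lj]

theorem map_ofReal_mul (A B : Matrix (Fin 4) (Fin 4) ℝ) :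
    (A * B).map (fun x : ℝ => (x : ℂ)) =
      A.map (fun x : ℝ => (x : ℂ)) * B.map (fun x : ℝ => (x : ℂ)) :=
  Matrix.map_mul (f := Complex.ofRealHom)

theorem complexify_mem {U : Aff ℝ} (hU : U ∈ affGroup ℝ) : complexify U ∈ affGroup ℂ := by
  constructor
  · have := congrArg (fun M => M.map (fun x : ℝ => (x : ℂ))) hU.1
    simp only [map_ofReal_mul] at this
    rw [Matrix.map_one _ (by simp) (by simp)] at this
    exact this
  · have := congrArg (fun M => M.map (fun x : ℝ => (x : ℂ))) hU.2
    simp only [map_ofReal_mul, Li_map] at this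
    exact this

theorem complexify_affOne : complexify (affOne ℝ) = affOne ℂ := by
  refine Prod.ext (Matrix.map_one _ (by simp) (by simp)) ?_
  ext p; simp [complexify, affOne]

/-- The factor e^{-βL_i/2} has complex determinant e^{-iβ}, which cancels that of F. The argument
runs over ℝ with the real form `B` of the rotation and is then complexified. -/
theorem frame_commute_Lj {Ω : Set ℂ} {z₀ : ℂ} {U : ℂ → Aff ℝ} {β : ℂ → ℝ} (hU : IsLCLI Ω z₀ U)
    (hβ : IsLagrangianAngle Ω z₀ (fun z => (U z).2) β) {z : ℂ} (hz : z ∈ Ω) :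
    frame U β z * Lj ℂ = Lj ℂ * frame U β z := by
  have hUz := hU.mem z hz
  set c := Real.cos (β z / 2)
  set s := Real.sin (β z / 2)
  have hcs : c ^ 2 + s ^ 2 = 1 := Real.cos_sq_add_sin_sq _
  set F := (U z).1
  set B : Matrix (Fin 4) (Fin 4) ℝ := c • 1 - s • Li ℝ with hB
  have hBB : Bᵀ * B = 1 := by
    simp only [hB, Matrix.transpose_sub, Matrix.transpose_smul, Matrix.transpose_one, Li_transpose,
      sub_mul, mul_sub, smul_mul_assoc, mul_smul_comm, Matrix.one_mul, Matrix.mul_one, neg_mul,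
      smul_neg, Li_mul_Li]
    exact Eq.trans (b := (c ^ 2 + s ^ 2) • (1 : Matrix (Fin 4) (Fin 4) ℝ)) (by module)
      (by rw [hcs, one_smul])
  have hG : ((B * F).map fun x : ℝ => (x : ℂ)) = frame U β z := by
    rw [map_ofReal_mul, frame]
    congr 1
    ext p q
    simp only [hB, rot, Matrix.map_apply, Matrix.sub_apply, Matrix.smul_apply, Matrix.add_apply,
      smul_eq_mul, cos_neg, sin_neg, ← Li_map]
    simp [c, s, Matrix.one_apply, sub_eq_add_neg]
    split_ifs <;> simp
  have h1 : (B * F)ᵀ * (B * F) = 1 := by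
    rw [Matrix.transpose_mul, Matrix.mul_assoc, ← Matrix.mul_assoc Bᵀ, hBB, Matrix.one_mul, hUz.1]
  have h2 : (B * F) * Li ℝ = Li ℝ * (B * F) := by
    have : B * Li ℝ = Li ℝ * B := by simp [hB, sub_mul, mul_sub]
    rw [Matrix.mul_assoc, hUz.2, ← Matrix.mul_assoc, this, Matrix.mul_assoc]
  have h3 : cdet (B * F) = 1 := by
    have e : cdet (B * F) = (c - I * s) ^ 2 * cdet F := by
      simp [cdet, hermDet, hB, Matrix.mul_apply, Fin.sum_univ_four, Li, Matrix.one_apply]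
      ring_nf
      simp only [I_sq, I_pow_three, I_pow_four]
      ring
    have e2 : (c : ℂ) - I * s = exp (-(I * (β z / 2))) := by
      rw [mul_comm I (β z / 2 : ℂ), ← neg_mul, exp_mul_I, cos_neg, sin_neg]
      simp [c, s]; ring
    rw [e, cdet_eq_exp hU hβ hz, e2, ← exp_nat_mul, ← exp_add]
    simp
    ring_nf
    simp
  have := congrArg (fun M => M.map (fun x : ℝ => (x : ℂ))) (commute_Lj_of_cdet_eq_one h1 h2 h3)
  simp only [map_ofReal_mul, Lj_map] at this
  rwa [← map_ofReal_mul, hG] at this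

/-! ### Differentiation of matrix-valued functions -/

/-- The matrix-valued function `M` has differential `P dz + Q dz̄` at `z`. -/
def HasMDeriv (M : ℂ → Matrix (Fin 4) (Fin 4) ℂ) (P Q : Matrix (Fin 4) (Fin 4) ℂ) (z : ℂ) : Prop :=
  ∀ p q, HasFDerivAt (fun w => M w p q) (lin (P p q) (Q p q)) z

/-- The vector-valued function `V` has differential `P dz + Q dz̄` at `z`. -/
def HasVDeriv (V : ℂ → Fin 4 → ℂ) (P Q : Fin 4 → ℂ) (z : ℂ) : Prop :=
  ∀ p, HasFDerivAt (fun w => V w p) (lin (P p) (Q p)) z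

theorem lin_sum {ι : Type*} (s : Finset ι) (p q : ι → ℂ) :
    ∑ i ∈ s, lin (p i) (q i) = lin (∑ i ∈ s, p i) (∑ i ∈ s, q i) := by
  ext; simp [Finset.sum_add_distrib, Finset.sum_mul]

theorem lin_zero : lin 0 0 = 0 := by ext; simp

theorem hasFDerivAt_comp_lin {f g : ℂ → ℂ} {g' p q z : ℂ} (hg : HasDerivAt g g' (f z))
    (hf : HasFDerivAt f (lin p q) z) : HasFDerivAt (fun w => g (f w)) (lin (g' * p) (g' * q)) z := by
  refine ((hg.hasFDerivAt.restrictScalars ℝ).comp z hf).congr_fderiv ?_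
  ext; simp; ring

theorem dZ_eq_of_lin {f : ℂ → ℂ} {p q z : ℂ} (h : HasFDerivAt f (lin p q) z) : dZ f z = p := by
  rw [dZ, h.fderiv]
  simp
  linear_combination (-p / 2 + q / 2) * I_sq

theorem dZbar_eq_of_lin {f : ℂ → ℂ} {p q z : ℂ} (h : HasFDerivAt f (lin p q) z) :
    dZbar f z = q := by
  rw [dZbar, h.fderiv]
  simp
  linear_combination (p / 2 - q / 2) * I_sq

theorem hasFDerivAt_lin_of_differentiableAt {f : ℂ → ℂ} {z : ℂ} (h : DifferentiableAt ℝ f z) :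
    HasFDerivAt f (lin (dZ f z) (dZbar f z)) z := by
  refine h.hasFDerivAt.congr_fderiv ?_
  ext v
  have hv : fderiv ℝ f z v = v.re * fderiv ℝ f z 1 + v.im * fderiv ℝ f z I := by
    conv_lhs => rw [← re_add_im v]
    have e : ((v.re : ℂ) + v.im * I) = v.re • (1 : ℂ) + v.im • I := by simp
    rw [e, map_add, map_smul, map_smul]
    simp
  have hc : (starRingEnd ℂ) v = v.re - v.im * I := by
    apply Complex.ext <;> simp
  rw [hv, lin_apply, hc, dZ, dZbar]
  linear_combination (-((fderiv ℝ f z 1 - I * fderiv ℝ f z I) / 2)) * (re_add_im v).symm +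
    (v.im * fderiv ℝ f z I) * I_sq

theorem eq_of_lin_zero {Ω : Set ℂ} (hΩ : IsOpen Ω) (hc : IsPreconnected Ω) {f : ℂ → ℂ}
    (h : ∀ z ∈ Ω, HasFDerivAt f (lin 0 0) z) {z z₀ : ℂ} (hz : z ∈ Ω) (hz₀ : z₀ ∈ Ω) :
    f z = f z₀ :=
  hΩ.is_const_of_fderiv_eq_zero hc
    (fun w hw => (h w hw).differentiableAt.differentiableWithinAt)
    (fun w hw => by rw [(h w hw).fderiv, lin_zero]; rfl) hz hz₀

namespace HasMDeriv

variable {M N : ℂ → Matrix (Fin 4) (Fin 4) ℂ} {P Q P' Q' : Matrix (Fin 4) (Fin 4) ℂ} {z : ℂ}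

theorem mul (hM : HasMDeriv M P Q z) (hN : HasMDeriv N P' Q' z) :
    HasMDeriv (fun w => M w * N w) (P * N z + M z * P') (Q * N z + M z * Q') z := by
  intro p q
  have := HasFDerivAt.fun_sum (u := Finset.univ) fun j _ => hasFDerivAt_mul_lin (hM p j) (hN j q)
  simp only [lin_sum] at this
  simp only [Matrix.mul_apply, Matrix.add_apply, ← Finset.sum_add_distrib]
  refine this.congr_fderiv ?_
  congr 1 <;> exact Finset.sum_congr rfl fun j _ => by ring

theorem mulVec {V : ℂ → Fin 4 → ℂ} {A B : Fin 4 → ℂ} (hM : HasMDeriv M P Q z)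
    (hV : HasVDeriv V A B z) :
    HasVDeriv (fun w => M w *ᵥ V w) (P *ᵥ V z + M z *ᵥ A) (Q *ᵥ V z + M z *ᵥ B) z := by
  intro p
  have := HasFDerivAt.fun_sum (u := Finset.univ) fun j _ => hasFDerivAt_mul_lin (hM p j) (hV j)
  simp only [lin_sum] at this
  simp only [Matrix.mulVec, dotProduct, Pi.add_apply, ← Finset.sum_add_distrib]
  refine this.congr_fderiv ?_
  congr 1 <;> exact Finset.sum_congr rfl fun j _ => by ring

theorem transpose (hM : HasMDeriv M P Q z) : HasMDeriv (fun w => (M w)ᵀ) Pᵀ Qᵀ z :=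
  fun p q => hM q p

theorem const (A : Matrix (Fin 4) (Fin 4) ℂ) (z : ℂ) : HasMDeriv (fun _ => A) 0 0 z := fun p q => by
  simpa [lin_zero] using hasFDerivAt_const (A p q) z

theorem rot {v : ℂ → ℂ} {p q : ℂ} (hv : HasFDerivAt v (lin p q) z) :
    HasMDeriv (fun w => HSL.rot (v w)) (p • (Li ℂ * HSL.rot (v z))) (q • (Li ℂ * HSL.rot (v z)))
      z := by
  intro i j
  have h := ((hasFDerivAt_comp_lin (hasDerivAt_cos _) hv).mul_const
    ((1 : Matrix (Fin 4) (Fin 4) ℂ) i j)).add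
    ((hasFDerivAt_comp_lin (hasDerivAt_sin _) hv).mul_const (Li ℂ i j))
  have e : Li ℂ * HSL.rot (v z) =
      (-sin (v z)) • (1 : Matrix (Fin 4) (Fin 4) ℂ) + cos (v z) • Li ℂ := by
    simp [HSL.rot, mul_add, Li_mul_Li, add_comm]
  rw [e]
  refine h.congr_fderiv ?_
  rw [smul_lin, smul_lin, lin_add_lin]
  simp only [Matrix.smul_apply, Matrix.add_apply, smul_eq_mul]
  congr 1 <;> ring

theorem congr_deriv (hM : HasMDeriv M P Q z) (hP : P = P') (hQ : Q = Q') : HasMDeriv M P' Q' z := by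
  rwa [← hP, ← hQ]

theorem eq_of_zero {Ω : Set ℂ} (hΩ : IsOpen Ω) (hc : IsPreconnected Ω)
    (h : ∀ z ∈ Ω, HasMDeriv M 0 0 z) {z z₀ : ℂ} (hz : z ∈ Ω) (hz₀ : z₀ ∈ Ω) : M z = M z₀ := by
  ext p q
  exact eq_of_lin_zero hΩ hc (f := fun w => M w p q) (fun w hw => h w hw p q) hz hz₀

theorem unique (hM : HasMDeriv M P Q z) (hN : HasMDeriv M P' Q' z) : P = P' ∧ Q = Q' :=
  ⟨by ext p q; rw [← dZ_eq_of_lin (hM p q), dZ_eq_of_lin (hN p q)],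
    by ext p q; rw [← dZbar_eq_of_lin (hM p q), dZbar_eq_of_lin (hN p q)]⟩

theorem congr_on {Ω : Set ℂ} (hΩ : IsOpen Ω) (hz : z ∈ Ω) (h : ∀ w ∈ Ω, M w = N w)
    (hM : HasMDeriv M P Q z) : HasMDeriv N P Q z := fun p q =>
  (hM p q).congr_of_eventuallyEq
    (Filter.eventuallyEq_of_mem (hΩ.mem_nhds hz) fun w hw => by
      simp only [h w hw])

end HasMDeriv

/-! ### Maurer-Cartan forms -/

theorem hasFDerivAt_ofReal_comp {Ω : Set ℂ} (hΩ : IsOpen Ω) {f : ℂ → ℝ} (hf : ContDiffOn ℝ ∞ f Ω)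
    {z : ℂ} (hz : z ∈ Ω) : DifferentiableAt ℝ (fun w => (f w : ℂ)) z :=
  (ofRealCLM.differentiableAt).comp z
    ((hf.differentiableOn (by simp)).differentiableAt (hΩ.mem_nhds hz))

theorem hasMDeriv_mc {Ω : Set ℂ} (hΩ : IsOpen Ω) {U : ℂ → Aff ℝ} (hU : SmoothOn Ω U)
    (hm : ∀ z ∈ Ω, U z ∈ affGroup ℝ) {z : ℂ} (hz : z ∈ Ω) :
    HasMDeriv (fun w => (complexify (U w)).1)
      ((complexify (U z)).1 * (mcZ (fun w => complexify (U w)) z).1)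
      ((complexify (U z)).1 * (mcZbar (fun w => complexify (U w)) z).1) z ∧
    HasVDeriv (fun w => (complexify (U w)).2)
      ((complexify (U z)).1 *ᵥ (mcZ (fun w => complexify (U w)) z).2)
      ((complexify (U z)).1 *ᵥ (mcZbar (fun w => complexify (U w)) z).2) z := by
  have hUz := complexify_mem (hm z hz)
  have hinv : (complexify (U z)).1 * (complexify (U z)).1⁻¹ = 1 := by
    rw [affGroup.inv_eq hUz, affGroup.mul_transpose hUz]
  simp only [mcZ, mcZbar, ← Matrix.mul_assoc, Matrix.mulVec_mulVec, hinv, Matrix.one_mul,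
    Matrix.one_mulVec]
  exact ⟨fun p q => hasFDerivAt_lin_of_differentiableAt
      (hasFDerivAt_ofReal_comp hΩ (hU.1 p q) hz),
    fun p => hasFDerivAt_lin_of_differentiableAt (hasFDerivAt_ofReal_comp hΩ (hU.2 p) hz)⟩

theorem dZbar_ofReal {f : ℂ → ℝ} {z : ℂ} (hf : DifferentiableAt ℝ f z) :
    dZbar (fun w => (f w : ℂ)) z = (starRingEnd ℂ) (dZ (fun w => (f w : ℂ)) z) := by
  have h : fderiv ℝ (fun w => (f w : ℂ)) z = ofRealCLM.comp (fderiv ℝ f z) :=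
    (ofRealCLM.hasFDerivAt.comp z hf.hasFDerivAt).fderiv
  simp only [dZ, dZbar, h, ContinuousLinearMap.comp_apply, ofRealCLM_apply, map_div₀, map_sub,
    map_mul, conj_ofReal, conj_I, map_ofNat, neg_mul, sub_neg_eq_add]

section Frame

variable {Ω : Set ℂ} {z₀ : ℂ} {U : ℂ → Aff ℝ} {E : Circle → ℂ → Aff ℝ} {β : ℂ → ℝ}

theorem frame_orthogonal (hU : IsLCLI Ω z₀ U) {z : ℂ} (hz : z ∈ Ω) :
    (frame U β z)ᵀ * frame U β z = 1 := by
  rw [frame, Matrix.transpose_mul, rot_transpose, Matrix.mul_assoc, ← Matrix.mul_assoc (rot _),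
    rot_neg_mul_rot, Matrix.one_mul, (complexify_mem (hU.mem z hz)).1]

theorem frame_commute_Li (hU : IsLCLI Ω z₀ U) {z : ℂ} (hz : z ∈ Ω) :
    frame U β z * Li ℂ = Li ℂ * frame U β z := by
  rw [frame, Matrix.mul_assoc, (complexify_mem (hU.mem z hz)).2, ← Matrix.mul_assoc, rot_mul_Li,
    Matrix.mul_assoc]

theorem frame_base (hU : IsLCLI Ω z₀ U) (hβ : β z₀ = 0) : frame U β z₀ = 1 := by
  rw [frame, hU.base, complexify_affOne, hβ]
  simp [rot_zero, affOne]

/-- The `dz`-coefficient of the Maurer-Cartan form of the special unitary part of the frame. -/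
noncomputable def frameZ (U : ℂ → Aff ℝ) (β : ℂ → ℝ) (z : ℂ) : Matrix (Fin 4) (Fin 4) ℂ :=
  (mcZ (fun w => complexify (U w)) z).1 - (dZ (fun w => (β w : ℂ)) z / 2) • Li ℂ

/-- The `dz̄`-coefficient of the Maurer-Cartan form of the special unitary part of the frame. -/
noncomputable def frameZbar (U : ℂ → Aff ℝ) (β : ℂ → ℝ) (z : ℂ) : Matrix (Fin 4) (Fin 4) ℂ :=
  (mcZbar (fun w => complexify (U w)) z).1 - (dZbar (fun w => (β w : ℂ)) z / 2) • Li ℂ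

theorem hasMDeriv_frame (hΩ : IsOpen Ω) (hU : IsLCLI Ω z₀ U) (hβ : ContDiffOn ℝ ∞ β Ω) {z : ℂ}
    (hz : z ∈ Ω) : HasMDeriv (frame U β) (frame U β z * frameZ U β z)
      (frame U β z * frameZbar U β z) z := by
  have hb := hasFDerivAt_lin_of_differentiableAt (hasFDerivAt_ofReal_comp hΩ hβ hz)
  have hv : HasFDerivAt (fun w => -((β w : ℂ) / 2)) (lin (-(dZ (fun w => (β w : ℂ)) z / 2))
      (-(dZbar (fun w => (β w : ℂ)) z / 2))) z := by
    have := hb.const_mul (-1 / 2 : ℂ)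
    rw [smul_lin] at this
    refine (this.congr_of_eventuallyEq (Eventually.of_forall fun w => by ring)).congr_fderiv ?_
    congr 1 <;> ring
  have hL : ∀ c : ℂ, ∀ ξ, (-c) • (Li ℂ * rot (-((β z : ℂ) / 2))) * (complexify (U z)).1 +
      rot (-((β z : ℂ) / 2)) * ((complexify (U z)).1 * ξ) = frame U β z * (ξ - c • Li ℂ) := by
    intro c ξ
    have h : Li ℂ * rot (-((β z : ℂ) / 2)) * (complexify (U z)).1 = frame U β z * Li ℂ := by
      rw [frame_commute_Li hU hz, frame, Matrix.mul_assoc]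
    rw [smul_mul_assoc, h, ← Matrix.mul_assoc, mul_sub, mul_smul_comm, frame]
    module
  exact ((HasMDeriv.rot hv).mul (hasMDeriv_mc hΩ hU.smooth hU.mem hz).1).congr_deriv
    (hL _ _) (hL _ _)

/-- Differentiate RL_j = L_jR and cancel R. -/
theorem frameZ_commute_Lj (hΩ : IsOpen Ω) (hU : IsLCLI Ω z₀ U)
    (hβ : IsLagrangianAngle Ω z₀ (fun z => (U z).2) β) {z : ℂ} (hz : z ∈ Ω) :
    frameZ U β z * Lj ℂ = Lj ℂ * frameZ U β z ∧
      frameZbar U β z * Lj ℂ = Lj ℂ * frameZbar U β z := by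
  have hR := hasMDeriv_frame hΩ hU hβ.smooth hz
  have h1 := hR.mul (HasMDeriv.const (Lj ℂ) z)
  have h2 := (HasMDeriv.const (Lj ℂ) z).mul hR
  obtain ⟨e1, e2⟩ := (h1.congr_on hΩ hz fun w hw => frame_commute_Lj hU hβ hw).unique h2
  simp only [Matrix.mul_zero, Matrix.zero_mul, add_zero, zero_add] at e1 e2
  have key : ∀ ξ, frame U β z * ξ * Lj ℂ = Lj ℂ * (frame U β z * ξ) → ξ * Lj ℂ = Lj ℂ * ξ := by
    intro ξ h
    rw [← Matrix.mul_assoc, ← frame_commute_Lj hU hβ hz, Matrix.mul_assoc, Matrix.mul_assoc] at h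
    have := congrArg (fun M => (frame U β z)ᵀ * M) h
    simpa only [← Matrix.mul_assoc, frame_orthogonal hU hz, Matrix.one_mul] using this
  exact ⟨key _ e1, key _ e2⟩

theorem frameZ_transpose (hΩ : IsOpen Ω) (hU : IsLCLI Ω z₀ U) (hβ : ContDiffOn ℝ ∞ β Ω) {z : ℂ}
    (hz : z ∈ Ω) : (frameZ U β z)ᵀ = -frameZ U β z ∧ (frameZbar U β z)ᵀ = -frameZbar U β z := by
  have hR := hasMDeriv_frame hΩ hU hβ hz
  have h1 := hR.transpose.mul hR
  obtain ⟨e1, e2⟩ := (h1.congr_on hΩ hz fun w hw => frame_orthogonal hU hw).unique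
    (HasMDeriv.const 1 z)
  simp only [Matrix.transpose_mul, Matrix.mul_assoc, frame_orthogonal hU hz, Matrix.mul_one] at e1 e2
  simp only [← Matrix.mul_assoc, frame_orthogonal hU hz, Matrix.one_mul] at e1 e2
  exact ⟨eq_neg_of_add_eq_zero_left e1, eq_neg_of_add_eq_zero_left e2⟩

/-- L_jL_iL_j = L_i, whereas L_jPL_j = -P when P commutes with L_j. -/
theorem half_add_conj_Lj {c : ℂ} {ξ P : Matrix (Fin 4) (Fin 4) ℂ} (hξ : ξ = c • Li ℂ + P)
    (hP : P * Lj ℂ = Lj ℂ * P) : (1 / 2 : ℂ) • (ξ + Lj ℂ * ξ * Lj ℂ) = c • Li ℂ ∧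
      (1 / 2 : ℂ) • (ξ - Lj ℂ * ξ * Lj ℂ) = P := by
  have h : Lj ℂ * ξ * Lj ℂ = c • Li ℂ - P := by
    rw [hξ, mul_add, ← hP, mul_smul_comm, Lj_mul_Li, add_mul, Matrix.mul_assoc, Lj_mul_Lj,
      smul_mul_assoc, neg_mul, Matrix.mul_assoc, Lj_mul_Lj]
    simp [sub_eq_add_neg]
  rw [h, hξ]
  constructor <;> module

/-- The coefficient of `λ⁻¹ dz` in the translation part of the extended Maurer-Cartan form. -/
noncomputable def formA (U : ℂ → Aff ℝ) (z : ℂ) : Fin 4 → ℂ :=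
  (tauProj (-1) (mcZ (fun w => complexify (U w)) z)).2

/-- The coefficient of `λ dz̄` in the translation part of the extended Maurer-Cartan form. -/
noncomputable def formB (U : ℂ → Aff ℝ) (z : ℂ) : Fin 4 → ℂ :=
  (tauProj 1 (mcZbar (fun w => complexify (U w)) z)).2

theorem Lj_formA (z : ℂ) : Lj ℂ *ᵥ formA U z = I • formA U z := by
  rw [formA, tauProj_neg_one]
  simp only [Matrix.mulVec_smul, Matrix.mulVec_sub, Lj_mulVec_Lj]
  rw [smul_comm I, smul_sub I, smul_smul, I_mul_I]
  module

theorem Lj_formB (z : ℂ) : Lj ℂ *ᵥ formB U z = -(I • formB U z) := by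
  rw [formB, tauProj_one]
  simp only [Matrix.mulVec_smul, Matrix.mulVec_add, Lj_mulVec_Lj]
  rw [smul_comm I, smul_add I, smul_smul, I_mul_I]
  module

/-- The L_i part of F⁻¹dF lies in the (-1)-eigenspace of τ and the special unitary part in the fixed
space, so only the former acquires a power of λ. -/
theorem extZ_eq (hΩ : IsOpen Ω) (hU : IsLCLI Ω z₀ U)
    (hβ : IsLagrangianAngle Ω z₀ (fun z => (U z).2) β) (l : Circle) {z : ℂ} (hz : z ∈ Ω) :
    extZ U l z = (((l : ℂ)⁻¹ ^ 2 * (dZ (fun w => (β w : ℂ)) z / 2)) • Li ℂ + frameZ U β z,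
      (l : ℂ)⁻¹ • formA U z) := by
  obtain ⟨h1, h2⟩ := half_add_conj_Lj (ξ := (mcZ (fun w => complexify (U w)) z).1)
    (c := dZ (fun w => (β w : ℂ)) z / 2) (P := frameZ U β z)
    (by rw [frameZ]; abel) (frameZ_commute_Lj hΩ hU hβ hz).1
  have e : (l : ℂ) ^ (-2 : ℤ) = (l : ℂ)⁻¹ ^ 2 := by rw [zpow_neg, zpow_ofNat, inv_pow]
  rw [extZ, formA, tauProj_two, tauProj_zero, h1, h2, e, zpow_neg_one]
  refine Prod.ext ?_ ?_
  · simp [tauProj_neg_one, smul_smul]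
  · simp

theorem extZbar_eq (hΩ : IsOpen Ω) (hU : IsLCLI Ω z₀ U)
    (hβ : IsLagrangianAngle Ω z₀ (fun z => (U z).2) β) (l : Circle) {z : ℂ} (hz : z ∈ Ω) :
    extZbar U l z = (((l : ℂ) ^ 2 * (dZbar (fun w => (β w : ℂ)) z / 2)) • Li ℂ + frameZbar U β z,
      (l : ℂ) • formB U z) := by
  obtain ⟨h1, h2⟩ := half_add_conj_Lj (ξ := (mcZbar (fun w => complexify (U w)) z).1)
    (c := dZbar (fun w => (β w : ℂ)) z / 2) (P := frameZbar U β z)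
    (by rw [frameZbar]; abel) (frameZ_commute_Lj hΩ hU hβ hz).2
  rw [extZbar, formB, tauProj_two, tauProj_zero, h1, h2]
  refine Prod.ext ?_ ?_
  · simp [tauProj_one, smul_smul, add_comm]
  · simp

/-- The rotation part of the extended lift relative to the special unitary part of the frame. -/
noncomputable def relRot (U : ℂ → Aff ℝ) (E : Circle → ℂ → Aff ℝ) (β : ℂ → ℝ) (l : Circle) (z : ℂ) :
    Matrix (Fin 4) (Fin 4) ℂ := (complexify (E l z)).1 * (frame U β z)ᵀ

theorem frame_transpose_commute_Li (hU : IsLCLI Ω z₀ U) {z : ℂ} (hz : z ∈ Ω) :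
    (frame U β z)ᵀ * Li ℂ = Li ℂ * (frame U β z)ᵀ := by
  have := congrArg Matrix.transpose (frame_commute_Li (β := β) hU hz)
  simp only [Matrix.transpose_mul, Li_transpose, neg_mul, mul_neg, neg_inj] at this
  exact this.symm

theorem relRot_commute_Li (hU : IsLCLI Ω z₀ U) (hE : IsExtendedLift Ω z₀ U E) (l : Circle) {z : ℂ}
    (hz : z ∈ Ω) : relRot U E β l z * Li ℂ = Li ℂ * relRot U E β l z := by
  rw [relRot, Matrix.mul_assoc, frame_transpose_commute_Li hU hz, ← Matrix.mul_assoc,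
    (complexify_mem (hE.mem l z hz)).2, Matrix.mul_assoc]

theorem relRot_base (hU : IsLCLI Ω z₀ U) (hE : IsExtendedLift Ω z₀ U E) (hβ : β z₀ = 0)
    (l : Circle) : relRot U E β l z₀ = 1 := by
  rw [relRot, frame_base hU hβ, hE.base, complexify_affOne]
  simp [affOne]

/-- The special unitary parts of F_λ and R have the same Maurer-Cartan form and cancel in the
quotient, which leaves an abelian equation. -/
theorem hasMDeriv_relRot (hΩ : IsOpen Ω) (hU : IsLCLI Ω z₀ U) (hE : IsExtendedLift Ω z₀ U E)
    (hβ : IsLagrangianAngle Ω z₀ (fun z => (U z).2) β) (l : Circle) {z : ℂ} (hz : z ∈ Ω) :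
    HasMDeriv (relRot U E β l)
      (((l : ℂ)⁻¹ ^ 2 * (dZ (fun w => (β w : ℂ)) z / 2)) • (relRot U E β l z * Li ℂ))
      (((l : ℂ) ^ 2 * (dZbar (fun w => (β w : ℂ)) z / 2)) • (relRot U E β l z * Li ℂ)) z := by
  have h1 := (hasMDeriv_mc hΩ (hE.smooth l) (hE.mem l) hz).1
  rw [hE.eqZ l z hz, hE.eqZbar l z hz, extZ_eq hΩ hU hβ l hz, extZbar_eq hΩ hU hβ l hz] at h1
  have h2 := (hasMDeriv_frame hΩ hU hβ.smooth hz).transpose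
  obtain ⟨t1, t2⟩ := frameZ_transpose hΩ hU hβ.smooth hz
  rw [Matrix.transpose_mul, Matrix.transpose_mul, t1, t2] at h2
  have key : ∀ (G : Matrix (Fin 4) (Fin 4) ℂ) (c : ℂ) P, G * (c • Li ℂ + P) * (frame U β z)ᵀ +
      G * (-P * (frame U β z)ᵀ) = c • (G * (frame U β z)ᵀ * Li ℂ) := by
    intro G c P
    rw [Matrix.mul_assoc G _ (Li ℂ), frame_transpose_commute_Li hU hz]
    simp only [mul_add, add_mul, mul_smul_comm, smul_mul_assoc, neg_mul, mul_neg, Matrix.mul_assoc]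
    abel
  exact (h1.mul h2).congr_deriv (key _ _ _) (key _ _ _)

end Frame

/-! ### The harmonic conjugate of the Lagrangian angle -/

theorem hasFDerivAt_conj_lin {f : ℂ → ℂ} {p q z : ℂ} (hf : HasFDerivAt f (lin p q) z) :
    HasFDerivAt (fun w => (starRingEnd ℂ) (f w)) (lin ((starRingEnd ℂ) q) ((starRingEnd ℂ) p)) z := by
  have h := (conjCLE : ℂ →L[ℝ] ℂ).hasFDerivAt.comp z hf
  refine h.congr_fderiv ?_
  ext; simp [add_comm]

/-- A continuous logarithm of a differentiable function is locally a branch: by continuity the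
imaginary part of f w - f z stays within π, where `log_exp` applies. -/
theorem hasDerivAt_of_exp_comp {f h : ℂ → ℂ} {h' z : ℂ} (hf : ContinuousAt f z)
    (he : ∀ᶠ w in 𝓝 z, exp (f w) = h w) (hh : HasDerivAt h h' z) :
    HasDerivAt f (h' / h z) z := by
  have hz : exp (f z) = h z := he.self_of_nhds
  have h0 : h z ≠ 0 := hz ▸ exp_ne_zero _
  have h1 : HasDerivAt (fun w => f z + log (h w / h z)) (h' / h z) z := by
    have := ((hh.div_const (h z)).clog (by rw [div_self h0]; exact one_mem_slitPlane)).const_add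
      (f z)
    rwa [div_self h0, div_one] at this
  refine h1.congr_of_eventuallyEq ?_
  filter_upwards [he, hf.eventually (ball_mem_nhds (f z) Real.pi_pos)] with w hw hb
  have him : |(f w - f z).im| < Real.pi :=
    (abs_im_le_norm _).trans_lt (by rwa [dist_eq_norm] at hb)
  rw [← hw, ← hz, ← exp_sub, log_exp (by linarith [(abs_lt.1 him).1]) (abs_lt.1 him).2.le]
  ring

theorem contDiffOn_real_of_differentiableOn {Ω : Set ℂ} (hΩ : IsOpen Ω) {f : ℂ → ℂ}
    (hf : DifferentiableOn ℂ f Ω) : ContDiffOn ℝ ∞ f Ω :=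
  (hf.contDiffOn hΩ).restrict_scalars ℝ

section Conjugate

variable {Ω : Set ℂ} {z₀ : ℂ} {U : ℂ → Aff ℝ} {E : Circle → ℂ → Aff ℝ} {β : ℂ → ℝ}

/-- The integrability of the extended Maurer-Cartan form at `λ = exp (iπ/4)` provides the function
`exp ((β + iγ)/2)`. -/
theorem exists_holomorphic_exp (hΩ : IsOpen Ω) (hc : IsPreconnected Ω) (hz₀ : z₀ ∈ Ω)
    (hU : IsLCLI Ω z₀ U) (hE : IsExtendedLift Ω z₀ U E)
    (hβ : IsLagrangianAngle Ω z₀ (fun z => (U z).2) β) :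
    ∃ h : ℂ → ℂ, ∀ z ∈ Ω, HasDerivAt h (dZ (fun w => (β w : ℂ)) z * h z) z ∧
      ‖h z‖ = Real.exp (β z / 2) := by
  set κ : Circle := Circle.exp (Real.pi / 4)
  have hκ : (κ : ℂ) ^ 2 = I := by
    rw [Circle.coe_exp, ← exp_nat_mul]
    convert exp_pi_div_two_mul_I using 2
    push_cast; ring
  have hκ' : (κ : ℂ)⁻¹ ^ 2 = -I := by rw [inv_pow, hκ, inv_I]
  -- Replacing S by S L_i multiplies S₀₀ + iS₁₀ by i, so the matrix equation becomes ds = s(∂β -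
  -- ∂̄β)/2.
  set s : ℂ → ℂ := fun z => relRot U E β κ z 0 0 + I * relRot U E β κ z 1 0 with hs
  have hsd : ∀ z ∈ Ω, HasFDerivAt s (lin (dZ (fun w => (β w : ℂ)) z / 2 * s z)
      (-(dZbar (fun w => (β w : ℂ)) z / 2) * s z)) z := by
    intro z hz
    have h := hasMDeriv_relRot hΩ hU hE hβ κ hz
    obtain ⟨a1, a2, -⟩ := entries_of_mul_Li_comm (relRot_commute_Li (β := β) hU hE κ hz)
    have b0 : (relRot U E β κ z * Li ℂ) 0 0 = -relRot U E β κ z 1 0 := by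
      rw [← a1]; simp [Matrix.mul_apply, Li, Fin.sum_univ_four]
    have b1 : (relRot U E β κ z * Li ℂ) 1 0 = relRot U E β κ z 0 0 := by
      rw [← a2]; simp [Matrix.mul_apply, Li, Fin.sum_univ_four]
    refine ((h 0 0).add ((h 1 0).const_mul I)).congr_fderiv ?_
    rw [smul_lin, lin_add_lin, hκ, hκ']
    simp only [Matrix.smul_apply, smul_eq_mul, b0, b1, hs]
    congr 1
    · linear_combination (-(dZ (fun w => (β w : ℂ)) z / 2 * relRot U E β κ z 0 0)) * I_sq
    · linear_combination (dZbar (fun w => (β w : ℂ)) z / 2 * relRot U E β κ z 0 0) * I_sq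
  -- As β is real, (∂β - ∂̄β)/2 is imaginary, so |s| is constant.
  have hnorm : ∀ z ∈ Ω, s z * (starRingEnd ℂ) (s z) = 1 := by
    intro z hz
    have := eq_of_lin_zero hΩ hc (f := fun z => s z * (starRingEnd ℂ) (s z)) (fun w hw => ?_) hz hz₀
    · rw [this]
      simp [hs, relRot_base hU hE hβ.base]
    · refine (hasFDerivAt_mul_lin (hsd w hw) (hasFDerivAt_conj_lin (hsd w hw))).congr_fderiv ?_
      have hb := dZbar_ofReal ((hβ.smooth.differentiableOn (by simp)).differentiableAt
        (hΩ.mem_nhds hw))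
      rw [hb]
      simp only [map_mul, map_neg, map_div₀, Complex.conj_conj, map_ofNat]
      congr 1 <;> ring
  -- Multiplication by e^{β/2} cancels the dz̄ part and doubles the dz part.
  refine ⟨fun z => s z * exp (β z / 2), fun z hz => ⟨?_, ?_⟩⟩
  · apply hasDerivAt_of_lin
    have hb := hasFDerivAt_lin_of_differentiableAt (hasFDerivAt_ofReal_comp hΩ hβ.smooth hz)
    have he := hasFDerivAt_comp_lin (g := fun v => exp (v / 2)) (f := fun w => (β w : ℂ))
      (((hasDerivAt_id _).div_const 2).cexp) hb
    refine (hasFDerivAt_mul_lin (hsd z hz) he).congr_fderiv ?_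
    congr 1 <;> ring
  · have h1 : ‖s z‖ = 1 := by
      have := congrArg norm (hnorm z hz)
      rw [norm_mul, RCLike.norm_conj, norm_one] at this
      nlinarith [norm_nonneg (s z)]
    rw [norm_mul, h1, one_mul, norm_exp]
    simp

/-- On the simply connected Ω the function of `exists_holomorphic_exp` has a logarithm f, with f' =
∂β/∂z and, from the modulus, Re f = β/2. Then γ is 2 Im f, normalized at z₀. -/
theorem exists_isHarmonicConjugate (hΩ : IsOpen Ω) (hΩsc : IsSimplyConnected Ω) (hz₀ : z₀ ∈ Ω)
    (hU : IsLCLI Ω z₀ U) (hE : IsExtendedLift Ω z₀ U E)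
    (hβ : IsLagrangianAngle Ω z₀ (fun z => (U z).2) β) :
    ∃ γ : ℂ → ℝ, IsHarmonicConjugate Ω z₀ β γ := by
  obtain ⟨h, hh⟩ := exists_holomorphic_exp hΩ hΩsc.isPathConnected.isConnected.isPreconnected hz₀
    hU hE hβ
  have hne : ∀ z ∈ Ω, h z ≠ 0 := fun z hz h0 => by
    have := (hh z hz).2
    rw [h0, norm_zero] at this
    exact (Real.exp_pos _).ne this
  obtain ⟨f, hfc, hf⟩ := exists_continuousOn_eqOn_exp_comp hΩsc hΩ (g := h)
    (fun z hz => (hh z hz).1.continuousAt.continuousWithinAt)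
    (by rintro ⟨z, hz, h0⟩; exact hne z hz h0)
  have hfd : ∀ z ∈ Ω, HasDerivAt f (dZ (fun w => (β w : ℂ)) z) z := fun z hz => by
    have := hasDerivAt_of_exp_comp (hfc.continuousAt (hΩ.mem_nhds hz))
      (eventually_of_mem (hΩ.mem_nhds hz) fun w hw => hf hw) (hh z hz).1
    rwa [mul_div_cancel_right₀ _ (hne z hz)] at this
  have hre : ∀ z ∈ Ω, (f z).re = β z / 2 := fun z hz => by
    have h1 := (hh z hz).2
    have h2 : exp (f z) = h z := hf hz
    rw [← h2, norm_exp] at h1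
    exact Real.exp_injective h1
  have hfd' : DifferentiableOn ℂ f Ω := fun z hz => (hfd z hz).differentiableAt.differentiableWithinAt
  have key : ∀ z ∈ Ω, HasFDerivAt
      (fun w => ((β w : ℂ) + I * ((2 * ((f w).im - (f z₀).im) : ℝ) : ℂ)) / 2)
      (lin (dZ (fun w => (β w : ℂ)) z) 0) z := fun z hz => by
    refine (hasFDerivAt_lin_of_hasDerivAt ((hfd z hz).sub_const
      (I * (f z₀).im))).congr_of_eventuallyEq ?_
    filter_upwards [hΩ.mem_nhds hz] with w hw
    apply Complex.ext
    · simp [hre w hw]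
    · simp
  refine ⟨fun z => 2 * ((f z).im - (f z₀).im), ?_, by simp, fun z hz => dZ_eq_of_lin (key z hz),
    fun z hz => dZbar_eq_of_lin (key z hz)⟩
  exact contDiffOn_const.mul
    ((imCLM.contDiff.comp_contDiffOn (contDiffOn_real_of_differentiableOn hΩ hfd')).sub
      contDiffOn_const)

end Conjugate

/-! ### Linear maps acting on loops of vectors -/

/-- The Fourier coefficients of a loop of vectors. -/
noncomputable def vecCoeff (v : Circle → Fin 4 → ℂ) (k : ℤ) : Fin 4 → ℂ :=
  fun p => loopCoeff (fun m => v m p) k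

section Linear

variable {v : Circle → Fin 4 → ℂ}

theorem vecCoeff_mulVec (hv : ∀ p, Continuous fun l => v l p) (M : Matrix (Fin 4) (Fin 4) ℂ)
    (k : ℤ) : vecCoeff (fun l => M *ᵥ v l) k = M *ᵥ vecCoeff v k := by
  ext p
  simp only [vecCoeff, Matrix.mulVec, dotProduct, Fin.sum_univ_four]
  have hc : ∀ j, Continuous fun l => M p j * v l j := fun j => continuous_const.mul (hv j)
  have h2 : Continuous fun l => M p 0 * v l 0 + M p 1 * v l 1 := (hc 0).add (hc 1)
  have h3 : Continuous fun l => M p 0 * v l 0 + M p 1 * v l 1 + M p 2 * v l 2 := h2.add (hc 2)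
  refine (loopCoeff_add h3 (hc 3) k).trans ?_
  rw [loopCoeff_const_mul]
  refine congrArg (· + _) ((loopCoeff_add h2 (hc 2) k).trans ?_)
  rw [loopCoeff_const_mul]
  refine congrArg (· + _) ((loopCoeff_add (hc 0) (hc 1) k).trans ?_)
  rw [loopCoeff_const_mul, loopCoeff_const_mul]

theorem vecCoeff_mul_left (m : Circle) (v : Circle → Fin 4 → ℂ) (k : ℤ) :
    vecCoeff (fun l => v (m * l)) k = (m : ℂ) ^ k • vecCoeff v k := by
  ext p
  exact loopCoeff_mul_left m (fun l => v l p) k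

theorem Qminus_eq (v : Circle → Fin 4 → ℂ) (l : Circle) (p : Fin 4) : Qminus v l p =
    ∑' n : ℕ, vecCoeff v (-((n : ℤ) + 1)) p * (l : ℂ) ^ (-((n : ℤ) + 1)) := rfl

theorem Qplus_eq (v : Circle → Fin 4 → ℂ) (l : Circle) (p : Fin 4) : Qplus v l p =
    ∑' n : ℕ, vecCoeff v (n : ℤ) p * (l : ℂ) ^ (n : ℤ) := rfl

theorem summable_vecCoeff_mul (hv : ∀ p, LoopHol fun l => v l p) {i : ℕ → ℤ}
    (hi : Function.Injective i) (l : Circle) (p : Fin 4) :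
    Summable fun n => vecCoeff v (i n) p * (l : ℂ) ^ (i n) :=
  (hasSum_loopCoeff (hv p).continuous (hv p).summable l).summable.comp_injective hi

theorem tsum_mulVec (hv : ∀ p, LoopHol fun l => v l p) (M : Matrix (Fin 4) (Fin 4) ℂ) {i : ℕ → ℤ}
    (hi : Function.Injective i) (l : Circle) (p : Fin 4) :
    ∑' n, vecCoeff (fun l => M *ᵥ v l) (i n) p * (l : ℂ) ^ (i n) =
      (M *ᵥ fun p => ∑' n, vecCoeff v (i n) p * (l : ℂ) ^ (i n)) p := by
  simp only [vecCoeff_mulVec (fun p => (hv p).continuous), Matrix.mulVec, dotProduct,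
    Finset.sum_mul]
  rw [Summable.tsum_finsetSum]
  · refine Finset.sum_congr rfl fun j _ => ?_
    rw [← tsum_mul_left]
    simp only [mul_assoc]
  · intro j _
    simp only [mul_assoc]
    exact (summable_vecCoeff_mul hv hi l j).mul_left _

theorem injective_neg_succ : Function.Injective fun n : ℕ => -((n : ℤ) + 1) := fun a b hab => by
  simpa using hab

theorem Qminus_mulVec (hv : ∀ p, LoopHol fun l => v l p) (M : Matrix (Fin 4) (Fin 4) ℂ)
    (l : Circle) : Qminus (fun l => M *ᵥ v l) l = M *ᵥ Qminus v l :=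
  funext fun p => tsum_mulVec hv M injective_neg_succ l p

theorem Qplus_mulVec (hv : ∀ p, LoopHol fun l => v l p) (M : Matrix (Fin 4) (Fin 4) ℂ)
    (l : Circle) : Qplus (fun l => M *ᵥ v l) l = M *ᵥ Qplus v l :=
  funext fun p => tsum_mulVec hv M Nat.cast_injective l p

theorem Qminus_mul_left (m : Circle) (v : Circle → Fin 4 → ℂ) (l : Circle) :
    Qminus v (m * l) = Qminus (fun l => v (m * l)) l := by
  ext p
  rw [Qminus_eq, Qminus_eq]
  refine tsum_congr fun n => ?_
  rw [vecCoeff_mul_left, Circle.coe_mul, mul_zpow, Pi.smul_apply, smul_eq_mul]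
  ring

theorem Qplus_mul_left (m : Circle) (v : Circle → Fin 4 → ℂ) (l : Circle) :
    Qplus v (m * l) = Qplus (fun l => v (m * l)) l := by
  ext p
  rw [Qplus_eq, Qplus_eq]
  refine tsum_congr fun n => ?_
  rw [vecCoeff_mul_left, Circle.coe_mul, mul_zpow, Pi.smul_apply, smul_eq_mul]
  ring

theorem Qminus_add_Qplus (hv : ∀ p, LoopHol fun l => v l p) (l : Circle) :
    Qminus v l + Qplus v l = v l :=
  funext fun p => (hv p).tsum_neg_add_tsum_nonneg l

end Linear

theorem proj_eq_mulVec (σ : ℂ) (V : Fin 4 → ℂ) : proj σ V = (1 - σ • Li ℂ) *ᵥ V := by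
  rw [proj, Matrix.sub_mulVec, Matrix.one_mulVec, Matrix.smul_mulVec]

theorem proj_apply (σ : ℂ) (V : Fin 4 → ℂ) (p : Fin 4) :
    proj σ V p = V p - σ * (Li ℂ *ᵥ V) p := rfl

theorem HasVDeriv.proj {V : ℂ → Fin 4 → ℂ} {P Q : Fin 4 → ℂ} {z : ℂ} (σ : ℂ)
    (h : HasVDeriv V P Q z) : HasVDeriv (fun w => proj σ (V w)) (proj σ P) (proj σ Q) z := by
  have h1 := (HasMDeriv.const (1 - σ • Li ℂ) z).mulVec h
  simp only [Matrix.zero_mulVec, zero_add, ← proj_eq_mulVec] at h1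
  exact h1

theorem half_proj_add_proj (V : Fin 4 → ℂ) (p : Fin 4) :
    (1 / 2 : ℂ) * (proj I V p + proj (-I) V p) = V p := by
  rw [proj_apply, proj_apply]; ring

/-! ### The extended lift in terms of the harmonic conjugate -/

/-- The function `(β + iγ) / 4`. -/
noncomputable def quarter (β γ : ℂ → ℝ) (z : ℂ) : ℂ := ((β z : ℂ) + I * γ z) / 4

section Lift

variable {Ω : Set ℂ} {z₀ : ℂ} {U : ℂ → Aff ℝ} {E : Circle → ℂ → Aff ℝ} {β γ : ℂ → ℝ}

theorem hasDerivAt_quarter (hΩ : IsOpen Ω) (hβ : ContDiffOn ℝ ∞ β Ω)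
    (hγ : IsHarmonicConjugate Ω z₀ β γ) {z : ℂ} (hz : z ∈ Ω) :
    HasDerivAt (quarter β γ) (dZ (fun w => (β w : ℂ)) z / 2) z := by
  have hd : DifferentiableAt ℝ (fun w => ((β w : ℂ) + I * γ w) / 2) z :=
    ((hasFDerivAt_ofReal_comp hΩ hβ hz).add
      ((hasFDerivAt_ofReal_comp hΩ hγ.smooth hz).const_mul I)).mul_const _
  have h := hasFDerivAt_lin_of_differentiableAt hd
  rw [hγ.eqZ z hz, hγ.eqZbar z hz] at h
  have h2 := (hasDerivAt_of_lin h).div_const 2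
  refine h2.congr_of_eventuallyEq (Eventually.of_forall fun w => ?_)
  simp only [quarter]; ring

theorem quarter_base (hβ : β z₀ = 0) (hγ : γ z₀ = 0) : quarter β γ z₀ = 0 := by
  simp [quarter, hβ, hγ]

/-- The function `λ⁻² u + λ² ū` with `u = (β + iγ) / 4`. -/
noncomputable def phase (β γ : ℂ → ℝ) (l : Circle) (z : ℂ) : ℂ :=
  (l : ℂ)⁻¹ ^ 2 * quarter β γ z + (l : ℂ) ^ 2 * (starRingEnd ℂ) (quarter β γ z)

theorem hasFDerivAt_phase (hΩ : IsOpen Ω) (hβ : ContDiffOn ℝ ∞ β Ω)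
    (hγ : IsHarmonicConjugate Ω z₀ β γ) (l : Circle) {z : ℂ} (hz : z ∈ Ω) :
    HasFDerivAt (phase β γ l) (lin ((l : ℂ)⁻¹ ^ 2 * (dZ (fun w => (β w : ℂ)) z / 2))
      ((l : ℂ) ^ 2 * (dZbar (fun w => (β w : ℂ)) z / 2))) z := by
  have h := hasFDerivAt_lin_of_hasDerivAt (hasDerivAt_quarter hΩ hβ hγ hz)
  refine ((h.const_mul ((l : ℂ)⁻¹ ^ 2)).add
    ((hasFDerivAt_conj_lin h).const_mul ((l : ℂ) ^ 2))).congr_fderiv ?_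
  rw [smul_lin, smul_lin, lin_add_lin, dZbar_ofReal ((hβ.differentiableOn (by simp)).differentiableAt
    (hΩ.mem_nhds hz)), map_div₀, map_ofNat, map_zero, mul_zero, mul_zero, add_zero, zero_add]

/-- `relRot` and exp(phase · L_i) solve the same equation with the same initial value, so their
quotient is constant. -/
theorem extendedLift_rotation (hΩ : IsOpen Ω) (hc : IsPreconnected Ω) (hz₀ : z₀ ∈ Ω)
    (hU : IsLCLI Ω z₀ U) (hE : IsExtendedLift Ω z₀ U E)
    (hβ : IsLagrangianAngle Ω z₀ (fun z => (U z).2) β) (hγ : IsHarmonicConjugate Ω z₀ β γ)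
    (l : Circle) {z : ℂ} (hz : z ∈ Ω) :
    (complexify (E l z)).1 = rot (phase β γ l z) * frame U β z := by
  have h1 : relRot U E β l z * rot (-phase β γ l z) = 1 := by
    have := HasMDeriv.eq_of_zero (M := fun z => relRot U E β l z * rot (-phase β γ l z)) hΩ hc
      (fun w hw => ?_) hz hz₀
    · rw [this, relRot_base hU hE hβ.base, phase, quarter_base hβ.base hγ.base]
      simp [rot_zero]
    · have hv := (hasFDerivAt_phase hΩ hβ.smooth hγ l hw).neg
      have hv' : HasFDerivAt (fun w => -phase β γ l w)
          (lin (-((l : ℂ)⁻¹ ^ 2 * (dZ (fun w => (β w : ℂ)) w / 2)))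
          (-((l : ℂ) ^ 2 * (dZbar (fun w => (β w : ℂ)) w / 2)))) w := by
        refine hv.congr_fderiv ?_
        ext; simp; ring
      refine ((hasMDeriv_relRot hΩ hU hE hβ l hw).mul (HasMDeriv.rot hv')).congr_deriv ?_ ?_ <;>
      · rw [smul_mul_assoc, mul_smul_comm, neg_smul, Matrix.mul_assoc, add_neg_cancel]
  have h2 : relRot U E β l z = rot (phase β γ l z) := by
    calc relRot U E β l z
        = relRot U E β l z * (rot (-phase β γ l z) * rot (phase β γ l z)) := by
          rw [rot_neg_mul_rot, Matrix.mul_one]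
      _ = rot (phase β γ l z) := by rw [← Matrix.mul_assoc, h1, Matrix.one_mul]
  rw [← h2, relRot, Matrix.mul_assoc, frame_orthogonal hU hz, Matrix.mul_one]

/-- The `dz`-form `R α₋₁'` transported to the special unitary frame. -/
noncomputable def frameA (U : ℂ → Aff ℝ) (β : ℂ → ℝ) (z : ℂ) : Fin 4 → ℂ :=
  frame U β z *ᵥ formA U z

/-- The `dz̄`-form `R α₁''` transported to the special unitary frame. -/
noncomputable def frameB (U : ℂ → Aff ℝ) (β : ℂ → ℝ) (z : ℂ) : Fin 4 → ℂ :=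
  frame U β z *ᵥ formB U z

theorem Lj_frameA (hU : IsLCLI Ω z₀ U) (hβ : IsLagrangianAngle Ω z₀ (fun z => (U z).2) β) {z : ℂ}
    (hz : z ∈ Ω) : Lj ℂ *ᵥ frameA U β z = I • frameA U β z := by
  rw [frameA, Matrix.mulVec_mulVec, ← frame_commute_Lj hU hβ hz, ← Matrix.mulVec_mulVec, Lj_formA,
    Matrix.mulVec_smul]

theorem Lj_frameB (hU : IsLCLI Ω z₀ U) (hβ : IsLagrangianAngle Ω z₀ (fun z => (U z).2) β) {z : ℂ}
    (hz : z ∈ Ω) : Lj ℂ *ᵥ frameB U β z = -(I • frameB U β z) := by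
  rw [frameB, Matrix.mulVec_mulVec, ← frame_commute_Lj hU hβ hz, ← Matrix.mulVec_mulVec, Lj_formB,
    Matrix.mulVec_neg, Matrix.mulVec_smul]

theorem hasVDeriv_extendedLift (hΩ : IsOpen Ω) (hc : IsPreconnected Ω) (hz₀ : z₀ ∈ Ω)
    (hU : IsLCLI Ω z₀ U) (hE : IsExtendedLift Ω z₀ U E)
    (hβ : IsLagrangianAngle Ω z₀ (fun z => (U z).2) β) (hγ : IsHarmonicConjugate Ω z₀ β γ)
    (l : Circle) {z : ℂ} (hz : z ∈ Ω) :
    HasVDeriv (fun w => (complexify (E l w)).2)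
      (rot (phase β γ l z) *ᵥ ((l : ℂ)⁻¹ • frameA U β z))
      (rot (phase β γ l z) *ᵥ ((l : ℂ) • frameB U β z)) z := by
  have h1 := (hasMDeriv_mc hΩ (hE.smooth l) (hE.mem l) hz).2
  rw [hE.eqZ l z hz, hE.eqZbar l z hz, extZ_eq hΩ hU hβ l hz, extZbar_eq hΩ hU hβ l hz,
    extendedLift_rotation hΩ hc hz₀ hU hE hβ hγ l hz] at h1
  simpa only [frameA, frameB, ← Matrix.mulVec_mulVec, Matrix.mulVec_smul] using h1

theorem continuousOn_dZ_ofReal (hΩ : IsOpen Ω) {f : ℂ → ℝ} (hf : ContDiffOn ℝ ∞ f Ω) :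
    ContinuousOn (dZ fun w => (f w : ℂ)) Ω ∧ ContinuousOn (dZbar fun w => (f w : ℂ)) Ω := by
  have h : ContDiffOn ℝ ∞ (fun w => (f w : ℂ)) Ω := ofRealCLM.contDiff.comp_contDiffOn hf
  have h' := h.continuousOn_fderiv_of_isOpen hΩ (by simp)
  have hv : ∀ v : ℂ, ContinuousOn (fun z => fderiv ℝ (fun w => (f w : ℂ)) z v) Ω := fun v =>
    h'.clm_apply continuousOn_const
  exact ⟨((hv 1).sub (continuousOn_const.mul (hv I))).div_const 2,
    ((hv 1).add (continuousOn_const.mul (hv I))).div_const 2⟩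

theorem continuousOn_mulVec {M : ℂ → Matrix (Fin 4) (Fin 4) ℂ} {V : ℂ → Fin 4 → ℂ}
    (hM : ∀ p q, ContinuousOn (fun z => M z p q) Ω) (hV : ∀ p, ContinuousOn (fun z => V z p) Ω)
    (p : Fin 4) : ContinuousOn (fun z => (M z *ᵥ V z) p) Ω := by
  simp only [Matrix.mulVec, dotProduct]
  exact continuousOn_finsetSum _ fun j _ => (hM p j).mul (hV j)

theorem continuousOn_proj (σ : ℂ) {V : ℂ → Fin 4 → ℂ}
    (hV : ∀ p, ContinuousOn (fun z => V z p) Ω) (p : Fin 4) :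
    ContinuousOn (fun z => proj σ (V z) p) Ω :=
  (hV p).sub (continuousOn_const.mul
    (continuousOn_mulVec (M := fun _ => Li ℂ) (fun _ _ => continuousOn_const) hV p))

theorem continuousOn_mc_snd (hΩ : IsOpen Ω) (hU : SmoothOn Ω U) (hm : ∀ z ∈ Ω, U z ∈ affGroup ℝ)
    (p : Fin 4) : ContinuousOn (fun z => (mcZ (fun w => complexify (U w)) z).2 p) Ω ∧
      ContinuousOn (fun z => (mcZbar (fun w => complexify (U w)) z).2 p) Ω := by
  have hT : ∀ p q, ContinuousOn (fun z => ((complexify (U z)).1⁻¹) p q) Ω := fun p q => by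
    refine ContinuousOn.congr (f := fun z => ((U z).1 q p : ℂ))
      (continuous_ofReal.comp_continuousOn (hU.1 q p).continuousOn) fun z hz => ?_
    simp only [affGroup.inv_eq (complexify_mem (hm z hz))]
    rfl
  exact ⟨continuousOn_mulVec hT (fun p => (continuousOn_dZ_ofReal hΩ (hU.2 p)).1) p,
    continuousOn_mulVec hT (fun p => (continuousOn_dZ_ofReal hΩ (hU.2 p)).2) p⟩

theorem continuousOn_frameA_frameB (hΩ : IsOpen Ω) (hU : IsLCLI Ω z₀ U) (hβ : ContDiffOn ℝ ∞ β Ω)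
    (p : Fin 4) : ContinuousOn (fun z => frameA U β z p) Ω ∧
      ContinuousOn (fun z => frameB U β z p) Ω := by
  have hR : ∀ p q, ContinuousOn (fun z => frame U β z p q) Ω := fun p q z hz =>
    (hasMDeriv_frame hΩ hU hβ hz p q).continuousAt.continuousWithinAt
  have hmc := continuousOn_mc_snd hΩ hU.smooth hU.mem
  have hcst : ∀ p q, ContinuousOn (fun _ : ℂ => Lj ℂ p q) Ω := fun p q => continuousOn_const
  refine ⟨continuousOn_mulVec hR (fun q => ?_) p, continuousOn_mulVec hR (fun q => ?_) p⟩
  · simp only [formA, tauProj_neg_one]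
    exact continuousOn_const.mul ((hmc q).1.sub (continuousOn_const.mul
      (continuousOn_mulVec hcst (fun p => (hmc p).1) q)))
  · simp only [formB, tauProj_one]
    exact continuousOn_const.mul ((hmc q).2.add (continuousOn_const.mul
      (continuousOn_mulVec hcst (fun p => (hmc p).2) q)))

/-- Each eigencomponent of X_λ under L_i turns the matrix exponential into a scalar one. -/
theorem isSpectralFamily_proj (hΩ : IsOpen Ω) (hc : IsPreconnected Ω) (hz₀ : z₀ ∈ Ω)
    (hU : IsLCLI Ω z₀ U) (hE : IsExtendedLift Ω z₀ U E)
    (hβ : IsLagrangianAngle Ω z₀ (fun z => (U z).2) β) (hγ : IsHarmonicConjugate Ω z₀ β γ)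
    {σ : ℂ} (hσ : σ ^ 2 = -1) (p : Fin 4) :
    IsSpectralFamily Ω z₀ σ (quarter β γ) (fun z => proj σ (frameA U β z) p)
      (fun z => proj σ (frameB U β z) p) (fun l z => proj σ (complexify (E l z)).2 p) where
  isOpen := hΩ
  isPreconnected := hc
  mem := hz₀
  differentiableOn z hz :=
    (hasDerivAt_quarter hΩ hβ.smooth hγ hz).differentiableAt.differentiableWithinAt
  continuousOn_left :=
    continuousOn_proj σ (fun p => (continuousOn_frameA_frameB hΩ hU hβ.smooth p).1) p
  continuousOn_right :=
    continuousOn_proj σ (fun p => (continuousOn_frameA_frameB hΩ hU hβ.smooth p).2) p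
  base l := by
    rw [hE.base, complexify_affOne, proj_apply, affOne, Matrix.mulVec_zero, Pi.zero_apply, mul_zero,
      sub_zero]
    rfl
  hasFDerivAt l z hz := by
    have h := (hasVDeriv_extendedLift hΩ hc hz₀ hU hE hβ hγ l hz).proj σ p
    have e : ∀ (c : ℂ) (V : Fin 4 → ℂ), proj σ (rot (phase β γ l z) *ᵥ (c • V)) p =
        kexp σ l (quarter β γ z) * (c * proj σ V p) := fun c V => by
      rw [proj_rot hσ, Pi.smul_apply, smul_eq_mul, proj_apply, proj_apply, Matrix.mulVec_smul,
        Pi.smul_apply, Pi.smul_apply, smul_eq_mul, smul_eq_mul, kexp, phase]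
      ring
    rw [e, e] at h
    exact h

theorem innerLoop_eq (z : ℂ) (l : Circle) : innerLoop β γ E z l =
    rot (-((l : ℂ)⁻¹ ^ 2 * quarter β γ z)) *ᵥ (complexify (E l z)).2 := by
  rw [innerLoop, rotExp_eq, neg_one_mul]; rfl

theorem gauge_proj {σ : ℂ} (hσ : σ ^ 2 = -1) (p : Fin 4) (l : Circle) (z : ℂ) :
    IsSpectralFamily.gauge σ (quarter β γ) (fun l z => proj σ (complexify (E l z)).2 p) l z =
      proj σ (innerLoop β γ E z l) p := by
  rw [innerLoop_eq, proj_rot hσ, IsSpectralFamily.gauge, Pi.smul_apply, smul_eq_mul]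
  congr 2; ring

theorem neg_I_sq : (-I) ^ 2 = -1 := by simp

theorem loopHol_innerLoop (hΩ : IsOpen Ω) (hc : IsPreconnected Ω) (hz₀ : z₀ ∈ Ω)
    (hU : IsLCLI Ω z₀ U) (hE : IsExtendedLift Ω z₀ U E)
    (hβ : IsLagrangianAngle Ω z₀ (fun z => (U z).2) β) (hγ : IsHarmonicConjugate Ω z₀ β γ)
    {z : ℂ} (hz : z ∈ Ω) (p : Fin 4) : LoopHol fun l => innerLoop β γ E z l p := by
  have h1 := (isSpectralFamily_proj hΩ hc hz₀ hU hE hβ hγ I_sq p).loopHol_gauge hz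
  have h2 := (isSpectralFamily_proj hΩ hc hz₀ hU hE hβ hγ neg_I_sq p).loopHol_gauge hz
  simp only [gauge_proj I_sq, gauge_proj neg_I_sq] at h1 h2
  have := (LoopHol.const (1 / 2)).mul (h1.add h2)
  simpa only [half_proj_add_proj] using this

theorem phase_circleI_mul (l : Circle) (z : ℂ) : phase β γ (circleI * l) z = -phase β γ l z := by
  have h : ((circleI : Circle) : ℂ) = I := rfl
  rw [phase, Circle.coe_mul, h, phase, mul_inv, mul_pow, mul_pow, inv_pow, I_sq]
  ring_nf

/-- Both sides have the same differential and vanish at z₀: λ ↦ iλ changes the sign of the phase,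
L_j reverses the rotation, and the dz and dz̄ forms are eigenvectors of L_j with eigenvalues i and
-i. -/
theorem extendedLift_twisted (hΩ : IsOpen Ω) (hc : IsPreconnected Ω) (hz₀ : z₀ ∈ Ω)
    (hU : IsLCLI Ω z₀ U) (hE : IsExtendedLift Ω z₀ U E)
    (hβ : IsLagrangianAngle Ω z₀ (fun z => (U z).2) β) (hγ : IsHarmonicConjugate Ω z₀ β γ)
    (l : Circle) {z : ℂ} (hz : z ∈ Ω) :
    (complexify (E (circleI * l) z)).2 = -(Lj ℂ *ᵥ (complexify (E l z)).2) := by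
  have hI : ((circleI : Circle) : ℂ) = I := rfl
  rw [eq_neg_iff_add_eq_zero]
  ext p
  have h0 := eq_of_lin_zero hΩ hc (f := fun z => ((complexify (E (circleI * l) z)).2 +
    Lj ℂ *ᵥ (complexify (E l z)).2) p) (fun w hw => ?_) hz hz₀
  · rw [h0, hE.base, hE.base, complexify_affOne]
    simp [affOne]
  · have h1 := hasVDeriv_extendedLift hΩ hc hz₀ hU hE hβ hγ (circleI * l) hw
    have h2 := (HasMDeriv.const (Lj ℂ) w).mulVec
      (hasVDeriv_extendedLift hΩ hc hz₀ hU hE hβ hγ l hw)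
    refine ((h1 p).add (h2 p)).congr_fderiv ?_
    rw [lin_add_lin, phase_circleI_mul]
    simp only [Matrix.zero_mulVec, zero_add, Lj_mulVec_rot, ← Pi.add_apply, ← Matrix.mulVec_add]
    rw [Matrix.mulVec_smul, Matrix.mulVec_smul, Lj_frameA hU hβ hw, Lj_frameB hU hβ hw,
      Circle.coe_mul, hI, mul_inv, inv_I]
    have e1 : (-I * (l : ℂ)⁻¹) • frameA U β w + (l : ℂ)⁻¹ • I • frameA U β w = 0 := by module
    have e2 : (I * (l : ℂ)) • frameB U β w + (l : ℂ) • -(I • frameB U β w) = 0 := by module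
    rw [e1, e2, Matrix.mulVec_zero]
    rfl

theorem innerLoop_twisted (hΩ : IsOpen Ω) (hc : IsPreconnected Ω) (hz₀ : z₀ ∈ Ω)
    (hU : IsLCLI Ω z₀ U) (hE : IsExtendedLift Ω z₀ U E)
    (hβ : IsLagrangianAngle Ω z₀ (fun z => (U z).2) β) (hγ : IsHarmonicConjugate Ω z₀ β γ)
    (l : Circle) {z : ℂ} (hz : z ∈ Ω) :
    innerLoop β γ E z (circleI * l) = -(Lj ℂ *ᵥ innerLoop β γ E z l) := by
  have hI : ((circleI : Circle) : ℂ) = I := rfl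
  rw [innerLoop_eq, innerLoop_eq, extendedLift_twisted hΩ hc hz₀ hU hE hβ hγ l hz, Lj_mulVec_rot,
    Matrix.mulVec_neg]
  congr 4
  rw [Circle.coe_mul, hI, mul_inv, mul_pow, inv_pow, I_sq]
  ring

end Lift

/-! ### Twisted loops -/

theorem coe_circleI : ((circleI : Circle) : ℂ) = I := rfl

section Twisted

variable {v : Circle → Fin 4 → ℂ}

theorem twisted_eq (ht : ∀ l, v (circleI * l) = -(Lj ℂ *ᵥ v l)) :
    (fun l => v (circleI * l)) = fun l => (-Lj ℂ) *ᵥ v l :=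
  funext fun l => by rw [ht, Matrix.neg_mulVec]

theorem vecCoeff_twisted (hv : ∀ p, LoopHol fun l => v l p)
    (ht : ∀ l, v (circleI * l) = -(Lj ℂ *ᵥ v l)) (k : ℤ) :
    I ^ k • vecCoeff v k = -(Lj ℂ *ᵥ vecCoeff v k) := by
  rw [← coe_circleI, ← vecCoeff_mul_left, twisted_eq ht,
    vecCoeff_mulVec (fun p => (hv p).continuous), Matrix.neg_mulVec]

/-- Twisting makes the constant term an eigenvector of L_j with eigenvalue -1, while L_j² = -1. -/
theorem vecCoeff_zero_of_twisted (hv : ∀ p, LoopHol fun l => v l p)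
    (ht : ∀ l, v (circleI * l) = -(Lj ℂ *ᵥ v l)) : vecCoeff v 0 = 0 := by
  have h := vecCoeff_twisted hv ht 0
  rw [zpow_zero, one_smul] at h
  have h2 := Lj_mulVec_Lj (vecCoeff v 0)
  have h3 : Lj ℂ *ᵥ vecCoeff v 0 = -vecCoeff v 0 := by rw [h, neg_neg, ← h]
  rw [h3, Matrix.mulVec_neg, h3, neg_neg] at h2
  exact self_eq_neg.1 h2

theorem Lj_vecCoeff_one (hv : ∀ p, LoopHol fun l => v l p)
    (ht : ∀ l, v (circleI * l) = -(Lj ℂ *ᵥ v l)) :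
    Lj ℂ *ᵥ vecCoeff v 1 = -(I • vecCoeff v 1) := by
  rw [← zpow_one I, vecCoeff_twisted hv ht, neg_neg]

theorem Qminus_twisted (hv : ∀ p, LoopHol fun l => v l p)
    (ht : ∀ l, v (circleI * l) = -(Lj ℂ *ᵥ v l)) (l : Circle) :
    Qminus v (circleI * l) = -(Lj ℂ *ᵥ Qminus v l) := by
  rw [Qminus_mul_left, twisted_eq ht, Qminus_mulVec hv, Matrix.neg_mulVec]

theorem Qplus_twisted (hv : ∀ p, LoopHol fun l => v l p)
    (ht : ∀ l, v (circleI * l) = -(Lj ℂ *ᵥ v l)) (l : Circle) :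
    Qplus v (circleI * l) = -(Lj ℂ *ᵥ Qplus v l) := by
  rw [Qplus_mul_left, twisted_eq ht, Qplus_mulVec hv, Matrix.neg_mulVec]

end Twisted

/-! ### Loops with entire extensions belong to the twisted loop groups -/

theorem rot_apply (c : ℂ) (p q : Fin 4) :
    rot c p q = cos c * (1 : Matrix (Fin 4) (Fin 4) ℂ) p q + sin c * Li ℂ p q := rfl

theorem differentiable_rot {f : ℂ → ℂ} (hf : Differentiable ℂ f) (p q : Fin 4) :
    Differentiable ℂ fun w => rot (f w) p q := by
  simp only [rot_apply]
  exact (hf.ccos.mul_const _).add (hf.csin.mul_const _)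

theorem differentiable_mul {M N : ℂ → Matrix (Fin 4) (Fin 4) ℂ}
    (hM : ∀ p q, Differentiable ℂ fun w => M w p q) (hN : ∀ p q, Differentiable ℂ fun w => N w p q)
    (p q : Fin 4) : Differentiable ℂ fun w => (M w * N w) p q := by
  simp only [Matrix.mul_apply]
  exact Differentiable.fun_sum fun j _ => (hM p j).mul (hN j q)

theorem differentiable_mulVec {M : ℂ → Matrix (Fin 4) (Fin 4) ℂ} {V : ℂ → Fin 4 → ℂ}
    (hM : ∀ p q, Differentiable ℂ fun w => M w p q) (hV : ∀ p, Differentiable ℂ fun w => V w p)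
    (p : Fin 4) : Differentiable ℂ fun w => (M w *ᵥ V w) p := by
  simp only [Matrix.mulVec, dotProduct]
  exact Differentiable.fun_sum fun j _ => (hM p j).mul (hV j)

theorem isHolomorphicOnDisk_of_differentiable {H : ℂ → Aff ℂ}
    (h1 : ∀ p q, Differentiable ℂ fun w => (H w).1 p q)
    (h2 : ∀ p, Differentiable ℂ fun w => (H w).2 p) (hm : ∀ w, H w ∈ affGroup ℂ) :
    IsHolomorphicOnDisk H :=
  ⟨fun p q => (h1 p q).diffContOnCl, fun p => (h2 p).diffContOnCl, fun w _ => hm w⟩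

theorem mem_loopMinus_of_entire (s : ℝ) {g : Circle → Aff ℂ} {H : ℂ → Aff ℂ}
    (h1 : ∀ p q, Differentiable ℂ fun w => (H w).1 p q)
    (h2 : ∀ p, Differentiable ℂ fun w => (H w).2 p) (hm : ∀ w, H w ∈ affGroup ℂ)
    (h0 : H 0 = affOne ℂ) (hg : ∀ l : Circle, H (l : ℂ)⁻¹ = g l)
    (ht : ∀ l, g (circleI * l) = tau (g l)) : g ∈ loopMinus s := by
  refine ⟨⟨fun p q => ?_, fun p => ?_, fun l => hg l ▸ hm _, ht⟩, H,
    isHolomorphicOnDisk_of_differentiable h1 h2 hm, h0, hg⟩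
  · simp only [← hg]
    exact (LoopHol.of_entire_inv (h1 p q)).isHs s
  · simp only [← hg]
    exact (LoopHol.of_entire_inv (h2 p)).isHs s

theorem mem_loopPlus_of_entire (s : ℝ) {g : Circle → Aff ℂ} {H : ℂ → Aff ℂ}
    (h1 : ∀ p q, Differentiable ℂ fun w => (H w).1 p q)
    (h2 : ∀ p, Differentiable ℂ fun w => (H w).2 p) (hm : ∀ w, H w ∈ affGroup ℂ)
    (hg : ∀ l : Circle, H l = g l) (ht : ∀ l, g (circleI * l) = tau (g l)) : g ∈ loopPlus s := by
  refine ⟨⟨fun p q => ?_, fun p => ?_, fun l => hg l ▸ hm _, ht⟩, H,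
    isHolomorphicOnDisk_of_differentiable h1 h2 hm, hg⟩
  · simp only [← hg]
    exact (LoopHol.of_entire (h1 p q)).isHs s
  · simp only [← hg]
    exact (LoopHol.of_entire (h2 p)).isHs s

theorem neg_Lj_rot_Lj (c : ℂ) : -(Lj ℂ * rot c * Lj ℂ) = rot (-c) := by
  rw [Lj_mul_rot, Matrix.mul_assoc, Lj_mul_Lj, mul_neg, Matrix.mul_one, neg_neg]

theorem neg_Lj_rot_mul_Lj (c : ℂ) {R : Matrix (Fin 4) (Fin 4) ℂ} (hR : R * Lj ℂ = Lj ℂ * R) :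
    -(Lj ℂ * (rot c * R) * Lj ℂ) = rot (-c) * R := by
  rw [← Matrix.mul_assoc, Matrix.mul_assoc _ R, hR, ← Matrix.mul_assoc, ← neg_Lj_rot_Lj, neg_mul]

/-! ### The two factors -/

section Factors

variable {Ω : Set ℂ} {z₀ : ℂ} {U : ℂ → Aff ℝ} {E : Circle → ℂ → Aff ℝ} {β γ : ℂ → ℝ}

theorem Uminus_eq (z : ℂ) (l : Circle) : Uminus β γ E z l =
    (rot ((l : ℂ)⁻¹ ^ 2 * quarter β γ z),
      rot ((l : ℂ)⁻¹ ^ 2 * quarter β γ z) *ᵥ Qminus (innerLoop β γ E z) l) := by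
  rw [Uminus, rotExp_eq, one_mul]; rfl

/-- The prefactor removes the λ⁻² half of the phase; the remaining λ² half is entire in λ. -/
theorem Uplus_eq (hΩ : IsOpen Ω) (hc : IsPreconnected Ω) (hz₀ : z₀ ∈ Ω)
    (hU : IsLCLI Ω z₀ U) (hE : IsExtendedLift Ω z₀ U E)
    (hβ : IsLagrangianAngle Ω z₀ (fun z => (U z).2) β) (hγ : IsHarmonicConjugate Ω z₀ β γ)
    {z : ℂ} (hz : z ∈ Ω) (l : Circle) : Uplus β γ E z l =
    (rot ((l : ℂ) ^ 2 * (starRingEnd ℂ) (quarter β γ z)) * frame U β z,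
      Qplus (innerLoop β γ E z) l) := by
  rw [Uplus, rotExp_eq, extendedLift_rotation hΩ hc hz₀ hU hE hβ hγ l hz, ← Matrix.mul_assoc,
    rot_mul_rot]
  congr 3
  rw [phase, quarter]
  ring

theorem circleI_mul_sq (l : Circle) : ((circleI * l : Circle) : ℂ) ^ 2 = -(l : ℂ) ^ 2 := by
  rw [Circle.coe_mul, coe_circleI, mul_pow, I_sq, neg_one_mul]

theorem circleI_mul_inv_sq (l : Circle) : ((circleI * l : Circle) : ℂ)⁻¹ ^ 2 = -(l : ℂ)⁻¹ ^ 2 := by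
  rw [inv_pow, circleI_mul_sq, inv_neg, inv_pow]

theorem innerLoop_mem_loopVec (s : ℝ) (hΩ : IsOpen Ω) (hc : IsPreconnected Ω) (hz₀ : z₀ ∈ Ω)
    (hU : IsLCLI Ω z₀ U) (hE : IsExtendedLift Ω z₀ U E)
    (hβ : IsLagrangianAngle Ω z₀ (fun z => (U z).2) β) (hγ : IsHarmonicConjugate Ω z₀ β γ)
    {z : ℂ} (hz : z ∈ Ω) : innerLoop β γ E z ∈ loopVec s :=
  ⟨fun p => (loopHol_innerLoop hΩ hc hz₀ hU hE hβ hγ hz p).isHs s,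
    fun l => innerLoop_twisted hΩ hc hz₀ hU hE hβ hγ l hz⟩

theorem Uminus_mem_loopMinus (s : ℝ) (hΩ : IsOpen Ω) (hc : IsPreconnected Ω) (hz₀ : z₀ ∈ Ω)
    (hU : IsLCLI Ω z₀ U) (hE : IsExtendedLift Ω z₀ U E)
    (hβ : IsLagrangianAngle Ω z₀ (fun z => (U z).2) β) (hγ : IsHarmonicConjugate Ω z₀ β γ)
    {z : ℂ} (hz : z ∈ Ω) : Uminus β γ E z ∈ loopMinus s := by
  have hY := loopHol_innerLoop hΩ hc hz₀ hU hE hβ hγ hz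
  choose N hNd hN0 hN using fun p => (hY p).exists_negPart
  have hr : ∀ p q, Differentiable ℂ fun w : ℂ => rot (w ^ 2 * quarter β γ z) p q :=
    differentiable_rot ((differentiable_id.pow 2).mul_const _)
  refine mem_loopMinus_of_entire s
    (H := fun w => (rot (w ^ 2 * quarter β γ z), rot (w ^ 2 * quarter β γ z) *ᵥ fun p => N p w))
    hr (differentiable_mulVec hr hNd) (fun w => rot_mem_affGroup _ _) ?_ (fun l => ?_) fun l => ?_
  · simp only [hN0, zero_pow two_ne_zero, zero_mul, rot_zero, affOne]
    exact Prod.ext rfl (Matrix.mulVec_zero (1 : Matrix (Fin 4) (Fin 4) ℂ))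
  · simp only [hN, Uminus_eq]
    rfl
  · simp only [Uminus_eq, tau, circleI_mul_inv_sq, neg_Lj_rot_Lj, neg_mul, Lj_mulVec_rot,
      Qminus_twisted hY (fun l => innerLoop_twisted hΩ hc hz₀ hU hE hβ hγ l hz),
      Matrix.mulVec_neg]

theorem Uplus_mem_loopPlus (s : ℝ) (hΩ : IsOpen Ω) (hc : IsPreconnected Ω) (hz₀ : z₀ ∈ Ω)
    (hU : IsLCLI Ω z₀ U) (hE : IsExtendedLift Ω z₀ U E)
    (hβ : IsLagrangianAngle Ω z₀ (fun z => (U z).2) β) (hγ : IsHarmonicConjugate Ω z₀ β γ)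
    {z : ℂ} (hz : z ∈ Ω) : Uplus β γ E z ∈ loopPlus s := by
  have hY := loopHol_innerLoop hΩ hc hz₀ hU hE hβ hγ hz
  choose N hNd hN using fun p => (hY p).exists_posPart
  have hr : ∀ p q, Differentiable ℂ fun w : ℂ =>
      (rot (w ^ 2 * (starRingEnd ℂ) (quarter β γ z)) * frame U β z) p q :=
    differentiable_mul (differentiable_rot ((differentiable_id.pow 2).mul_const _))
      fun _ _ => differentiable_const _
  refine mem_loopPlus_of_entire s (H := fun w =>
    (rot (w ^ 2 * (starRingEnd ℂ) (quarter β γ z)) * frame U β z, fun p => N p w))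
    hr hNd (fun w => ⟨?_, ?_⟩) (fun l => ?_) fun l => ?_
  · rw [Matrix.transpose_mul, rot_transpose, Matrix.mul_assoc, ← Matrix.mul_assoc (rot _),
      rot_neg_mul_rot, Matrix.one_mul, frame_orthogonal hU hz]
  · rw [Matrix.mul_assoc, frame_commute_Li hU hz, ← Matrix.mul_assoc, rot_mul_Li, Matrix.mul_assoc]
  · simp only [hN, Uplus_eq hΩ hc hz₀ hU hE hβ hγ hz]
    rfl
  · simp only [Uplus_eq hΩ hc hz₀ hU hE hβ hγ hz, tau, circleI_mul_sq, neg_mul,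
      Qplus_twisted hY (fun l => innerLoop_twisted hΩ hc hz₀ hU hE hβ hγ l hz),
      neg_Lj_rot_mul_Lj _ (frame_commute_Lj hU hβ hz)]

/-- The two exponentials cancel, and Q⁻ + Q⁺ is the identity on the inner loop. -/
theorem affMul_Uminus_Uplus (hΩ : IsOpen Ω) (hc : IsPreconnected Ω) (hz₀ : z₀ ∈ Ω)
    (hU : IsLCLI Ω z₀ U) (hE : IsExtendedLift Ω z₀ U E)
    (hβ : IsLagrangianAngle Ω z₀ (fun z => (U z).2) β) (hγ : IsHarmonicConjugate Ω z₀ β γ)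
    {z : ℂ} (hz : z ∈ Ω) (l : Circle) :
    complexify (E l z) = affMul (Uminus β γ E z l) (Uplus β γ E z l) := by
  have h : rotExp 1 β γ l z * rotExp (-1) β γ l z = 1 := by
    rw [rotExp_eq, rotExp_eq, neg_one_mul, one_mul, rot_mul_rot_neg]
  refine Prod.ext ?_ ?_
  · simp only [affMul, Uminus, Uplus]
    rw [← Matrix.mul_assoc, h, Matrix.one_mul]
  · simp only [affMul, Uminus, Uplus]
    rw [← Matrix.mulVec_add, add_comm (Qplus _ _),
      Qminus_add_Qplus (loopHol_innerLoop hΩ hc hz₀ hU hE hβ hγ hz), innerLoop,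
      Matrix.mulVec_mulVec, h, Matrix.one_mulVec]

/-! ### The Maurer-Cartan form of the holomorphic factor -/

theorem negSum_proj (hΩ : IsOpen Ω) (hc : IsPreconnected Ω) (hz₀ : z₀ ∈ Ω)
    (hU : IsLCLI Ω z₀ U) (hE : IsExtendedLift Ω z₀ U E)
    (hβ : IsLagrangianAngle Ω z₀ (fun z => (U z).2) β) (hγ : IsHarmonicConjugate Ω z₀ β γ)
    {σ : ℂ} (hσ : σ ^ 2 = -1) {z : ℂ} (hz : z ∈ Ω) (l : Circle) (p : Fin 4) :
    IsSpectralFamily.negSum σ (quarter β γ) (fun l z => proj σ (complexify (E l z)).2 p) l z =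
      proj σ (Qminus (innerLoop β γ E z) l) p := by
  rw [proj_eq_mulVec, ← Qminus_mulVec (loopHol_innerLoop hΩ hc hz₀ hU hE hβ hγ hz)]
  simp only [IsSpectralFamily.negSum, gauge_proj hσ, ← proj_eq_mulVec]
  rfl

theorem loopCoeff_gauge_proj (hΩ : IsOpen Ω) (hc : IsPreconnected Ω) (hz₀ : z₀ ∈ Ω)
    (hU : IsLCLI Ω z₀ U) (hE : IsExtendedLift Ω z₀ U E)
    (hβ : IsLagrangianAngle Ω z₀ (fun z => (U z).2) β) (hγ : IsHarmonicConjugate Ω z₀ β γ)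
    {σ : ℂ} (hσ : σ ^ 2 = -1) {z : ℂ} (hz : z ∈ Ω) (k : ℤ) (p : Fin 4) :
    loopCoeff (fun m => IsSpectralFamily.gauge σ (quarter β γ)
      (fun l z => proj σ (complexify (E l z)).2 p) m z) k =
      proj σ (vecCoeff (innerLoop β γ E z) k) p := by
  rw [proj_eq_mulVec, ← vecCoeff_mulVec
    fun p => (loopHol_innerLoop hΩ hc hz₀ hU hE hβ hγ hz p).continuous]
  simp only [gauge_proj hσ, ← proj_eq_mulVec]
  rfl

/-- The coefficient of `λ⁻¹ dz` in the translation part of the Maurer-Cartan form of `U⁻_λ`. -/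
noncomputable def potential (U : ℂ → Aff ℝ) (E : Circle → ℂ → Aff ℝ) (β γ : ℂ → ℝ) (z : ℂ) :
    Fin 4 → ℂ :=
  frameA U β z - (dZ (fun w => (β w : ℂ)) z / 2) • (Li ℂ *ᵥ vecCoeff (innerLoop β γ E z) 1)

/-- The scalar equation of `hasDerivAt_negSum` holds for σ = i and σ = -i; averaging them restores
L_i. -/
theorem hasDerivAt_Qminus (hΩ : IsOpen Ω) (hc : IsPreconnected Ω) (hz₀ : z₀ ∈ Ω)
    (hU : IsLCLI Ω z₀ U) (hE : IsExtendedLift Ω z₀ U E)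
    (hβ : IsLagrangianAngle Ω z₀ (fun z => (U z).2) β) (hγ : IsHarmonicConjugate Ω z₀ β γ)
    {z : ℂ} (hz : z ∈ Ω) (l : Circle) (p : Fin 4) :
    HasDerivAt (fun w => Qminus (innerLoop β γ E w) l p)
      (((l : ℂ)⁻¹ • potential U E β γ z - ((l : ℂ)⁻¹ ^ 2 * (dZ (fun w => (β w : ℂ)) z / 2)) •
        (Li ℂ *ᵥ Qminus (innerLoop β γ E z) l)) p) z := by
  have hd := (hasDerivAt_quarter hΩ hβ.smooth hγ hz).deriv
  -- This removes the λ⁻² boundary term, so the potential has a pure λ⁻¹ dependence.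
  have h0 := vecCoeff_zero_of_twisted (loopHol_innerLoop hΩ hc hz₀ hU hE hβ hγ hz)
    (fun l => innerLoop_twisted hΩ hc hz₀ hU hE hβ hγ l hz)
  have hσ : ∀ {σ : ℂ}, σ ^ 2 = -1 → HasDerivAt (fun w => proj σ (Qminus (innerLoop β γ E w) l) p)
      (-σ * (dZ (fun w => (β w : ℂ)) z / 2) * ((l : ℂ)⁻¹ ^ 2 *
        (proj σ (Qminus (innerLoop β γ E z) l) p) +
        (l : ℂ)⁻¹ * proj σ (vecCoeff (innerLoop β γ E z) 1) p) +
        (l : ℂ)⁻¹ * proj σ (frameA U β z) p) z := fun {σ} hσ => by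
    have h := (isSpectralFamily_proj hΩ hc hz₀ hU hE hβ hγ hσ p).hasDerivAt_negSum hz l
    rw [negSum_proj hΩ hc hz₀ hU hE hβ hγ hσ hz, loopCoeff_gauge_proj hΩ hc hz₀ hU hE hβ hγ hσ hz,
      loopCoeff_gauge_proj hΩ hc hz₀ hU hE hβ hγ hσ hz, hd, h0] at h
    have e0 : proj σ 0 p = 0 := by rw [proj_apply, Matrix.mulVec_zero]; simp
    rw [e0, add_zero] at h
    exact h.congr_of_eventuallyEq (eventuallyEq_of_mem (hΩ.mem_nhds hz) fun w hw =>
      (negSum_proj hΩ hc hz₀ hU hE hβ hγ hσ hw l p).symm)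
  have h := ((hσ I_sq).add (hσ neg_I_sq)).const_mul (1 / 2)
  have h' := h.congr_of_eventuallyEq (f₁ := fun w => Qminus (innerLoop β γ E w) l p)
    (Eventually.of_forall fun w => (half_proj_add_proj _ p).symm)
  refine h'.congr_deriv ?_
  simp only [potential, proj_apply, Pi.sub_apply, Pi.smul_apply, smul_eq_mul]
  linear_combination ((dZ (fun w => (β w : ℂ)) z / 2) * ((l : ℂ)⁻¹ ^ 2 *
    (Li ℂ *ᵥ Qminus (innerLoop β γ E z) l) p + (l : ℂ)⁻¹ *
    (Li ℂ *ᵥ vecCoeff (innerLoop β γ E z) 1) p)) * I_sq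

/-- Differentiating the exponential produces an L_iQ⁻ term that cancels the one in the derivative of
Q⁻. -/
theorem hasMDeriv_Uminus (hΩ : IsOpen Ω) (hc : IsPreconnected Ω) (hz₀ : z₀ ∈ Ω)
    (hU : IsLCLI Ω z₀ U) (hE : IsExtendedLift Ω z₀ U E)
    (hβ : IsLagrangianAngle Ω z₀ (fun z => (U z).2) β) (hγ : IsHarmonicConjugate Ω z₀ β γ)
    {z : ℂ} (hz : z ∈ Ω) (l : Circle) :
    HasMDeriv (fun w => (Uminus β γ E w l).1)
      (((l : ℂ)⁻¹ ^ 2 * (dZ (fun w => (β w : ℂ)) z / 2)) • (Li ℂ * (Uminus β γ E z l).1)) 0 z ∧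
    HasVDeriv (fun w => (Uminus β γ E w l).2)
      ((Uminus β γ E z l).1 *ᵥ ((l : ℂ)⁻¹ • potential U E β γ z)) 0 z := by
  have hv := (hasDerivAt_quarter hΩ hβ.smooth hγ hz).const_mul ((l : ℂ)⁻¹ ^ 2)
  have h1 := HasMDeriv.rot (hasFDerivAt_lin_of_hasDerivAt hv)
  have h2 : HasVDeriv (fun w => Qminus (innerLoop β γ E w) l)
      ((l : ℂ)⁻¹ • potential U E β γ z - ((l : ℂ)⁻¹ ^ 2 * (dZ (fun w => (β w : ℂ)) z / 2)) •
        (Li ℂ *ᵥ Qminus (innerLoop β γ E z) l)) 0 z := fun p =>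
    hasFDerivAt_lin_of_hasDerivAt (hasDerivAt_Qminus hΩ hc hz₀ hU hE hβ hγ hz l p)
  have h3 := h1.mulVec h2
  simp only [Uminus_eq]
  rw [zero_smul] at h1 h3
  refine ⟨h1, ?_⟩
  rw [Matrix.zero_mulVec, Matrix.mulVec_zero, add_zero, Matrix.mulVec_sub, Matrix.mulVec_smul _ _
    (Li ℂ *ᵥ _), Matrix.smul_mulVec, ← Matrix.mulVec_mulVec, Li_mulVec_rot, add_sub_cancel] at h3
  exact h3

theorem Lj_potential (hΩ : IsOpen Ω) (hc : IsPreconnected Ω) (hz₀ : z₀ ∈ Ω)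
    (hU : IsLCLI Ω z₀ U) (hE : IsExtendedLift Ω z₀ U E)
    (hβ : IsLagrangianAngle Ω z₀ (fun z => (U z).2) β) (hγ : IsHarmonicConjugate Ω z₀ β γ)
    {z : ℂ} (hz : z ∈ Ω) : Lj ℂ *ᵥ potential U E β γ z = I • potential U E β γ z := by
  rw [potential, Matrix.mulVec_sub, Lj_frameA hU hβ hz, Matrix.mulVec_smul, Lj_mulVec_Li,
    Lj_vecCoeff_one (loopHol_innerLoop hΩ hc hz₀ hU hE hβ hγ hz)
      (fun l => innerLoop_twisted hΩ hc hz₀ hU hE hβ hγ l hz), Matrix.mulVec_neg,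
    Matrix.mulVec_smul]
  module

/-- In the i-eigenspace of L_j the entries 0 and 1 are free and determine the others; the factors 2
undo the halves in `eps` and `epsBar`. -/
theorem eq_eps_add_epsBar {ξ : Fin 4 → ℂ} (h : Lj ℂ *ᵥ ξ = I • ξ) :
    ξ = (2 * ξ 0) • eps + (2 * ξ 1) • (Li ℂ *ᵥ epsBar) := by
  have h0 := congrFun h 0
  have h1 := congrFun h 1
  simp [Lj, Matrix.mulVec, dotProduct, Fin.sum_univ_four] at h0 h1
  ext p
  fin_cases p
  · simp [eps, epsBar, Li]
    ring
  · simp [eps, epsBar, Li]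
    ring
  · simp [eps, epsBar, Li]
    linear_combination -h0
  · simp [eps, epsBar, Li]
    linear_combination h1

/-- The potential does not depend on λ, so λ = 1 suffices: the translation T of U⁻₁ is holomorphic
with T' = e^{uL_i} times the potential, and both T' and e^{-uL_i} are holomorphic. -/
theorem differentiableOn_potential (hΩ : IsOpen Ω) (hc : IsPreconnected Ω) (hz₀ : z₀ ∈ Ω)
    (hU : IsLCLI Ω z₀ U) (hE : IsExtendedLift Ω z₀ U E)
    (hβ : IsLagrangianAngle Ω z₀ (fun z => (U z).2) β) (hγ : IsHarmonicConjugate Ω z₀ β γ)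
    (p : Fin 4) : DifferentiableOn ℂ (fun z => potential U E β γ z p) Ω := by
  have hT : ∀ q, ∀ z ∈ Ω, HasDerivAt (fun w => (Uminus β γ E w 1).2 q)
      ((rot (quarter β γ z) *ᵥ potential U E β γ z) q) z := fun q z hz => by
    have := hasDerivAt_of_lin ((hasMDeriv_Uminus hΩ hc hz₀ hU hE hβ hγ hz 1).2 q)
    rw [Uminus_eq, Circle.coe_one, inv_one, one_smul, one_pow, one_mul] at this
    exact this
  have hT' : ∀ q, DifferentiableOn ℂ (deriv fun w => (Uminus β γ E w 1).2 q) Ω := fun q =>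
    DifferentiableOn.deriv (fun z hz => (hT q z hz).differentiableAt.differentiableWithinAt) hΩ
  have hq : DifferentiableOn ℂ (fun z => -quarter β γ z) Ω := fun z hz =>
    (hasDerivAt_quarter hΩ hβ.smooth hγ hz).differentiableAt.neg.differentiableWithinAt
  refine DifferentiableOn.congr (f := fun z => ∑ j, rot (-quarter β γ z) p j *
    deriv (fun w => (Uminus β γ E w 1).2 j) z) ?_ fun z hz => ?_
  · refine DifferentiableOn.fun_sum fun j _ => DifferentiableOn.mul ?_ (hT' j)
    simp only [rot_apply]
    exact (hq.ccos.mul_const _).add (hq.csin.mul_const _)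
  · have : potential U E β γ z =
        rot (-quarter β γ z) *ᵥ fun q => deriv (fun w => (Uminus β γ E w 1).2 q) z := by
      simp only [(hT _ z hz).deriv]
      rw [Matrix.mulVec_mulVec, rot_neg_mul_rot, Matrix.one_mulVec]
    exact congrFun this p

theorem smoothOn_Uminus (hΩ : IsOpen Ω) (hc : IsPreconnected Ω) (hz₀ : z₀ ∈ Ω)
    (hU : IsLCLI Ω z₀ U) (hE : IsExtendedLift Ω z₀ U E)
    (hβ : IsLagrangianAngle Ω z₀ (fun z => (U z).2) β) (hγ : IsHarmonicConjugate Ω z₀ β γ)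
    (l : Circle) : SmoothOn Ω fun z => Uminus β γ E z l :=
  ⟨fun p q => contDiffOn_real_of_differentiableOn hΩ fun _ hz => (hasDerivAt_of_lin
    ((hasMDeriv_Uminus hΩ hc hz₀ hU hE hβ hγ hz l).1 p q)).differentiableAt.differentiableWithinAt,
  fun p => contDiffOn_real_of_differentiableOn hΩ fun _ hz => (hasDerivAt_of_lin
    ((hasMDeriv_Uminus hΩ hc hz₀ hU hE hβ hγ hz l).2 p)).differentiableAt.differentiableWithinAt⟩

theorem mc_Uminus (hΩ : IsOpen Ω) (hc : IsPreconnected Ω) (hz₀ : z₀ ∈ Ω)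
    (hU : IsLCLI Ω z₀ U) (hE : IsExtendedLift Ω z₀ U E)
    (hβ : IsLagrangianAngle Ω z₀ (fun z => (U z).2) β) (hγ : IsHarmonicConjugate Ω z₀ β γ)
    {z : ℂ} (hz : z ∈ Ω) (l : Circle) :
    mcZ (fun w => Uminus β γ E w l) z =
      (((l : ℂ) ^ (-2 : ℤ) / 2 * dZ (fun w => (β w : ℂ)) z) • Li ℂ,
        ((l : ℂ) ^ (-1 : ℤ)) • potential U E β γ z) ∧
    mcZbar (fun w => Uminus β γ E w l) z = 0 := by
  obtain ⟨h1, h2⟩ := hasMDeriv_Uminus hΩ hc hz₀ hU hE hβ hγ hz l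
  have hm : Uminus β γ E z l ∈ affGroup ℂ := by rw [Uminus_eq]; exact rot_mem_affGroup _ _
  have e1 : (l : ℂ) ^ (-2 : ℤ) = (l : ℂ)⁻¹ ^ 2 := by rw [zpow_neg, zpow_ofNat, inv_pow]
  refine ⟨?_, ?_⟩
  · simp only [mcZ, dZ_eq_of_lin (h1 _ _), dZ_eq_of_lin (h2 _), affGroup.inv_eq hm, e1,
      zpow_neg_one]
    refine Prod.ext ?_ ?_
    · change (Uminus β γ E z l).1ᵀ * (((l : ℂ)⁻¹ ^ 2 * (dZ (fun w => (β w : ℂ)) z / 2)) •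
        (Li ℂ * (Uminus β γ E z l).1)) = _
      rw [← hm.2, mul_smul_comm, ← Matrix.mul_assoc, hm.1, Matrix.one_mul]
      congr 1
      ring
    · change (Uminus β γ E z l).1ᵀ *ᵥ ((Uminus β γ E z l).1 *ᵥ _) = _
      rw [Matrix.mulVec_mulVec, hm.1, Matrix.one_mulVec]
  · simp only [mcZbar, dZbar_eq_of_lin (h1 _ _), dZbar_eq_of_lin (h2 _)]
    refine Prod.ext ?_ ?_
    · change (Uminus β γ E z l).1⁻¹ * 0 = 0
      rw [Matrix.mul_zero]
    · exact Matrix.mulVec_zero (Uminus β γ E z l).1⁻¹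

end Factors

end HSL

/-
The differential equations of the extended lift at each `λ` already force `β` to be harmonic, so
that the hypothesis `hstat` is implied by the existence of `E` and is not used below. All the loops
constructed are real analytic in `λ`, hence of class `H^s` for every `s`.
-/
theorem mainTheorem7 (s : ℝ) (hs : 1 / 2 < s)
    (Ω : Set ℂ) (hΩ : IsOpen Ω) (hΩsc : IsSimplyConnected Ω) (z₀ : ℂ) (hz₀ : z₀ ∈ Ω)
    (U : ℂ → HSL.Aff ℝ) (hU : HSL.IsLCLI Ω z₀ U)
    (hstat : HSL.IsHamiltonianStationary Ω (fun z => (U z).2))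
    (E : Circle → ℂ → HSL.Aff ℝ) (hE : HSL.IsExtendedLift Ω z₀ U E)
    (β : ℂ → ℝ) (hβ : HSL.IsLagrangianAngle Ω z₀ (fun z => (U z).2) β) :
    (∃ γ : ℂ → ℝ, HSL.IsHarmonicConjugate Ω z₀ β γ) ∧
    ∀ γ : ℂ → ℝ, HSL.IsHarmonicConjugate Ω z₀ β γ →
      (∀ z ∈ Ω,
        HSL.innerLoop β γ E z ∈ HSL.loopVec s ∧
        HSL.Uminus β γ E z ∈ HSL.loopMinus s ∧
        HSL.Uplus β γ E z ∈ HSL.loopPlus s ∧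
        (∀ l : Circle, HSL.complexify (E l z) =
          HSL.affMul (HSL.Uminus β γ E z l) (HSL.Uplus β γ E z l)) ∧
        ∀ A ∈ HSL.loopMinus s, ∀ B ∈ HSL.loopPlus s,
          (∀ l : Circle, HSL.complexify (E l z) = HSL.affMul (A l) (B l)) →
          A = HSL.Uminus β γ E z ∧ B = HSL.Uplus β γ E z) ∧
      ∃ a b : ℂ → ℂ, DifferentiableOn ℂ a Ω ∧ DifferentiableOn ℂ b Ω ∧
        ∀ l : Circle,
          HSL.SmoothOn Ω (fun z => HSL.Uminus β γ E z l) ∧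
          ∀ z ∈ Ω,
            HSL.mcZ (fun w => HSL.Uminus β γ E w l) z =
              (((l : ℂ) ^ (-2 : ℤ) / 2 * HSL.dZ (fun w => (β w : ℂ)) z) • HSL.Li ℂ,
                ((l : ℂ) ^ (-1 : ℤ)) •
                  (a z • HSL.eps + b z • (HSL.Li ℂ *ᵥ HSL.epsBar))) ∧
            HSL.mcZbar (fun w => HSL.Uminus β γ E w l) z = 0 := by
  have hc : IsPreconnected Ω := hΩsc.isPathConnected.isConnected.isPreconnected
  refine ⟨HSL.exists_isHarmonicConjugate hΩ hΩsc hz₀ hU hE hβ, fun γ hγ => ⟨fun z hz => ?_, ?_⟩⟩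
  · have hm := HSL.Uminus_mem_loopMinus s hΩ hc hz₀ hU hE hβ hγ hz
    have hp := HSL.Uplus_mem_loopPlus s hΩ hc hz₀ hU hE hβ hγ hz
    have hmp := HSL.affMul_Uminus_Uplus hΩ hc hz₀ hU hE hβ hγ hz
    exact ⟨HSL.innerLoop_mem_loopVec s hΩ hc hz₀ hU hE hβ hγ hz, hm, hp, hmp,
      fun A hA B hB h => HSL.factorization_unique hA hm hB hp fun l => (h l).symm.trans (hmp l)⟩
  · have hd := HSL.differentiableOn_potential hΩ hc hz₀ hU hE hβ hγ
    -- The witnesses are the coordinates of the potential in the basis ε, L_i ε̄ of the i-eigenspace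
    -- of L_j.
    refine ⟨fun z => 2 * HSL.potential U E β γ z 0, fun z => 2 * HSL.potential U E β γ z 1,
      (hd 0).const_mul 2, (hd 1).const_mul 2,
      fun l => ⟨HSL.smoothOn_Uminus hΩ hc hz₀ hU hE hβ hγ l, fun z hz => ?_⟩⟩
    rw [← HSL.eq_eps_add_epsBar (HSL.Lj_potential hΩ hc hz₀ hU hE hβ hγ hz)]
    exact HSL.mc_Uminus hΩ hc hz₀ hU hE hβ hγ hz l
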